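/- Let $E=\mathbb{C}/\Lambda$ be an elliptic curve over $\mathbb{C}$. A *simple $2$-branched cover* of $E$ is a pair $(C,f)$, where $C$ is a smooth projective complex curve (compact Riemann surface), possibly disconnected, and $f:C\to E$ is a holomorphic map such that every ramification point has ramification index $2$ and different ramification points have different images. Isomorphisms $(C,f)\cong(C',f')$ are biholomorphic maps $\varphi:C\to C'$ with $f'\circ\varphi=f$. The genus $g$ of a possibly disconnected curve $C$ is defined by $2g-2=\deg K_C$, so $2g-2=\sum_i(2g_i-2)$ if the components of $C$ have genera $g_i$. For every $g\ge 1$ choose a set of $2g-2$ different points of $E$ (the number of ramification points of a cover of genus $g$, by the Hurwitz formula). For $d\ge 1$ let $\hat X_{g,d}$ be the set of isomorphism classes of simple $2$-branched covers of $E$ of degree $d$ and genus $g$ whose set of branch points is the chosen set of $2g-2$ points, and let $X_{g,d}$ be defined in the same way with $C$ required to be connected; the choices of points used for $X_{g,d}$ and for $\hat X_{g,d}$ may be different. Then the sets $X_{g,d}$ and $\hat X_{g,d}$ and all the automorphism groups $\operatorname{Aut}(C,f)$ are finite, and with $$N_{g,d}=\sum_{(C,f)\in X_{g,d}}\frac1{|\operatorname{Aut}(C,f)|},\qquad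 \hat N_{g,d}=\sum_{(C,f)\in \hat X_{g,d}}\frac1{|\operatorname{Aut}(C,f)|},$$ $$Z(q,\lambda)=\sum_{g\ge1}\sum_{d\ge1}\frac{N_{g,d}}{(2g-2)!}\,q^d\lambda^{2g-2},\qquad \hat Z(q,\lambda)=\sum_{g\ge1}\sum_{d\ge1}\frac{\hat N_{g,d}}{(2g-2)!}\,q^d\lambda^{2g-2},$$ the identity $$\hat Z(q,\lambda)=\exp(Z(q,\lambda))-1$$ holds in the ring of formal power series $\mathbb{Q}[[q,\lambda]]$. -/

import Mathlib

open scoped Manifold ContDiff Topology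

noncomputable section

namespace BranchedCover

/-! ### Elliptic curves over `ℂ`

The elliptic curve `ℂ ⧸ Λ` attached to a lattice `Λ = ℤ ω₁ + ℤ ω₂`, as a Riemann surface: its charts
are local inverses of the projection `ℂ → ℂ ⧸ Λ`. -/

/-- The elliptic curve `ℂ ⧸ Λ`, where `Λ` is the lattice spanned by the pair of periods `L`. -/
abbrev EllipticCurve (L : PeriodPair) : Type := ℂ ⧸ L.lattice.toAddSubgroup

theorem isCoveringMap_mk (L : PeriodPair) :
    IsCoveringMap (QuotientAddGroup.mk : ℂ → EllipticCurve L) := by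
  have : DiscreteTopology L.lattice.toAddSubgroup :=
    inferInstanceAs (DiscreteTopology L.lattice)
  exact (AddSubgroup.isAddQuotientCoveringMap_of_comm L.lattice.toAddSubgroup
    DiscreteTopology.isDiscrete).isCoveringMap

instance instChartedSpaceEllipticCurve (L : PeriodPair) : ChartedSpace ℂ (EllipticCurve L) :=
  (isCoveringMap_mk L).isLocalHomeomorph.chartedSpace QuotientAddGroup.mk_surjective

/-- On the source of a chart, the chart is a section of the projection. -/
theorem mk_atlas_apply {L : PeriodPair} {e : OpenPartialHomeomorph (EllipticCurve L) ℂ}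
    (he : e ∈ atlas ℂ (EllipticCurve L)) {q : EllipticCurve L} (hq : q ∈ e.source) :
    (QuotientAddGroup.mk (e q) : EllipticCurve L) = q := by
  obtain ⟨p, rfl⟩ := he
  refine (isCoveringMap_mk L).isLocalHomeomorph.apply_localInverseAt_of_mem ?_
  exact hq.1

/-- The transition maps between charts are locally translations. -/
theorem transition_eventuallyEq {L : PeriodPair}
    {e e' : OpenPartialHomeomorph (EllipticCurve L) ℂ} (he : e ∈ atlas ℂ (EllipticCurve L))
    (he' : e' ∈ atlas ℂ (EllipticCurve L)) {w₀ : ℂ} (hw₀' : w₀ ∈ (e.symm ≫ₕ e').source) :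
    ∀ᶠ w in 𝓝 w₀, (e.symm ≫ₕ e') w = w + ((e.symm ≫ₕ e') w₀ - w₀) := by
  have key : ∀ w ∈ (e.symm ≫ₕ e').source, (e.symm ≫ₕ e') w - w ∈ L.lattice := by
    intro w hw
    rw [OpenPartialHomeomorph.trans_source] at hw
    have h1 : (QuotientAddGroup.mk (e (e.symm w)) : EllipticCurve L) = e.symm w :=
      mk_atlas_apply he (e.map_target hw.1)
    rw [e.right_inv hw.1] at h1
    have h2 : (QuotientAddGroup.mk (e' (e.symm w)) : EllipticCurve L) = e.symm w :=
      mk_atlas_apply he' hw.2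
    have h3 := QuotientAddGroup.eq.mp (h1.trans h2.symm)
    have h4 : -w + e' (e.symm w) ∈ L.lattice := h3
    rw [OpenPartialHomeomorph.coe_trans, Function.comp_apply, sub_eq_neg_add]
    exact h4
  have hS : (e.symm ≫ₕ e').source ∈ 𝓝 w₀ := (e.symm ≫ₕ e').open_source.mem_nhds hw₀'
  obtain ⟨U, hU, hU0⟩ : ∃ U : Set ℂ, IsOpen U ∧ Subtype.val ⁻¹' U = ({0} : Set L.lattice) :=
    isOpen_induced_iff.mp (isOpen_discrete ({0} : Set L.lattice))
  have hcont : ContinuousAt (fun w => ((e.symm ≫ₕ e') w - w) - ((e.symm ≫ₕ e') w₀ - w₀)) w₀ :=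
    (((e.symm ≫ₕ e').continuousAt hw₀').sub continuousAt_id).sub continuousAt_const
  have h0U : (0 : ℂ) ∈ U := by
    have : (0 : L.lattice) ∈ (Subtype.val ⁻¹' U : Set L.lattice) := by rw [hU0]; rfl
    simpa using this
  have hUn : U ∈ 𝓝 (((e.symm ≫ₕ e') w₀ - w₀) - ((e.symm ≫ₕ e') w₀ - w₀)) := by
    rw [sub_self]; exact hU.mem_nhds h0U
  filter_upwards [hS, hcont.preimage_mem_nhds hUn] with w hw hwU
  have hmem := L.lattice.sub_mem (key w hw) (key w₀ hw₀')
  have : (⟨_, hmem⟩ : L.lattice) ∈ (Subtype.val ⁻¹' U : Set L.lattice) := hwU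
  rw [hU0] at this
  have h5 := congrArg Subtype.val (Set.mem_singleton_iff.mp this)
  have h6 : ((e.symm ≫ₕ e') w - w) - ((e.symm ≫ₕ e') w₀ - w₀) = 0 := h5
  linear_combination h6

instance instIsManifoldEllipticCurve (L : PeriodPair) :
    IsManifold 𝓘(ℂ) ω (EllipticCurve L) := by
  refine isManifold_of_contDiffOn _ _ _ fun e e' he he' => ?_
  intro w₀ hw₀
  have hev := transition_eventuallyEq he he' (w₀ := w₀) (by simpa using hw₀)
  have hd : ContDiffAt ℂ ω (fun w : ℂ => w + ((e.symm ≫ₕ e') w₀ - w₀)) w₀ := by fun_prop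
  exact (hd.congr_of_eventuallyEq hev).contDiffWithinAt

/-! ### Genus of a compact Riemann surface

The genus `g` is defined by `deg K = 2 g - 2`, where `K` is the divisor of a meromorphic `1`-form
that vanishes identically on no component. For a surface with components of genera `gᵢ` this reads
`2 g - 2 = ∑ᵢ (2 gᵢ - 2)`, that is, the Euler characteristic is `2 - 2 g`. -/

section Genus

variable {C : Type*} [TopologicalSpace C] [ChartedSpace ℂ C]

/-- The coefficient `u` of the `1`-form `η = u(z) dz` in the coordinate `z` around `p`. -/
def formCoeff (η : ∀ x : C, TangentSpace 𝓘(ℂ) x →L[ℂ] ℂ) (p : C) (z : ℂ) : ℂ :=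
  η ((chartAt ℂ p).symm z) (mfderiv 𝓘(ℂ) 𝓘(ℂ) (chartAt ℂ p).symm z (1 : ℂ))

/-- `η` is a meromorphic `1`-form. (The value of `η` at a pole is irrelevant.) -/
def IsMeromorphicForm (η : ∀ x : C, TangentSpace 𝓘(ℂ) x →L[ℂ] ℂ) : Prop :=
  ∀ p : C, MeromorphicAt (formCoeff η p) (chartAt ℂ p p)

/-- The order of vanishing (negative at a pole) of a meromorphic `1`-form at `p`. -/
def formOrder (η : ∀ x : C, TangentSpace 𝓘(ℂ) x →L[ℂ] ℂ) (p : C) : WithTop ℤ :=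
  meromorphicOrderAt (formCoeff η p) (chartAt ℂ p p)

variable (C) in
/-- The compact Riemann surface `C` has genus `g`. -/
def HasGenus (g : ℕ) : Prop :=
  ∃ η : ∀ x : C, TangentSpace 𝓘(ℂ) x →L[ℂ] ℂ, IsMeromorphicForm η ∧
    (∀ p, formOrder η p ≠ ⊤) ∧ ∑ᶠ p, (formOrder η p).untop₀ = 2 * (g : ℤ) - 2

end Genus

/-! ### Covers of an elliptic curve -/

/-- A holomorphic map `f : C → E` from a compact, possibly disconnected Riemann surface (smooth
projective complex curve) `C` to the elliptic curve `E = ℂ ⧸ Λ`. -/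
structure Cover (L : PeriodPair) where
  /-- The underlying set of `C`. -/
  C : Type
  [topologicalSpace : TopologicalSpace C]
  [t2Space : T2Space C]
  [compactSpace : CompactSpace C]
  [chartedSpace : ChartedSpace ℂ C]
  [isManifold : IsManifold 𝓘(ℂ) ω C]
  /-- The map to the elliptic curve. -/
  f : C → EllipticCurve L
  holomorphic : ContMDiff 𝓘(ℂ) 𝓘(ℂ) ω f

namespace Cover

attribute [instance] topologicalSpace t2Space compactSpace chartedSpace isManifold

variable {L : PeriodPair}

/-- Isomorphisms `(C, f) ≅ (C', f')`: biholomorphic maps `φ : C → C'` with `f' ∘ φ = f`. -/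
def Iso (X Y : Cover L) : Type :=
  {φ : Diffeomorph 𝓘(ℂ) 𝓘(ℂ) X.C Y.C ω // ∀ x, Y.f (φ x) = X.f x}

/-- The automorphisms of `(C, f)`. -/
abbrev Aut (X : Cover L) : Type := Iso X X

/-- The ramification index of `f` at `x`: the order of vanishing at `x` of `f - f x`, read in
charts. -/
def ramificationIndex (X : Cover L) (x : X.C) : ℕ∞ :=
  analyticOrderAt
    (fun z => chartAt ℂ (X.f x) (X.f ((chartAt ℂ x).symm z)) - chartAt ℂ (X.f x) (X.f x))
    (chartAt ℂ x x)

/-- The set of ramification points of `f`. -/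
def ramificationPoints (X : Cover L) : Set X.C := {x | X.ramificationIndex x ≠ 1}

/-- The set of branch points of `f`. -/
def branchPoints (X : Cover L) : Set (EllipticCurve L) := X.f '' X.ramificationPoints

/-- Every ramification point has index `m`, and different ramification points have different
images. -/
def IsSimple (m : ℕ) (X : Cover L) : Prop :=
  (∀ x ∈ X.ramificationPoints, X.ramificationIndex x = m) ∧ Set.InjOn X.f X.ramificationPoints

/-- `f` has degree `d`: it takes every value that is not a branch point exactly `d` times. -/
def HasDegree (X : Cover L) (d : ℕ) : Prop :=
  ∀ y ∉ X.branchPoints, (X.f ⁻¹' {y}).encard = d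

end Cover

/-- Isomorphism as an equivalence relation on a class `S` of covers. -/
def isoSetoid {L : PeriodPair} (S : Set (Cover L)) : Setoid S where
  r X Y := Nonempty (Cover.Iso X.1 Y.1)
  iseqv :=
    { refl := fun X => ⟨⟨Diffeomorph.refl _ _ _, fun _ => rfl⟩⟩
      symm := fun {X Y} ⟨φ⟩ => ⟨⟨φ.1.symm, fun y => by
        rw [← φ.2 (φ.1.symm y), Diffeomorph.apply_symm_apply]⟩⟩
      trans := fun {X Y Z} ⟨φ⟩ ⟨ψ⟩ => ⟨⟨φ.1.trans ψ.1, fun x => by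
        rw [Diffeomorph.coe_trans, Function.comp_apply, ψ.2, φ.2]⟩⟩ }

/-- The set of isomorphism classes of covers in `S`. -/
def IsoClasses {L : PeriodPair} (S : Set (Cover L)) : Type 1 := Quotient (isoSetoid S)

/-- `∑ 1 / |Aut (C, f)|` over the isomorphism classes of covers `(C, f)` in `S`. -/
def weightedCount {L : PeriodPair} (S : Set (Cover L)) : ℚ :=
  ∑ᶠ c : IsoClasses S, 1 / (Nat.card (Cover.Aut (Quotient.out c).1) : ℚ)

/-- The possibly disconnected simple `2`-branched covers of degree `d` and genus `g` with set of
branch points `B`. -/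
def possiblyDisconnectedCovers {L : PeriodPair} (B : Finset (EllipticCurve L)) (g d : ℕ) :
    Set (Cover L) :=
  {X | X.IsSimple 2 ∧ X.branchPoints = B ∧ X.HasDegree d ∧ HasGenus X.C g}

/-- The connected simple `2`-branched covers of degree `d` and genus `g` with set of branch
points `B`. -/
def connectedCovers {L : PeriodPair} (B : Finset (EllipticCurve L)) (g d : ℕ) : Set (Cover L) :=
  {X | X ∈ possiblyDisconnectedCovers B g d ∧ ConnectedSpace X.C}

/-! ### Generating series -/

/-- The formal power series `∑_{g ≥ 1} ∑_{d ≥ 1} N g d / (2 g - 2)! * q ^ d * λ ^ (2 g - 2)` in the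
variables `q` (index `0`) and `λ` (index `1`). -/
def partitionFunction (N : ℕ → ℕ → ℚ) : MvPowerSeries (Fin 2) ℚ := fun n =>
  if 1 ≤ n 0 ∧ Even (n 1) then N (n 1 / 2 + 1) (n 0) / ((n 1).factorial : ℚ) else 0

theorem coeff_partitionFunction (N : ℕ → ℕ → ℚ) {g d : ℕ} (hg : 1 ≤ g) (hd : 1 ≤ d) :
    MvPowerSeries.coeff (Finsupp.single 0 d + Finsupp.single 1 (2 * g - 2)) (partitionFunction N) =
      N g d / ((2 * g - 2).factorial : ℚ) := by
  obtain ⟨k, rfl⟩ := Nat.exists_eq_add_of_le hg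
  have h : 2 * (1 + k) - 2 = 2 * k := by omega
  rw [h, MvPowerSeries.coeff_apply]
  simp [partitionFunction, hd, add_comm]

/-- `exp (partitionFunction N)` makes sense: the constant term vanishes. -/
theorem hasSubst_partitionFunction (N : ℕ → ℕ → ℚ) :
    PowerSeries.HasSubst (partitionFunction N) := by
  apply PowerSeries.HasSubst.of_constantCoeff_zero
  rw [← MvPowerSeries.coeff_zero_eq_constantCoeff_apply, MvPowerSeries.coeff_apply]
  simp [partitionFunction]

/-- The partition function `Z(q, λ)` of connected covers. The covers of genus `g` are taken with
set of branch points `B g`. -/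
def Z {L : PeriodPair} (B : ℕ → Finset (EllipticCurve L)) : MvPowerSeries (Fin 2) ℚ :=
  partitionFunction fun g d => weightedCount (connectedCovers (B g) g d)

/-- The partition function `Ẑ(q, λ)` of possibly disconnected covers. The covers of genus `g` are
taken with set of branch points `B g`. -/
def ZHat {L : PeriodPair} (B : ℕ → Finset (EllipticCurve L)) : MvPowerSeries (Fin 2) ℚ :=
  partitionFunction fun g d => weightedCount (possiblyDisconnectedCovers (B g) g d)

end BranchedCover

end

/-!
The identity `1 + Ẑ = exp Z` says that a cover is the disjoint union of its components. It is proved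
by comparing the derivatives `∂ / ∂q`: the series `exp Z` is the solution of `∂ G = ∂ Z * G` with the
right terms at `q ^ 0` (`pderiv_exp_subst`, `eq_zero_of_pderiv_eq`), and for `1 + Ẑ` this equation is
a recursion that splits off one component of a cover.

To obtain the recursion, the fibre over a point `y` off the branch points is labelled. A labelled
cover has no automorphisms, so the number of labelled covers of degree `n` is `n!` times the
weighted count (`card_labelledClasses`), and the component that carries a given label is
distinguished. Splitting it off is a bijection onto pairs of labelled covers, for a partition of the
labels and of the branch points (`exists_bijective_splitting`). Summation over the label yields
`n N̂(B, n) = ∑ e N(S, e) N̂(B \ S, n - e)` over `S ⊆ B` and `e ≤ n` (`mul_weightedCount`).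

Four facts about covers turn this into an equation between `Z` and `Ẑ`.

* *Covers are topological objects.* A continuous map over the elliptic curve between nonconstant
  covers is holomorphic (`Cover.isoEquiv`), and a homeomorphism over the complement of the branch
  points extends (`Cover.exists_iso_of_continuousOn`). Isomorphisms are determined on one fibre, so
  they are finite in number (`Cover.finite_iso`). The complement of the branch points is the image of
  finitely many bounded convex sets, over each of which a cover is trivial. It is therefore given by
  one of finitely many gluing data (`finite_isoClasses`).
* *The genus is automatic.* The form `f^* dz` has a simple zero at each ramification point and no
  other zeros or poles (`Cover.IsSimple.hasGenus`).
* *The counts depend only on the number of branch points.* A branch point can be moved a little by a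
  homeomorphism of the elliptic curve that is a translation near all branch points, and composition
  with it identifies the covers (`countInvariants_eq_of_card_eq`). This is needed even if the two
  choices of points agree, since the recursion involves arbitrary subsets of `B`.
* *The number of branch points is even* (`even_card_of_nonempty`). The series `Z` and `Ẑ` contain
  only even powers of `λ`, while the recursion involves subsets `S` of odd cardinality as well. By
  the previous item the branch points may be put on a line in the direction of the first period. The
  permutations of the sheets given by transport across this line change by a transposition whenever
  a branch point is passed, and after a full period the permutation is conjugate to the initial one.
  So the number of transpositions is even.
-/

open scoped Manifold ContDiff Topology Pointwise

noncomputable section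

namespace BranchedCover

open Set Filter

variable {L : PeriodPair}

/-! ### One complex variable -/

theorem eventually_deriv_ne_zero {v : ℂ → ℂ} {w : ℂ} (hv : AnalyticAt ℂ v w)
    (hv' : analyticOrderAt (fun z => v z - v w) w ≠ ⊤) : ∀ᶠ z in 𝓝[≠] w, deriv v z ≠ 0 := by
  have h1 : analyticOrderAt (deriv v) w ≠ ⊤ := by
    intro h
    have := hv.analyticOrderAt_deriv_add_one
    rw [h] at this
    exact hv' this.symm
  rcases hv.deriv.eventually_eq_zero_or_eventually_ne_zero with h | h
  · exact absurd (analyticOrderAt_eq_top.2 h) h1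
  · exact h

theorem eventually_ne_of_order_ne_top {u : ℂ → ℂ} {z₀ : ℂ} (hu : AnalyticAt ℂ u z₀)
    (hu' : analyticOrderAt (fun z => u z - u z₀) z₀ ≠ ⊤) : ∀ᶠ z in 𝓝[≠] z₀, u z ≠ u z₀ := by
  have hu2 : AnalyticAt ℂ (fun z => u z - u z₀) z₀ := hu.sub analyticAt_const
  rcases hu2.eventually_eq_zero_or_eventually_ne_zero with h | h
  · exact absurd (analyticOrderAt_eq_top.2 h) hu'
  · exact h.mono fun z hz => sub_ne_zero.1 hz

/-- Away from critical points `t` is locally `v⁻¹ ∘ u`. -/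
theorem differentiableAt_of_comp_eq {u v t : ℂ → ℂ} {z : ℂ} (hu : DifferentiableAt ℂ u z)
    (hv : AnalyticAt ℂ v (t z)) (hv' : deriv v (t z) ≠ 0) (ht : ContinuousAt t z)
    (h : ∀ᶠ y in 𝓝 z, v (t y) = u y) : DifferentiableAt ℂ t z := by
  have hs := hv.hasStrictDerivAt
  have h1 := ht.eventually (hs.eventually_left_inverse hv')
  have h2 : t =ᶠ[𝓝 z] fun y => HasStrictDerivAt.localInverse v _ _ hs hv' (u y) := by
    filter_upwards [h1, h] with y hy1 hy2
    rw [← hy2, hy1]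
  have h3 : DifferentiableAt ℂ (HasStrictDerivAt.localInverse v _ _ hs hv') (u z) := by
    have := (hs.to_localInverse hv').hasDerivAt.differentiableAt
    rwa [h.self_of_nhds] at this
  exact (h3.comp z hu).congr_of_eventuallyEq h2

/-- A continuous solution `t` of `v ∘ t = u` is holomorphic if `u` and `v` are holomorphic and not
locally constant: it is so away from critical points, which are removable singularities. -/
theorem analyticAt_of_comp_eq {u v t : ℂ → ℂ} {z₀ : ℂ} (hu : AnalyticAt ℂ u z₀)
    (hu' : analyticOrderAt (fun z => u z - u z₀) z₀ ≠ ⊤) (hv : AnalyticAt ℂ v (t z₀))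
    (hv' : analyticOrderAt (fun z => v z - v (t z₀)) (t z₀) ≠ ⊤)
    (ht : ∀ᶠ z in 𝓝 z₀, ContinuousAt t z) (h : ∀ᶠ z in 𝓝 z₀, v (t z) = u z) :
    AnalyticAt ℂ t z₀ := by
  refine Complex.analyticAt_of_differentiable_on_punctured_nhds_of_continuousAt ?_ ht.self_of_nhds
  have hne : ∀ᶠ z in 𝓝[≠] z₀, t z ≠ t z₀ := by
    filter_upwards [eventually_ne_of_order_ne_top hu hu', h.filter_mono nhdsWithin_le_nhds]
      with z hz hz2 hz3
    exact hz (by rw [← hz2, ← h.self_of_nhds, hz3])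
  have htend : Tendsto t (𝓝[≠] z₀) (𝓝[≠] (t z₀)) :=
    tendsto_nhdsWithin_iff.2 ⟨ht.self_of_nhds.tendsto.mono_left nhdsWithin_le_nhds, hne⟩
  have h1 := htend.eventually (eventually_deriv_ne_zero hv hv')
  have h2 := htend.eventually (hv.eventually_analyticAt.filter_mono nhdsWithin_le_nhds)
  filter_upwards [h1, h2, ht.filter_mono nhdsWithin_le_nhds,
    hu.eventually_analyticAt.filter_mono nhdsWithin_le_nhds,
    h.eventually_nhds.filter_mono nhdsWithin_le_nhds] with z a1 a2 a3 a4 a5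
  exact differentiableAt_of_comp_eq a4.differentiableAt a2 a1 a3 a5

/-- Normal form at a point of ramification index `2`: `v - v w` is the square of a local
coordinate `s`. -/
theorem exists_sqrt_of_order_eq_two {v : ℂ → ℂ} {w : ℂ} (hv : AnalyticAt ℂ v w)
    (hv' : analyticOrderAt (fun z => v z - v w) w = 2) :
    ∃ s : ℂ → ℂ, AnalyticAt ℂ s w ∧ s w = 0 ∧ deriv s w ≠ 0 ∧
      ∀ᶠ z in 𝓝 w, v z = v w + s z ^ 2 := by
  have hv2 : AnalyticAt ℂ (fun z => v z - v w) w := hv.sub analyticAt_const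
  obtain ⟨g, hg, hg0, hgv⟩ := (hv2.analyticOrderAt_eq_natCast (n := 2)).1 hv'
  have hq : AnalyticAt ℂ (fun z => g z / g w) w := hg.div analyticAt_const hg0
  obtain ⟨r, hr⟩ : ∃ r : ℂ, r ^ 2 = g w := IsAlgClosed.exists_pow_nat_eq _ (by norm_num)
  have hr0 : r ≠ 0 := by rintro rfl; exact hg0 (by rw [← hr]; simp)
  have hk : AnalyticAt ℂ (fun z => r * Complex.exp (Complex.log (g z / g w) / 2)) w := by
    refine analyticAt_const.mul (AnalyticAt.cexp ?_)
    exact (hq.clog (by simp [div_self hg0])).div analyticAt_const two_ne_zero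
  refine ⟨fun z => (z - w) * (r * Complex.exp (Complex.log (g z / g w) / 2)), ?_, by simp, ?_, ?_⟩
  · exact (analyticAt_id.sub analyticAt_const).mul hk
  · have h1 : HasDerivAt (fun z => (z - w) *
        (r * Complex.exp (Complex.log (g z / g w) / 2))) _ w :=
      ((hasDerivAt_id w).sub_const w).mul hk.differentiableAt.hasDerivAt
    rw [h1.deriv]
    simp [hr0]
  · have hne : ∀ᶠ z in 𝓝 w, g z ≠ 0 := hg.continuousAt.eventually_ne hg0
    filter_upwards [hgv, hne] with z hz hz0
    have h1 : Complex.exp (Complex.log (g z / g w) / 2) ^ 2 = g z / g w := by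
      rw [← Complex.exp_nat_mul]
      rw [show ((2 : ℕ) : ℂ) * (Complex.log (g z / g w) / 2) = Complex.log (g z / g w) by
        push_cast; ring]
      exact Complex.exp_log (div_ne_zero hz0 hg0)
    rw [mul_pow, mul_pow, h1, hr, mul_div_cancel₀ _ hg0]
    simp only [smul_eq_mul] at hz
    linear_combination hz

/-! ### The topology of an elliptic curve -/

section EllipticCurve

variable (L : PeriodPair)

instance instT2SpaceEllipticCurve : T2Space (EllipticCurve L) := by
  have : IsClosed (L.lattice.toAddSubgroup : Set ℂ) := L.isClosed_lattice
  infer_instance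

/-- Every point of the elliptic curve is the image of a point of the parallelogram spanned by the
periods. -/
theorem exists_mk_eq (y : EllipticCurve L) : ∃ s ∈ Icc (0 : ℝ) 1, ∃ t ∈ Icc (0 : ℝ) 1,
    (QuotientAddGroup.mk ((s : ℂ) * L.ω₁ + (t : ℂ) * L.ω₂) : EllipticCurve L) = y := by
  obtain ⟨z, rfl⟩ := QuotientAddGroup.mk_surjective y
  have hz : L.basis.repr z 0 • L.ω₁ + L.basis.repr z 1 • L.ω₂ = z := by
    conv_rhs => rw [← L.basis.sum_repr z]
    simp [Fin.sum_univ_two]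
  set a := L.basis.repr z 0
  set b := L.basis.repr z 1
  refine ⟨Int.fract a, ⟨Int.fract_nonneg _, (Int.fract_lt_one _).le⟩, Int.fract b,
    ⟨Int.fract_nonneg _, (Int.fract_lt_one _).le⟩, ?_⟩
  rw [QuotientAddGroup.eq]
  change _ ∈ L.lattice
  rw [← hz, PeriodPair.mem_lattice]
  refine ⟨⌊a⌋, ⌊b⌋, ?_⟩
  simp only [Int.fract, Complex.real_smul]
  push_cast
  ring

instance instCompactSpaceEllipticCurve : CompactSpace (EllipticCurve L) := by
  constructor
  have hc : IsCompact ((fun p : ℝ × ℝ => (QuotientAddGroup.mk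
      ((p.1 : ℂ) * L.ω₁ + (p.2 : ℂ) * L.ω₂) : EllipticCurve L)) '' (Icc 0 1 ×ˢ Icc 0 1)) := by
    refine (isCompact_Icc.prod isCompact_Icc).image ?_
    exact QuotientAddGroup.continuous_mk.comp (by fun_prop)
  convert hc
  refine (eq_univ_of_forall fun y => ?_).symm
  obtain ⟨s, hs, t, ht, h⟩ := exists_mk_eq L y
  exact ⟨(s, t), ⟨hs, ht⟩, h⟩

variable {L}

theorem countable_preimage_mk {B : Set (EllipticCurve L)} (hB : B.Finite) :
    ((QuotientAddGroup.mk : ℂ → EllipticCurve L) ⁻¹' B).Countable := by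
  have hc : Countable L.lattice := L.latticeEquivProd.toEquiv.countable_iff.2 inferInstance
  rw [← biUnion_preimage_singleton]
  refine hB.countable.biUnion fun b _ => ?_
  obtain ⟨z, rfl⟩ := QuotientAddGroup.mk_surjective b
  refine (countable_range fun l : L.lattice => z + l).mono fun w hw => ?_
  have h : -z + w ∈ L.lattice := QuotientAddGroup.eq.1 (Eq.symm hw)
  exact ⟨⟨_, h⟩, add_neg_cancel_left z w⟩

theorem isPathConnected_compl {B : Set (EllipticCurve L)} (hB : B.Finite) :
    IsPathConnected Bᶜ := by
  have h := (countable_preimage_mk hB).isPathConnected_compl_of_one_lt_rank (E := ℂ)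
    (by rw [Complex.rank_real_complex]; norm_num)
  have h2 := h.image (f := (QuotientAddGroup.mk : ℂ → EllipticCurve L))
    QuotientAddGroup.continuous_mk
  rwa [← preimage_compl, image_preimage_eq _ QuotientAddGroup.mk_surjective] at h2

end EllipticCurve

/-! ### Maps to an elliptic curve in local coordinates -/

section LocalCoordinates

variable {C C' : Type*} [TopologicalSpace C] [TopologicalSpace C']

/-- The map `g` to the elliptic curve, read in the chart `e` of its source and in the chart of the
elliptic curve at `g p`. -/
def localMap (g : C → EllipticCurve L) (e : OpenPartialHomeomorph C ℂ) (p : C) (z : ℂ) : ℂ :=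
  chartAt ℂ (g p) (g (e.symm z))

/-- `g` is constant near `p`. -/
def IsConstAt (g : C → EllipticCurve L) (p : C) : Prop := ∀ᶠ q in 𝓝 p, g q = g p

theorem localMap_apply (g : C → EllipticCurve L) (e : OpenPartialHomeomorph C ℂ) {p : C}
    (hp : p ∈ e.source) : localMap g e p (e p) = chartAt ℂ (g p) (g p) := by
  rw [localMap, e.left_inv hp]

theorem order_localMap_ne_top {g : C → EllipticCurve L} {e : OpenPartialHomeomorph C ℂ} {p : C}
    (hp : p ∈ e.source) (hg : ContinuousAt g p) (hc : ¬ IsConstAt g p) :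
    analyticOrderAt (fun z => localMap g e p z - localMap g e p (e p)) (e p) ≠ ⊤ := by
  intro h
  apply hc
  rw [analyticOrderAt_eq_top] at h
  have h1 := (e.continuousAt hp).eventually h
  have h2 := hg.eventually ((chartAt ℂ (g p)).open_source.mem_nhds (mem_chart_source ℂ (g p)))
  filter_upwards [h1, h2, e.open_source.mem_nhds hp] with q hq1 hq2 hq3
  rw [localMap_apply g e hp, localMap, e.left_inv hq3, sub_eq_zero] at hq1
  exact (chartAt ℂ (g p)).injOn hq2 (mem_chart_source ℂ (g p)) hq1

/-- A continuous map `α` between the sources of two nonconstant maps `g` and `g'` to the elliptic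
curve with `g' ∘ α = g` is holomorphic in charts in which `g` and `g'` are holomorphic. -/
theorem analyticAt_of_over {g : C → EllipticCurve L} {g' : C' → EllipticCurve L}
    {e : OpenPartialHomeomorph C ℂ} {e' : OpenPartialHomeomorph C' ℂ} {α : C → C'} {p : C}
    (hp : p ∈ e.source) (hp' : α p ∈ e'.source)
    (hg : AnalyticAt ℂ (localMap g e p) (e p)) (hgp : ContinuousAt g p) (hgc : ¬ IsConstAt g p)
    (hg' : AnalyticAt ℂ (localMap g' e' (α p)) (e' (α p))) (hgp' : ContinuousAt g' (α p))
    (hgc' : ¬ IsConstAt g' (α p))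
    (hα : ∀ᶠ q in 𝓝 p, ContinuousAt α q) (h : ∀ᶠ q in 𝓝 p, g' (α q) = g q) :
    AnalyticAt ℂ (fun z => e' (α (e.symm z))) (e p) := by
  have hz : Tendsto e.symm (𝓝 (e p)) (𝓝 p) := by
    have := e.symm.continuousAt (e.map_source hp)
    rwa [ContinuousAt, e.left_inv hp] at this
  have key : e' (α (e.symm (e p))) = e' (α p) := by rw [e.left_inv hp]
  have hsrc : ∀ᶠ q in 𝓝 p, α q ∈ e'.source :=
    hα.self_of_nhds.eventually (e'.open_source.mem_nhds hp')
  refine analyticAt_of_comp_eq (u := localMap g e p) (v := localMap g' e' (α p)) hg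
    (order_localMap_ne_top hp hgp hgc) (by rwa [key]) ?_ ?_ ?_
  · rw [key]; exact order_localMap_ne_top hp' hgp' hgc'
  · filter_upwards [hz.eventually hα, hz.eventually hsrc, e.open_target.mem_nhds (e.map_source hp)]
      with z h1 h2 h3
    exact ((e'.continuousAt h2).comp h1).comp (e.symm.continuousAt h3)
  · filter_upwards [hz.eventually hsrc, hz.eventually h] with z h1 h2
    rw [localMap, localMap, e'.left_inv h1, h2, h.self_of_nhds]

/-- The order of `g - g p` at `p` does not change under a local homeomorphism over the elliptic
curve. -/
theorem order_localMap_eq {g : C → EllipticCurve L} {g' : C' → EllipticCurve L}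
    {e : OpenPartialHomeomorph C ℂ} {e' : OpenPartialHomeomorph C' ℂ}
    (a : OpenPartialHomeomorph C C') {p : C} (ha : p ∈ a.source)
    (hp : p ∈ e.source) (hp' : a p ∈ e'.source)
    (hg : AnalyticAt ℂ (localMap g e p) (e p)) (hgp : ContinuousAt g p) (hgc : ¬ IsConstAt g p)
    (hg' : AnalyticAt ℂ (localMap g' e' (a p)) (e' (a p))) (hgp' : ContinuousAt g' (a p))
    (hgc' : ¬ IsConstAt g' (a p)) (h : ∀ q ∈ a.source, g' (a q) = g q) :
    analyticOrderAt (fun z => localMap g' e' (a p) z - localMap g' e' (a p) (e' (a p)))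
      (e' (a p)) = analyticOrderAt (fun z => localMap g e p z - localMap g e p (e p)) (e p) := by
  have hz : Tendsto e.symm (𝓝 (e p)) (𝓝 p) := by
    have := e.symm.continuousAt (e.map_source hp)
    rwa [ContinuousAt, e.left_inv hp] at this
  have hs : ∀ᶠ q in 𝓝 p, q ∈ a.source := a.open_source.mem_nhds ha
  have hs' : ∀ᶠ q in 𝓝 (a p), q ∈ a.target := a.open_target.mem_nhds (a.map_source ha)
  have hsrc : ∀ᶠ q in 𝓝 p, a q ∈ e'.source :=
    (a.continuousAt ha).eventually (e'.open_source.mem_nhds hp')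
  have ht : AnalyticAt ℂ (fun z => e' (a (e.symm z))) (e p) :=
    analyticAt_of_over hp hp' hg hgp hgc hg' hgp' hgc' (hs.mono fun q hq => a.continuousAt hq)
      (hs.mono h)
  have hap : a.symm (a p) = p := a.left_inv ha
  have ht' : AnalyticAt ℂ (fun z => e (a.symm (e'.symm z))) (e' (a p)) := by
    refine analyticAt_of_over (α := a.symm) (g := g') (g' := g) hp' (by rwa [hap]) hg' hgp' hgc'
      (by rwa [hap]) (by rwa [hap]) (by rwa [hap]) (hs'.mono fun q hq => a.symm.continuousAt hq)
      (hs'.mono fun q hq => ?_)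
    rw [← h _ (a.map_target hq), a.right_inv hq]
  have hcomp : (fun z => e (a.symm (e'.symm (e' (a (e.symm z)))))) =ᶠ[𝓝 (e p)] id := by
    filter_upwards [hz.eventually hs, hz.eventually hsrc,
      e.open_target.mem_nhds (e.map_source hp)] with z h1 h2 h3
    rw [e'.left_inv h2, a.left_inv h1, e.right_inv h3, id]
  have hval : e' (a (e.symm (e p))) = e' (a p) := by rw [e.left_inv hp]
  have hd : deriv (fun z => e' (a (e.symm z))) (e p) ≠ 0 := by
    intro h0
    have h1 : HasDerivAt (fun z => e' (a (e.symm z))) 0 (e p) := by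
      rw [← h0]; exact ht.differentiableAt.hasDerivAt
    have h2 : HasDerivAt (fun z => e (a.symm (e'.symm z)))
        (deriv (fun z => e (a.symm (e'.symm z))) (e' (a p))) (e' (a (e.symm (e p)))) := by
      rw [hval]; exact ht'.differentiableAt.hasDerivAt
    have h3 := (h2.comp (e p) h1).unique ((hasDerivAt_id (e p)).congr_of_eventuallyEq hcomp)
    simp at h3
  rw [← hval, ← analyticOrderAt_comp_of_deriv_ne_zero ht hd]
  refine analyticOrderAt_congr ?_
  filter_upwards [hz.eventually hs, hz.eventually hsrc] with z h1 h2
  rw [Function.comp_apply]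
  simp only [localMap]
  rw [e'.left_inv h2, h _ h1, h p ha, hval, e'.left_inv hp', h p ha, e.left_inv hp]

end LocalCoordinates

namespace Cover

theorem continuous (X : Cover L) : Continuous X.f := X.holomorphic.continuous

theorem analyticAt_localMap (X : Cover L) {x p : X.C} (hp : p ∈ (chartAt ℂ x).source) :
    AnalyticAt ℂ (localMap X.f (chartAt ℂ x) p) (chartAt ℂ x p) := by
  have h := (contMDiffAt_iff_of_mem_source (x := x) (y := X.f p) hp
    (mem_chart_source ℂ (X.f p))).1 (X.holomorphic p)
  have h2 := h.2
  simp only [mfld_simps, contDiffWithinAt_univ] at h2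
  exact h2.analyticAt

theorem ramificationIndex_eq (X : Cover L) (x : X.C) : X.ramificationIndex x =
    analyticOrderAt (fun z => localMap X.f (chartAt ℂ x) x z -
      localMap X.f (chartAt ℂ x) x (chartAt ℂ x x)) (chartAt ℂ x x) := by
  rw [ramificationIndex, localMap_apply _ _ (mem_chart_source ℂ x)]
  rfl

theorem ramificationIndex_eq_top_of_isConstAt {X : Cover L} {x : X.C} (h : IsConstAt X.f x) :
    X.ramificationIndex x = ⊤ := by
  rw [ramificationIndex, analyticOrderAt_eq_top]
  have hz : Tendsto (chartAt ℂ x).symm (𝓝 (chartAt ℂ x x)) (𝓝 x) := by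
    have := (chartAt ℂ x).symm.continuousAt (mem_chart_target ℂ x)
    rwa [ContinuousAt, (chartAt ℂ x).left_inv (mem_chart_source ℂ x)] at this
  filter_upwards [hz.eventually h] with z hz
  rw [hz, sub_self]

/-- Ramification indices are invariant under local homeomorphisms over the elliptic curve. -/
theorem ramificationIndex_congr {X Y : Cover L} (a : OpenPartialHomeomorph X.C Y.C)
    (h : ∀ q ∈ a.source, Y.f (a q) = X.f q) {x : X.C} (hx : x ∈ a.source) :
    Y.ramificationIndex (a x) = X.ramificationIndex x := by
  have hcc : IsConstAt X.f x ↔ IsConstAt Y.f (a x) := by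
    constructor
    · intro hc
      have h1 : ContinuousAt a.symm (a x) := a.symm.continuousAt (a.map_source hx)
      rw [ContinuousAt, a.left_inv hx] at h1
      filter_upwards [h1.eventually hc, a.open_target.mem_nhds (a.map_source hx)] with q h2 h3
      rw [← a.right_inv h3, h _ (a.map_target h3), h2, h _ hx]
    · intro hc
      filter_upwards [(a.continuousAt hx).eventually hc, a.open_source.mem_nhds hx] with q h2 h3
      rw [← h _ h3, h2, h _ hx]
  by_cases hc : IsConstAt X.f x
  · rw [ramificationIndex_eq_top_of_isConstAt hc,
      ramificationIndex_eq_top_of_isConstAt (hcc.1 hc)]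
  · rw [ramificationIndex_eq, ramificationIndex_eq]
    exact order_localMap_eq a hx (mem_chart_source ℂ x) (mem_chart_source ℂ (a x))
      (X.analyticAt_localMap (mem_chart_source ℂ x)) X.continuous.continuousAt hc
      (Y.analyticAt_localMap (mem_chart_source ℂ (a x))) Y.continuous.continuousAt
      (fun h' => hc (hcc.2 h')) h

/-- `f` is nowhere locally constant. -/
def IsNonconstant (X : Cover L) : Prop := ∀ x, ¬ IsConstAt X.f x

/-- Near a point where `f` is constant the ramification index is `⊤`, which a simple cover excludes.
-/
theorem IsSimple.isNonconstant {X : Cover L} (hX : X.IsSimple 2) : X.IsNonconstant := by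
  intro x hx
  have h := ramificationIndex_eq_top_of_isConstAt hx
  have h2 := hX.1 x (by simp [ramificationPoints, h])
  rw [h] at h2
  exact absurd h2 (by decide)

/-- A continuous map between covers over the elliptic curve is holomorphic. -/
theorem contMDiff_of_continuous {X Y : Cover L} (hX : X.IsNonconstant) (hY : Y.IsNonconstant)
    {α : X.C → Y.C} (hα : Continuous α) (h : ∀ x, Y.f (α x) = X.f x) :
    ContMDiff 𝓘(ℂ) 𝓘(ℂ) ω α := by
  intro x
  rw [contMDiffAt_iff]
  refine ⟨hα.continuousAt, ?_⟩
  simp only [mfld_simps, contDiffWithinAt_univ]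
  refine AnalyticAt.contDiffAt ?_
  exact analyticAt_of_over (mem_chart_source ℂ x) (mem_chart_source ℂ (α x))
      (X.analyticAt_localMap (mem_chart_source ℂ x)) X.continuous.continuousAt (hX x)
      (Y.analyticAt_localMap (mem_chart_source ℂ (α x))) Y.continuous.continuousAt (hY (α x))
      (.of_forall fun q => hα.continuousAt) (.of_forall h)

/-- Isomorphisms of covers are the same as homeomorphisms over the elliptic curve. -/
def isoEquiv {X Y : Cover L} (hX : X.IsNonconstant) (hY : Y.IsNonconstant) :
    Iso X Y ≃ {φ : X.C ≃ₜ Y.C // ∀ x, Y.f (φ x) = X.f x} where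
  toFun φ := ⟨φ.1.toHomeomorph, φ.2⟩
  invFun φ := ⟨{ toEquiv := φ.1.toEquiv
                 contMDiff_toFun := contMDiff_of_continuous hX hY φ.1.continuous φ.2
                 contMDiff_invFun := contMDiff_of_continuous hY hX φ.1.symm.continuous
                  fun y => by
                    have := φ.2 (φ.1.symm y)
                    rw [φ.1.apply_symm_apply] at this
                    exact this.symm }, φ.2⟩
  left_inv φ := rfl
  right_inv φ := rfl

/-- Off the ramification points the differential of `f` does not vanish, so the inverse function
theorem applies. -/
theorem isLocalHomeomorphOn (X : Cover L) : IsLocalHomeomorphOn X.f X.ramificationPointsᶜ := by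
  refine IsLocalHomeomorphOn.mk _ _ fun x hx => ?_
  have hx1 : X.ramificationIndex x = 1 := by simpa [ramificationPoints] using hx
  have han := X.analyticAt_localMap (mem_chart_source ℂ x)
  set e := chartAt ℂ x
  set c := chartAt ℂ (X.f x)
  have hd : deriv (localMap X.f e x) (e x) ≠ 0 := by
    have h1 := han.analyticOrderAt_deriv_add_one
    rw [← ramificationIndex_eq, hx1] at h1
    have h2 : analyticOrderAt (deriv (localMap X.f e x)) (e x) = 0 := by
      generalize analyticOrderAt (deriv (localMap X.f e x)) (e x) = r at h1
      cases r with
      | top => simp at h1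
      | coe r =>
        norm_cast at h1 ⊢
        omega
    exact (han.deriv.analyticOrderAt_eq_zero).1 h2
  let k : OpenPartialHomeomorph ℂ ℂ :=
    (han.hasStrictDerivAt.hasStrictFDerivAt_equiv hd).toOpenPartialHomeomorph _
  have hk : (k : ℂ → ℂ) = localMap X.f e x := rfl
  have hke : e x ∈ k.source :=
    (han.hasStrictDerivAt.hasStrictFDerivAt_equiv hd).mem_toOpenPartialHomeomorph_source
  have hxe : x ∈ e.source := mem_chart_source ℂ x
  have hxc : X.f x ∈ c.source := mem_chart_source ℂ (X.f x)
  have hkx : k (e x) = c (X.f x) := by rw [hk]; exact localMap_apply _ _ hxe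
  refine ⟨((e.trans k).trans c.symm).restrOpen (X.f ⁻¹' c.source)
    (c.open_source.preimage X.continuous), ?_, ?_⟩
  · simp only [OpenPartialHomeomorph.restrOpen_source, OpenPartialHomeomorph.trans_source,
      mem_inter_iff, mem_preimage, OpenPartialHomeomorph.coe_trans, Function.comp_apply]
    exact ⟨⟨⟨hxe, hke⟩, by rw [hkx]; exact c.map_source hxc⟩, hxc⟩
  · intro q hq
    simp only [OpenPartialHomeomorph.restrOpen_source, OpenPartialHomeomorph.trans_source,
      mem_inter_iff, mem_preimage, OpenPartialHomeomorph.coe_trans, Function.comp_apply] at hq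
    change X.f q = c.symm (k (e q))
    rw [hk, localMap, e.left_inv hq.1.1.1]
    exact (c.left_inv hq.2).symm

end Cover

/-! ### Punctured neighbourhoods on a Riemann surface -/

theorem isPreconnected_ball_diff_center (c : ℂ) (r : ℝ) :
    IsPreconnected (Metric.ball c r \ {c}) := by
  have h : Metric.ball c r \ {c} = (fun p : ℝ × ℝ => c + p.1 * Complex.exp (p.2 * Complex.I)) ''
      (Ioo 0 r ×ˢ univ) := by
    ext z
    constructor
    · rintro ⟨hz, hzc⟩
      refine ⟨(‖z - c‖, Complex.arg (z - c)),
        ⟨⟨norm_pos_iff.2 (sub_ne_zero.2 hzc), by simpa [dist_eq_norm] using hz⟩, trivial⟩, ?_⟩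
      simp [Complex.norm_mul_exp_arg_mul_I]
    · rintro ⟨⟨ρ, θ⟩, ⟨⟨h1, h2⟩, -⟩, rfl⟩
      simp only at h1 h2
      refine ⟨?_, ?_⟩
      · simpa [dist_eq_norm, abs_of_pos h1, Complex.norm_exp_ofReal_mul_I] using h2
      · simp [h1.ne']
  rw [h]
  exact (isPreconnected_Ioo.prod isPreconnected_univ).image _ (by fun_prop)

section Punctured

variable {C : Type*} [TopologicalSpace C] [ChartedSpace ℂ C]

/-- Punctured neighbourhoods have a basis of connected sets. This is what makes the branch points
removable for continuous maps over the elliptic curve. -/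
theorem exists_isPreconnected_punctured (x : C) {U : Set C} (hU : U ∈ 𝓝[≠] x) :
    ∃ V ∈ 𝓝[≠] x, V ⊆ U ∧ IsPreconnected V := by
  set e := chartAt ℂ x
  have hx : x ∈ e.source := mem_chart_source ℂ x
  obtain ⟨W, hW, hWU⟩ := mem_nhdsWithin_iff_exists_mem_nhds_inter.1 hU
  have h1 : e.symm ⁻¹' W ∩ e.target ∈ 𝓝 (e x) := by
    refine inter_mem ?_ (e.open_target.mem_nhds (e.map_source hx))
    refine (e.symm.continuousAt (e.map_source hx)).preimage_mem_nhds ?_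
    rwa [e.left_inv hx]
  obtain ⟨r, hr, hrW⟩ := Metric.mem_nhds_iff.1 h1
  refine ⟨e.symm '' (Metric.ball (e x) r \ {e x}), ?_, ?_, ?_⟩
  · refine mem_nhdsWithin_iff_exists_mem_nhds_inter.2
      ⟨e.source ∩ e ⁻¹' Metric.ball (e x) r, inter_mem (e.open_source.mem_nhds hx)
        ((e.continuousAt hx).preimage_mem_nhds (Metric.ball_mem_nhds _ hr)), ?_⟩
    rintro q ⟨⟨hq1, hq2⟩, hq3⟩
    exact ⟨e q, ⟨hq2, fun h => hq3 (e.injOn hq1 hx h)⟩, e.left_inv hq1⟩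
  · rintro _ ⟨z, ⟨hz, hzx⟩, rfl⟩
    refine hWU ⟨(hrW hz).1, fun h => hzx ?_⟩
    rw [mem_singleton_iff] at h ⊢
    rw [← h, e.right_inv (hrW hz).2]
  · refine (isPreconnected_ball_diff_center _ _).image _ ?_
    exact e.continuousOn_symm.mono fun z hz => (hrW hz.1).2

variable (C) in
theorem neBot_punctured (x : C) : (𝓝[≠] x).NeBot := by
  set e := chartAt ℂ x
  have hx : x ∈ e.source := mem_chart_source ℂ x
  have h : Tendsto e.symm (𝓝[≠] (e x)) (𝓝[≠] x) := by
    refine tendsto_nhdsWithin_iff.2 ⟨?_, ?_⟩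
    · have := e.symm.continuousAt (e.map_source hx)
      rw [ContinuousAt, e.left_inv hx] at this
      exact this.mono_left nhdsWithin_le_nhds
    · filter_upwards [nhdsWithin_le_nhds (e.open_target.mem_nhds (e.map_source hx)),
        self_mem_nhdsWithin] with z hz hzx h
      rw [mem_singleton_iff] at h
      exact hzx (by rw [mem_singleton_iff, ← h, e.right_inv hz])
  exact h.neBot

end Punctured

/-- A map `α` into a compact space `K` has a limit along a filter with a basis of connected sets if
`p ∘ α` has a limit whose fibre under `p` is finite. -/
theorem exists_tendsto_of_isPreconnected {C K M : Type*} [TopologicalSpace C] [TopologicalSpace K]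
    [TopologicalSpace M] [T2Space K] [CompactSpace K] [T2Space M] {p : K → M} (hp : Continuous p)
    {l : Filter C} [l.NeBot] (hl : ∀ U ∈ l, ∃ V ∈ l, V ⊆ U ∧ IsPreconnected V)
    {α : C → K} {U : Set C} (hU : U ∈ l) (hα : ContinuousOn α U) {y : M}
    (hy : Tendsto (fun x => p (α x)) l (𝓝 y)) (hfin : (p ⁻¹' {y}).Finite) :
    ∃ c, Tendsto α l (𝓝 c) := by
  obtain ⟨c, hc⟩ := exists_clusterPt_of_compactSpace (map α l)
  refine ⟨c, ?_⟩
  have hpc : p c = y := by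
    have h1 : ClusterPt (p c) (map p (map α l)) := hc.map hp.continuousAt tendsto_map
    have h2 : map p (map α l) ≤ 𝓝 y := by rw [Filter.map_map]; exact hy
    exact eq_of_nhds_neBot (h1.mono h2)
  intro O hO
  -- separate `c` from the rest of the fibre; a connected set that maps into the union of the two
  -- neighbourhoods and meets the first one stays in it
  have hsep : SeparatedNhds {c} (p ⁻¹' {y} \ {c}) :=
    SeparatedNhds.of_isCompact_isCompact isCompact_singleton (hfin.subset sdiff_subset).isCompact
      (by simp)
  obtain ⟨O1, O2, hO1, hO2, h1, h2, hd⟩ := hsep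
  have hcov : ∃ W ∈ 𝓝 y, p ⁻¹' W ⊆ (O1 ∩ interior O) ∪ O2 := by
    have h3 : comap p (𝓝 y) ≤ nhdsSet (p ⁻¹' {y}) :=
      isClosedMap_iff_comap_nhds_le.1 hp.isClosedMap
    have h4 : (O1 ∩ interior O) ∪ O2 ∈ nhdsSet (p ⁻¹' {y}) := by
      refine (((hO1.inter isOpen_interior).union hO2).mem_nhdsSet).2 fun q hq => ?_
      by_cases hqc : q = c
      · subst hqc
        exact .inl ⟨h1 rfl, mem_interior_iff_mem_nhds.2 hO⟩
      · exact .inr (h2 ⟨hq, hqc⟩)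
    exact h3 h4
  obtain ⟨W, hW, hWO⟩ := hcov
  obtain ⟨V, hV, hVU, hVc⟩ := hl _ (inter_mem hU (hy hW))
  have h5 : α '' V ⊆ (O1 ∩ interior O) ∪ O2 := by
    rintro _ ⟨v, hv, rfl⟩
    exact hWO (hVU hv).2
  have h6 : (α '' V ∩ (O1 ∩ interior O)).Nonempty := by
    have h7 : O1 ∩ interior O ∈ 𝓝 c := inter_mem (hO1.mem_nhds (h1 rfl)) (interior_mem_nhds.2 hO)
    have h8 := clusterPt_iff_nonempty.1 hc h7 (image_mem_map hV)
    rwa [inter_comm] at h8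
  have h9 := (hVc.image α (hα.mono fun v hv => (hVU hv).1)).subset_left_of_subset_union
    (hO1.inter isOpen_interior) hO2 (hd.mono_left inter_subset_left) h5 h6
  exact mem_map.2 (mem_of_superset hV fun v hv =>
    mem_preimage.2 (interior_subset (h9 (mem_image_of_mem α hv)).2 : α v ∈ O))

namespace Cover

/-! ### The covering map off the branch points -/

/-- Over the complement of the branch points `f` is a proper local homeomorphism, hence a
covering. -/
theorem isCoveringMapOn (X : Cover L) : IsCoveringMapOn X.f X.branchPointsᶜ := by
  refine .of_isLocalHomeomorphOn X.continuous (X.isLocalHomeomorphOn.mono fun x hx hr => ?_)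
  exact hx (mem_image_of_mem _ hr)

/-- Points over the finite set `B` are isolated. -/
theorem IsNonconstant.eventually_notMem {X : Cover L} (hX : X.IsNonconstant)
    {B : Set (EllipticCurve L)} (hB : B.Finite) (x : X.C) : ∀ᶠ q in 𝓝[≠] x, X.f q ∉ B := by
  have hx : x ∈ (chartAt ℂ x).source := mem_chart_source ℂ x
  have h1 : ∀ᶠ q in 𝓝[≠] x, X.f q ≠ X.f x := by
    have h2 := eventually_ne_of_order_ne_top (X.analyticAt_localMap hx)
      (order_localMap_ne_top hx X.continuous.continuousAt (hX x))
    have h3 : Tendsto (chartAt ℂ x) (𝓝[≠] x) (𝓝[≠] (chartAt ℂ x x)) := by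
      refine tendsto_nhdsWithin_iff.2 ⟨((chartAt ℂ x).continuousAt hx).tendsto.mono_left
        nhdsWithin_le_nhds, ?_⟩
      filter_upwards [nhdsWithin_le_nhds ((chartAt ℂ x).open_source.mem_nhds hx),
        self_mem_nhdsWithin] with q hq hqx h
      exact hqx ((chartAt ℂ x).injOn hq hx h)
    filter_upwards [h3.eventually h2,
      nhdsWithin_le_nhds ((chartAt ℂ x).open_source.mem_nhds hx)] with q hq hqs h
    apply hq
    rw [localMap_apply _ _ hx, localMap, (chartAt ℂ x).left_inv hqs, h]
  have h2 : ∀ᶠ q in 𝓝 x, X.f q ∉ B \ {X.f x} := by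
    refine X.continuous.continuousAt.eventually
      ((hB.subset sdiff_subset).isClosed.isOpen_compl.mem_nhds ?_)
    simp
  filter_upwards [h1, nhdsWithin_le_nhds h2] with q hq1 hq2 hq3
  exact hq2 ⟨hq3, hq1⟩

theorem IsNonconstant.finite_fiber {X : Cover L} (hX : X.IsNonconstant) (y : EllipticCurve L) :
    (X.f ⁻¹' {y}).Finite := by
  refine ((isClosed_singleton.preimage X.continuous).isCompact).finite ?_
  refine isDiscrete_iff_forall_mem_exists_isOpen.mpr fun x hx => ?_
  have h := hX.eventually_notMem (finite_singleton y) x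
  obtain ⟨U, hU, hUo, hxU⟩ := eventually_nhds_iff.1 (eventually_nhdsWithin_iff.1 h)
  refine ⟨U, hUo, subset_antisymm ?_ (by simpa using ⟨hxU, hx⟩)⟩
  rintro q ⟨hq1, hq2⟩
  by_contra hqx
  exact hU q hq1 hqx hq2

theorem IsNonconstant.dense_preimage_compl {X : Cover L} (hX : X.IsNonconstant)
    {B : Set (EllipticCurve L)} (hB : B.Finite) : Dense (X.f ⁻¹' Bᶜ) := by
  intro x
  have := neBot_punctured X.C x
  exact mem_closure_of_tendsto (tendsto_id.mono_left (nhdsWithin_le_nhds (s := {x}ᶜ)))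
    (hX.eventually_notMem hB x)

theorem IsSimple.finite_ramificationPoints {X : Cover L} (hX : X.IsSimple 2)
    (hB : X.branchPoints.Finite) : X.ramificationPoints.Finite :=
  Finite.of_finite_image hB hX.2

/-- Extension over the branch points: a continuous map over the elliptic curve, defined off finitely
many fibres, extends to the whole cover. -/
theorem exists_continuous_extension {X Y : Cover L} (hX : X.IsNonconstant) (hY : Y.IsNonconstant)
    {B : Set (EllipticCurve L)} (hB : B.Finite) {α : X.C → Y.C}
    (hα : ContinuousOn α (X.f ⁻¹' Bᶜ)) (h : ∀ x, X.f x ∉ B → Y.f (α x) = X.f x) :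
    ∃ α' : X.C → Y.C, Continuous α' ∧ (∀ x, Y.f (α' x) = X.f x) ∧
      ∀ x, X.f x ∉ B → α' x = α x := by
  have hd := hX.dense_preimage_compl hB
  have hc : Continuous (extendFrom (X.f ⁻¹' Bᶜ) α) := by
    refine continuous_extendFrom hd fun x => ?_
    by_cases hx : X.f x ∈ B
    · have h1 : 𝓝[X.f ⁻¹' Bᶜ] x ≤ 𝓝[≠] x := by
        refine nhdsWithin_mono _ ?_
        rintro q hq rfl
        exact hq hx
      have := neBot_punctured X.C x
      obtain ⟨c, hc⟩ := exists_tendsto_of_isPreconnected Y.continuous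
        (fun U hU => exists_isPreconnected_punctured x hU) (hX.eventually_notMem hB x) hα
        (y := X.f x) (by
        refine (X.continuous.continuousAt.tendsto.mono_left nhdsWithin_le_nhds).congr' ?_
        filter_upwards [hX.eventually_notMem hB x] with q hq
        exact (h q hq).symm) (hY.finite_fiber _)
      exact ⟨c, hc.mono_left h1⟩
    · exact ⟨α x, hα x hx⟩
  have he := extendFrom_extends hα
  refine ⟨_, hc, congrFun (Continuous.ext_on hd (Y.continuous.comp hc) X.continuous ?_), he⟩
  intro x hx
  beta_reduce
  rw [he x hx, h x hx]

/-- A homeomorphism over the elliptic curve, defined off finitely many fibres, extends to an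
isomorphism of covers. -/
theorem exists_iso_of_continuousOn {X Y : Cover L} (hX : X.IsNonconstant) (hY : Y.IsNonconstant)
    {B : Set (EllipticCurve L)} (hB : B.Finite) {α : X.C → Y.C} {β : Y.C → X.C}
    (hα : ContinuousOn α (X.f ⁻¹' Bᶜ)) (hαf : ∀ x, X.f x ∉ B → Y.f (α x) = X.f x)
    (hβ : ContinuousOn β (Y.f ⁻¹' Bᶜ)) (hβf : ∀ y, Y.f y ∉ B → X.f (β y) = Y.f y)
    (hαβ : ∀ x, X.f x ∉ B → β (α x) = x) (hβα : ∀ y, Y.f y ∉ B → α (β y) = y) :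
    Nonempty (Iso X Y) := by
  obtain ⟨α', hα', hαf', hαe⟩ := exists_continuous_extension hX hY hB hα hαf
  obtain ⟨β', hβ', hβf', hβe⟩ := exists_continuous_extension hY hX hB hβ hβf
  refine ⟨(isoEquiv hX hY).symm ⟨⟨⟨α', β', ?_, ?_⟩, hα', hβ'⟩, hαf'⟩⟩
  · refine congrFun (Continuous.ext_on (hX.dense_preimage_compl hB) (hβ'.comp hα')
      continuous_id ?_)
    intro x hx
    beta_reduce
    rw [hαe x hx, hβe _ (by rw [hαf x hx]; exact hx), hαβ x hx]
  · refine congrFun (Continuous.ext_on (hY.dense_preimage_compl hB) (hα'.comp hβ')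
      continuous_id ?_)
    intro x hx
    beta_reduce
    rw [hβe x hx, hαe _ (by rw [hβf x hx]; exact hx), hβα x hx]

/-! ### Fibres -/

/-- Lifts along `Y.f` that avoid the fibres over the branch points are unique. -/
theorem lift_unique (Y : Cover L) {B : Set (EllipticCurve L)} (hYB : Y.branchPoints ⊆ B)
    {A : Type*} [TopologicalSpace A] [PreconnectedSpace A] {g₁ g₂ : A → Y.C}
    (h₁ : Continuous g₁) (h₂ : Continuous g₂) (h : ∀ a, Y.f (g₁ a) = Y.f (g₂ a))
    (hB : ∀ a, Y.f (g₁ a) ∉ B) (a : A) (ha : g₁ a = g₂ a) : g₁ = g₂ := by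
  have hcov := (Y.isCoveringMapOn.mono (compl_subset_compl.2 hYB)).isCoveringMap_restrictPreimage
  have h1 := hcov.eq_of_comp_eq (g₁ := fun t => ⟨g₁ t, hB t⟩)
    (g₂ := fun t => ⟨g₂ t, by rw [mem_preimage, ← h]; exact hB t⟩)
    (by fun_prop) (by fun_prop) (funext fun t => Subtype.ext (h t)) a (Subtype.ext ha)
  exact funext fun t => congrArg Subtype.val (congrFun h1 t)

/-- Every point off the branch points can be joined to any fibre off the branch points. -/
theorem exists_path_to_fiber (X : Cover L) {B : Set (EllipticCurve L)} (hB : B.Finite)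
    (hXB : X.branchPoints ⊆ B) {x : X.C} (hx : X.f x ∉ B) {y : EllipticCurve L} (hy : y ∉ B) :
    ∃ γ : C(unitInterval, X.C), γ 0 = x ∧ X.f (γ 1) = y ∧ ∀ t, X.f (γ t) ∉ B := by
  have hcov := (X.isCoveringMapOn.mono (compl_subset_compl.2 hXB)).isCoveringMap_restrictPreimage
  have hpc : PathConnectedSpace (Bᶜ : Set (EllipticCurve L)) :=
    isPathConnected_iff_pathConnectedSpace.1 (isPathConnected_compl hB)
  obtain ⟨p⟩ := hpc.joined ⟨X.f x, hx⟩ ⟨y, hy⟩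
  obtain ⟨Γ, hΓ, hΓ0⟩ := hcov.exists_path_lifts p.toContinuousMap ⟨x, hx⟩ p.source
  refine ⟨⟨fun t => (Γ t).1, by fun_prop⟩, by simp [hΓ0], ?_, fun t => (Γ t).2⟩
  have h1 := congrArg Subtype.val (congrFun hΓ 1)
  exact h1.trans (congrArg Subtype.val p.target)

/-- Maps of covers over the elliptic curve are determined by their restriction to one fibre. -/
theorem eq_of_eqOn_fiber {X Y : Cover L} (hX : X.IsNonconstant) {B : Set (EllipticCurve L)}
    (hB : B.Finite) (hXB : X.branchPoints ⊆ B) (hYB : Y.branchPoints ⊆ B) {y : EllipticCurve L}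
    (hy : y ∉ B) {φ ψ : X.C → Y.C} (hφ : Continuous φ) (hψ : Continuous ψ)
    (hφf : ∀ x, Y.f (φ x) = X.f x) (hψf : ∀ x, Y.f (ψ x) = X.f x)
    (h : ∀ x, X.f x = y → φ x = ψ x) : φ = ψ := by
  refine Continuous.ext_on (hX.dense_preimage_compl hB) hφ hψ fun x hx => ?_
  obtain ⟨γ, hγ0, hγ1, hγ⟩ := X.exists_path_to_fiber hB hXB hx hy
  have h2 := congrFun (Y.lift_unique hYB (g₁ := fun t => φ (γ t)) (g₂ := fun t => ψ (γ t))
    (by fun_prop) (by fun_prop) (fun t => by rw [hφf, hψf]) (fun t => by rw [hφf]; exact hγ t) 1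
    (h _ hγ1)) 0
  rw [← hγ0]
  exact h2

/-- Monodromy along a path from `y` to `y'` identifies the fibres. -/
theorem encard_fiber_eq (X : Cover L) {B : Set (EllipticCurve L)} (hB : B.Finite)
    (hXB : X.branchPoints ⊆ B) {y y' : EllipticCurve L} (hy : y ∉ B) (hy' : y' ∉ B) :
    (X.f ⁻¹' {y}).encard = (X.f ⁻¹' {y'}).encard := by
  have hcov := (X.isCoveringMapOn.mono (compl_subset_compl.2 hXB)).isCoveringMap_restrictPreimage
  have hpc : PathConnectedSpace (Bᶜ : Set (EllipticCurve L)) :=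
    isPathConnected_iff_pathConnectedSpace.1 (isPathConnected_compl hB)
  obtain ⟨p⟩ := hpc.joined ⟨y, hy⟩ ⟨y', hy'⟩
  have hb := hcov.monodromy_bijective (.mk p)
  have he : ∀ z : (Bᶜ : Set (EllipticCurve L)), (X.f ⁻¹' {z.1}).encard =
      ENat.card ((Bᶜ : Set (EllipticCurve L)).restrictPreimage X.f ⁻¹' {z}) := by
    intro z
    refine ENat.card_congr (Equiv.symm ⟨fun x => ⟨x.1.1, congrArg Subtype.val x.2⟩,
      fun x => ⟨⟨x.1, by rw [mem_preimage, show X.f x.1 = z.1 from x.2]; exact z.2⟩,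
        Subtype.ext x.2⟩, fun x => rfl, fun x => rfl⟩)
  rw [he ⟨y, hy⟩, he ⟨y', hy'⟩]
  exact ENat.card_congr (Equiv.ofBijective _ hb)

/-- The degree can be read off from one fibre. -/
theorem hasDegree_iff (X : Cover L) {B : Set (EllipticCurve L)} (hB : B.Finite)
    (hXB : X.branchPoints ⊆ B) {y : EllipticCurve L} (hy : y ∉ B) {d : ℕ} :
    X.HasDegree d ↔ (X.f ⁻¹' {y}).encard = d := by
  refine ⟨fun h => h y fun h' => hy (hXB h'), fun h y' hy' => ?_⟩
  rw [← h]
  exact X.encard_fiber_eq (hB.subset hXB) subset_rfl hy' fun h' => hy (hXB h')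

end Cover

/-! ### Finiteness -/

theorem isLocalHomeomorph_mk (L : PeriodPair) :
    IsLocalHomeomorph (QuotientAddGroup.mk : ℂ → EllipticCurve L) :=
  (isCoveringMap_mk L).isLocalHomeomorph

/-- `K` is a bounded open convex set on which the projection to the elliptic curve avoids `B`. -/
structure IsConvexPatch (B : Set (EllipticCurve L)) (K : Set ℂ) : Prop where
  convex : Convex ℝ K
  isOpen : IsOpen K
  nonempty : K.Nonempty
  isBounded : Bornology.IsBounded K
  notMem : ∀ u ∈ K, (QuotientAddGroup.mk u : EllipticCurve L) ∉ B

/-- Near a point of `B` the complement of `B` is covered by four half-discs. -/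
theorem exists_patches_nhds {B : Set (EllipticCurve L)} (hB : B.Finite) (p : EllipticCurve L) :
    ∃ O ∈ 𝓝 p, ∃ 𝒦 : Set (Set ℂ), 𝒦.Finite ∧ (∀ K ∈ 𝒦, IsConvexPatch B K) ∧
      ∀ y ∈ O, y ∉ B → ∃ K ∈ 𝒦, ∃ u ∈ K, (QuotientAddGroup.mk u : EllipticCurve L) = y := by
  obtain ⟨z, rfl⟩ := QuotientAddGroup.mk_surjective p
  have hop := isLocalHomeomorph_mk L
  obtain ⟨U, hU, hzU, hinj⟩ := hop.isLocallyInjective z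
  have h1 : U ∩ QuotientAddGroup.mk ⁻¹' (B \ {(QuotientAddGroup.mk z : EllipticCurve L)})ᶜ ∈
      𝓝 z := by
    refine inter_mem (hU.mem_nhds hzU) (hop.continuous.continuousAt.preimage_mem_nhds ?_)
    exact (hB.subset sdiff_subset).isClosed.isOpen_compl.mem_nhds (by simp)
  obtain ⟨r, hr, hrU⟩ := Metric.mem_nhds_iff.1 h1
  have hav : ∀ u ∈ Metric.ball z r, u ≠ z → (QuotientAddGroup.mk u : EllipticCurve L) ∉ B := by
    intro u hu hne hB'
    refine (hrU hu).2 ⟨hB', fun h => hne (hinj (hrU hu).1 hzU h)⟩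
  have hO : (QuotientAddGroup.mk : ℂ → EllipticCurve L) '' Metric.ball z r ∈
      𝓝 (QuotientAddGroup.mk z : EllipticCurve L) :=
    hop.isOpenMap.image_mem_nhds (Metric.ball_mem_nhds z hr)
  refine ⟨_, hO, ?_⟩
  by_cases hz : (QuotientAddGroup.mk z : EllipticCurve L) ∈ B
  · let H : ℂ → Set ℂ := fun c => Metric.ball z r ∩ {u | 0 < ((u - z) * c).re}
    have hH : ∀ c : ℂ, ‖c‖ = 1 → IsConvexPatch B (H c) := by
      intro c hc
      have hc0 : c ≠ 0 := by rintro rfl; simp at hc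
      refine ⟨(convex_ball z r).inter ?_, Metric.isOpen_ball.inter
        (isOpen_lt continuous_const (by fun_prop)), ⟨z + (r / 2 : ℝ) * star c, ?_, ?_⟩,
        Metric.isBounded_ball.subset inter_subset_left, ?_⟩
      · have h2 : {u : ℂ | 0 < ((u - z) * c).re} = {u | (z * c).re < (u * c).re} := by
          ext u; simp [sub_mul]
        rw [h2]
        refine convex_halfSpace_gt (f := fun u : ℂ => (u * c).re) ⟨fun x y => ?_, fun a x => ?_⟩ _
        · simp [add_mul]
        · simp [mul_assoc]
      · rw [Metric.mem_ball, dist_eq_norm, add_sub_cancel_left, norm_mul, norm_star, hc,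
          Complex.norm_real, Real.norm_of_nonneg (by positivity)]
        linarith
      · have h3 : star c * c = 1 := by
          have := Complex.conj_mul' c
          rw [hc] at this
          simpa using this
        simp only [mem_ofPred_eq, add_sub_cancel_left]
        rw [mul_assoc, h3, mul_one, Complex.ofReal_re]
        positivity
      · rintro u ⟨hu, hu2⟩
        refine hav u hu ?_
        rintro rfl
        simp at hu2
    refine ⟨{H 1, H (-1), H Complex.I, H (-Complex.I)}, by simp, ?_, ?_⟩
    · rintro K (rfl | rfl | rfl | rfl) <;> exact hH _ (by simp)
    · rintro _ ⟨u, hu, rfl⟩ hyB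
      have hne : u - z ≠ 0 := by
        intro h
        rw [sub_eq_zero] at h
        exact hyB (h ▸ hz)
      rcases lt_trichotomy (u - z).re 0 with h | h | h
      · exact ⟨H (-1), by simp, u, ⟨hu, by simpa using h⟩, rfl⟩
      · rcases lt_trichotomy (u - z).im 0 with h' | h' | h'
        · exact ⟨H Complex.I, by simp, u, ⟨hu, by simpa using h'⟩, rfl⟩
        · exact absurd (Complex.ext h h') hne
        · exact ⟨H (-Complex.I), by simp, u, ⟨hu, by simpa using h'⟩, rfl⟩
      · exact ⟨H 1, by simp, u, ⟨hu, by simpa using h⟩, rfl⟩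
  · refine ⟨{Metric.ball z r}, finite_singleton _, ?_, ?_⟩
    · rintro K rfl
      refine ⟨convex_ball _ _, Metric.isOpen_ball, ⟨z, Metric.mem_ball_self hr⟩,
        Metric.isBounded_ball, fun u hu => ?_⟩
      by_cases h : u = z
      · rwa [h]
      · exact hav u hu h
    · rintro _ ⟨u, hu, rfl⟩ -
      exact ⟨_, rfl, u, hu, rfl⟩

/-- By compactness, finitely many convex patches cover the complement of `B`, although this
complement is not compact: near each point of `B` four half-discs suffice. -/
theorem exists_patches {B : Set (EllipticCurve L)} (hB : B.Finite) :
    ∃ 𝒦 : Set (Set ℂ), 𝒦.Finite ∧ (∀ K ∈ 𝒦, IsConvexPatch B K) ∧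
      ∀ y ∉ B, ∃ K ∈ 𝒦, ∃ u ∈ K, (QuotientAddGroup.mk u : EllipticCurve L) = y := by
  have h := (isCompact_univ (X := EllipticCurve L)).induction_on
    (p := fun O => ∃ 𝒦 : Set (Set ℂ), 𝒦.Finite ∧ (∀ K ∈ 𝒦, IsConvexPatch B K) ∧
      ∀ y ∈ O, y ∉ B → ∃ K ∈ 𝒦, ∃ u ∈ K, (QuotientAddGroup.mk u : EllipticCurve L) = y)
    ⟨∅, finite_empty, by simp, by simp⟩
    (fun s t hst ⟨𝒦, h1, h2, h3⟩ => ⟨𝒦, h1, h2, fun y hy => h3 y (hst hy)⟩)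
    (fun s t ⟨𝒦, h1, h2, h3⟩ ⟨𝒦', h1', h2', h3'⟩ => ⟨𝒦 ∪ 𝒦', h1.union h1',
      fun K hK => hK.elim (h2 K) (h2' K), fun y hy hyB => hy.elim
        (fun hy => (h3 y hy hyB).imp fun K hK => ⟨.inl hK.1, hK.2⟩)
        (fun hy => (h3' y hy hyB).imp fun K hK => ⟨.inr hK.1, hK.2⟩)⟩)
    (fun p _ => by
      obtain ⟨O, hO, h⟩ := exists_patches_nhds hB p
      exact ⟨O, mem_nhdsWithin_of_mem_nhds hO, h⟩)
  obtain ⟨𝒦, h1, h2, h3⟩ := h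
  exact ⟨𝒦, h1, h2, fun y hy => h3 y trivial hy⟩

namespace Cover

/-- A cover is trivial over the image of a convex set that avoids the branch points. -/
theorem exists_lift (X : Cover L) {B : Set (EllipticCurve L)} (hXB : X.branchPoints ⊆ B)
    {K : Set ℂ} (hK : Convex ℝ K) (hKo : IsOpen K)
    (hKB : ∀ u ∈ K, (QuotientAddGroup.mk u : EllipticCurve L) ∉ B) {x : X.C} (u : K)
    (hx : X.f x = QuotientAddGroup.mk (u : ℂ)) :
    ∃ s : K → X.C, Continuous s ∧ (∀ v, X.f (s v) = QuotientAddGroup.mk (v : ℂ)) ∧ s u = x := by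
  have hc := hK.contractibleSpace ⟨u, u.2⟩
  have hl := hKo.locallyPathConnectedSpace
  obtain ⟨F, ⟨hF1, hF2⟩, -⟩ :=
    (X.isCoveringMapOn.mono (compl_subset_compl.2 hXB)).existsUnique_continuousMap_lifts
      (⟨fun v : K => (QuotientAddGroup.mk (v : ℂ) : EllipticCurve L),
        QuotientAddGroup.continuous_mk.comp continuous_subtype_val⟩ : C(K, EllipticCurve L)) hx
      (fun a => hKB a a.2)
  exact ⟨F, F.continuous, congrFun hF2, hF1⟩

theorem HasDegree.nonempty_equiv {X : Cover L} {d : ℕ} (hd : X.HasDegree d) {y : EllipticCurve L}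
    (hy : y ∉ X.branchPoints) : Nonempty (Fin d ≃ X.f ⁻¹' {y}) := by
  have h := hd y hy
  have hf : (X.f ⁻¹' {y}).Finite := finite_of_encard_eq_coe h
  have := hf.fintype
  rw [encard_eq_coe_toFinset_card, toFinset_card, Nat.cast_inj] at h
  exact ⟨(Fintype.equivFinOfCardEq h).symm⟩

/-- A trivialization of the cover `X` of degree `d` over each convex patch in `𝒦`. -/
structure Sheets (X : Cover L) (𝒦 : Set (Set ℂ)) (d : ℕ) where
  /-- The `k`-th sheet over the patch `K`. -/
  s : ∀ K : 𝒦, Fin d → K.1 → X.C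
  continuous : ∀ K k, Continuous (s K k)
  f_s : ∀ K k u, X.f (s K k u) = QuotientAddGroup.mk (u : ℂ)
  exists_eq : ∀ (K : 𝒦) (u : K.1) x, X.f x = QuotientAddGroup.mk (u : ℂ) → ∃ k, s K k u = x

/-- Patches are simply connected, so the sheets exist; a point of the fibre over the base point of a
patch determines its sheet. -/
theorem nonempty_sheets {X : Cover L} {B : Set (EllipticCurve L)} (hXB : X.branchPoints ⊆ B)
    {𝒦 : Set (Set ℂ)} (h𝒦 : ∀ K ∈ 𝒦, IsConvexPatch B K) {d : ℕ} (hd : X.HasDegree d) :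
    Nonempty (X.Sheets 𝒦 d) := by
  have h0 : ∀ K : 𝒦, ∃ s : Fin d → K.1 → X.C, (∀ k, Continuous (s k)) ∧
      (∀ k u, X.f (s k u) = QuotientAddGroup.mk (u : ℂ)) ∧
      ∀ (u : K.1) x, X.f x = QuotientAddGroup.mk (u : ℂ) → ∃ k, s k u = x := by
    rintro ⟨K, hK⟩
    have hp := h𝒦 K hK
    obtain ⟨u₀, hu₀⟩ := hp.nonempty
    obtain ⟨ℓ⟩ := hd.nonempty_equiv (fun h => hp.notMem u₀ hu₀ (hXB h))
    choose s hs1 hs2 hs3 using fun k => X.exists_lift hXB hp.convex hp.isOpen hp.notMem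
      (x := (ℓ k).1) ⟨u₀, hu₀⟩ (ℓ k).2
    refine ⟨s, hs1, hs2, fun u x hx => ?_⟩
    obtain ⟨t, ht1, ht2, ht3⟩ := X.exists_lift hXB hp.convex hp.isOpen hp.notMem u hx
    refine ⟨ℓ.symm ⟨t ⟨u₀, hu₀⟩, ht2 _⟩, ?_⟩
    have : PreconnectedSpace K := Subtype.preconnectedSpace hp.convex.isPreconnected
    rw [← ht3]
    refine congrFun (X.lift_unique hXB (hs1 _) ht1 (fun v => by rw [hs2, ht2])
      (fun v => by rw [hs2]; exact hp.notMem v v.2) ⟨u₀, hu₀⟩ ?_) u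
    rw [hs3, Equiv.apply_symm_apply]
  choose s h1 h2 h3 using h0
  exact ⟨⟨s, h1, h2, h3⟩⟩

/-- The gluing data of a trivialization: over which translates of the patches which sheets meet. -/
def Sheets.gluing {X : Cover L} {𝒦 : Set (Set ℂ)} {d : ℕ} (S : X.Sheets 𝒦 d) :
    Set ((𝒦 × 𝒦) × (Fin d × Fin d) × ℂ) :=
  {t | t.2.2 ∈ L.lattice ∧ ∃ (u : t.1.1.1) (v : t.1.2.1), (v : ℂ) = u + t.2.2 ∧
    S.s t.1.1 t.2.1.1 u = S.s t.1.2 t.2.1.2 v}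

/-- Sheets that meet at one point of the connected set `K ∩ (K' - λ)` agree on all of it. -/
theorem Sheets.eq_of_mem_gluing {X : Cover L} {B : Set (EllipticCurve L)}
    (hXB : X.branchPoints ⊆ B) {𝒦 : Set (Set ℂ)} (h𝒦 : ∀ K ∈ 𝒦, IsConvexPatch B K) {d : ℕ}
    (S : X.Sheets 𝒦 d) {K K' : 𝒦} {k k' : Fin d} {l : ℂ} (h : ((K, K'), (k, k'), l) ∈ S.gluing)
    (u : K.1) (v : K'.1) (huv : (v : ℂ) = u + l) : S.s K k u = S.s K' k' v := by
  obtain ⟨hl, u₀, v₀, h0, h1⟩ := h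
  simp only at hl u₀ v₀ h0 h1
  let A : Set ℂ := K.1 ∩ (fun w => w + l) ⁻¹' K'.1
  have hA : Convex ℝ A := (h𝒦 K K.2).convex.inter
    ((h𝒦 K' K'.2).convex.translate_preimage_left l)
  have : PreconnectedSpace A := Subtype.preconnectedSpace hA.isPreconnected
  have hc1 := S.continuous K k
  have hc2 := S.continuous K' k'
  have := congrFun (X.lift_unique hXB (g₁ := fun w : A => S.s K k ⟨w, w.2.1⟩)
    (g₂ := fun w : A => S.s K' k' ⟨w + l, w.2.2⟩) (by fun_prop) (by fun_prop)
    (fun w => ?_) (fun w => by rw [S.f_s]; exact (h𝒦 K K.2).notMem w w.2.1)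
    ⟨u₀, u₀.2, show (u₀ : ℂ) + l ∈ K'.1 from h0 ▸ v₀.2⟩ ?_)
    ⟨u, u.2, show (u : ℂ) + l ∈ K'.1 from huv ▸ v.2⟩
  · simp only at this
    rw [this]
    congr 1
    exact Subtype.ext huv.symm
  · rw [S.f_s, S.f_s, QuotientAddGroup.eq]
    change -(w : ℂ) + (w + l) ∈ L.lattice
    simpa using hl
  · simp only
    rw [h1]
    congr 1
    exact Subtype.ext h0

/-- There are only finitely many gluing data: the patches are bounded, so only finitely many lattice
translates of one patch meet another. -/
theorem finite_gluing {B : Set (EllipticCurve L)} {𝒦 : Set (Set ℂ)} (hfin : 𝒦.Finite)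
    (h𝒦 : ∀ K ∈ 𝒦, IsConvexPatch B K) (d : ℕ) :
    ∃ T : Set ((𝒦 × 𝒦) × (Fin d × Fin d) × ℂ), T.Finite ∧
      ∀ (X : Cover L) (S : X.Sheets 𝒦 d), S.gluing ⊆ T := by
  have : Finite 𝒦 := hfin
  have hb : Bornology.IsBounded (⋃ p : 𝒦 × 𝒦, (p.2.1 - p.1.1 : Set ℂ)) := by
    exact Bornology.isBounded_iUnion.2 fun p => (h𝒦 _ p.2.2).isBounded.sub (h𝒦 _ p.1.2).isBounded
  have hF : ((⋃ p : 𝒦 × 𝒦, (p.2.1 - p.1.1 : Set ℂ)) ∩ (L.lattice : Set ℂ)).Finite :=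
    Metric.finite_isBounded_inter_isClosed ⟨inferInstanceAs (DiscreteTopology L.lattice)⟩ hb
      L.isClosed_lattice
  refine ⟨univ ×ˢ univ ×ˢ _, finite_univ.prod (finite_univ.prod hF), fun X S => ?_⟩
  rintro ⟨p, q, l⟩ ⟨hl, u, v, huv, -⟩
  refine ⟨trivial, trivial, mem_iUnion.2 ⟨p, ?_⟩, hl⟩
  exact ⟨v, v.2, u, u.2, by simp [huv]⟩

theorem Sheets.isLocalHomeomorph {X : Cover L} {B : Set (EllipticCurve L)}
    (hXB : X.branchPoints ⊆ B) {𝒦 : Set (Set ℂ)} (h𝒦 : ∀ K ∈ 𝒦, IsConvexPatch B K) {d : ℕ}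
    (S : X.Sheets 𝒦 d) (K : 𝒦) (k : Fin d) : IsLocalHomeomorph (S.s K k) := by
  rw [isLocalHomeomorph_iff_isLocalHomeomorphOn_univ]
  have h1 : X.f ∘ S.s K k = (QuotientAddGroup.mk : ℂ → EllipticCurve L) ∘ Subtype.val :=
    funext fun u => S.f_s K k u
  refine IsLocalHomeomorphOn.of_comp_left (g := X.f) ?_ ?_
    (fun x _ => (S.continuous K k).continuousAt)
  · rw [h1, ← isLocalHomeomorph_iff_isLocalHomeomorphOn_univ]
    exact (isLocalHomeomorph_mk L).comp
      ((h𝒦 K K.2).isOpen.isOpenEmbedding_subtypeVal).isLocalHomeomorph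
  · refine X.isLocalHomeomorphOn.mono ?_
    rintro _ ⟨u, -, rfl⟩ hr
    have := hXB (mem_image_of_mem X.f hr)
    rw [S.f_s] at this
    exact (h𝒦 K K.2).notMem u u.2 this

/-- Sending each sheet of `X` to the sheet of `Y` with the same label is well defined off the branch
points if sheets that meet in `X` also meet in `Y`. -/
theorem Sheets.exists_map {X Y : Cover L} (hX : X.IsNonconstant) {B : Set (EllipticCurve L)}
    (hB : B.Finite) (hXB : X.branchPoints ⊆ B) (hYB : Y.branchPoints ⊆ B) {𝒦 : Set (Set ℂ)}
    (h𝒦 : ∀ K ∈ 𝒦, IsConvexPatch B K)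
    (hcov : ∀ y ∉ B, ∃ K ∈ 𝒦, ∃ u ∈ K, (QuotientAddGroup.mk u : EllipticCurve L) = y) {d : ℕ}
    (S : X.Sheets 𝒦 d) (S' : Y.Sheets 𝒦 d) (h : S.gluing ⊆ S'.gluing) :
    ∃ α : X.C → Y.C, ContinuousOn α (X.f ⁻¹' Bᶜ) ∧ (∀ x, X.f x ∉ B → Y.f (α x) = X.f x) ∧
      ∀ K k u, α (S.s K k u) = S'.s K k u := by
  have hex : ∀ x, X.f x ∉ B → ∃ (K : 𝒦) (k : Fin d) (u : K.1), S.s K k u = x := by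
    intro x hx
    obtain ⟨K, hK, u, hu, hux⟩ := hcov _ hx
    obtain ⟨k, hk⟩ := S.exists_eq ⟨K, hK⟩ ⟨u, hu⟩ x hux.symm
    exact ⟨_, _, _, hk⟩
  have hα : ∀ x, ∃ y : Y.C, ∀ K k u, S.s K k u = x → S'.s K k u = y := by
    intro x
    -- over `B` any value will do: there are no sheets to respect
    by_cases hx : X.f x ∈ B
    · have : Nonempty X.C := ⟨x⟩
      obtain ⟨x', hx'⟩ := (hX.dense_preimage_compl hB).nonempty
      obtain ⟨K, k, u, -⟩ := hex x' hx'
      refine ⟨S'.s K k u, fun K' k' u' h' => ?_⟩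
      rw [← h', S.f_s] at hx
      exact absurd hx ((h𝒦 K' K'.2).notMem u' u'.2)
    · obtain ⟨K, k, u, rfl⟩ := hex x hx
      refine ⟨S'.s K k u, fun K' k' u' h' => ?_⟩
      have h1 : (u : ℂ) - u' ∈ L.lattice := by
        have h2 := congrArg X.f h'
        rw [S.f_s, S.f_s, QuotientAddGroup.eq] at h2
        change -(u' : ℂ) + u ∈ L.lattice at h2
        rwa [neg_add_eq_sub] at h2
      exact S'.eq_of_mem_gluing hYB h𝒦 (h (show ((K', K), (k', k), (u : ℂ) - u') ∈ S.gluing from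
        ⟨h1, u', u, by simp, h'⟩)) u' u (by simp)
  choose α hα using hα
  refine ⟨α, fun x hx => ?_, fun x hx => ?_, fun K k u => (hα _ K k u rfl).symm⟩
  · obtain ⟨K, k, u, rfl⟩ := hex x hx
    refine ContinuousAt.continuousWithinAt ?_
    rw [ContinuousAt, ← (S.isLocalHomeomorph hXB h𝒦 K k).map_nhds_eq u, tendsto_map'_iff,
      ← hα _ K k u rfl]
    refine ((S'.continuous K k).tendsto u).congr fun v => hα _ K k v rfl
  · obtain ⟨K, k, u, rfl⟩ := hex x hx
    rw [← hα _ K k u rfl, S.f_s, S'.f_s]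

/-- The gluing data determine a cover up to isomorphism. -/
theorem nonempty_iso_of_gluing_eq {X Y : Cover L} (hX : X.IsNonconstant) (hY : Y.IsNonconstant)
    {B : Set (EllipticCurve L)} (hB : B.Finite) (hXB : X.branchPoints ⊆ B)
    (hYB : Y.branchPoints ⊆ B) {𝒦 : Set (Set ℂ)} (h𝒦 : ∀ K ∈ 𝒦, IsConvexPatch B K)
    (hcov : ∀ y ∉ B, ∃ K ∈ 𝒦, ∃ u ∈ K, (QuotientAddGroup.mk u : EllipticCurve L) = y) {d : ℕ}
    (S : X.Sheets 𝒦 d) (S' : Y.Sheets 𝒦 d) (h : S.gluing = S'.gluing) : Nonempty (Iso X Y) := by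
  obtain ⟨α, hα, hαf, hαs⟩ := S.exists_map hX hB hXB hYB h𝒦 hcov S' h.subset
  obtain ⟨β, hβ, hβf, hβs⟩ := S'.exists_map hY hB hYB hXB h𝒦 hcov S h.symm.subset
  refine exists_iso_of_continuousOn hX hY hB hα hαf hβ hβf (fun x hx => ?_) (fun y hy => ?_)
  · obtain ⟨K, hK, u, hu, hux⟩ := hcov _ hx
    obtain ⟨k, rfl⟩ := S.exists_eq ⟨K, hK⟩ ⟨u, hu⟩ x hux.symm
    rw [hαs, hβs]
  · obtain ⟨K, hK, u, hu, hux⟩ := hcov _ hy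
    obtain ⟨k, rfl⟩ := S'.exists_eq ⟨K, hK⟩ ⟨u, hu⟩ y hux.symm
    rw [hβs, hαs]

end Cover

/-- A choice of trivialization embeds the isomorphism classes into the finite set of possible gluing
data. -/
theorem finite_isoClasses {S : Set (Cover L)} {B : Set (EllipticCurve L)} (hB : B.Finite) {d : ℕ}
    (hS : ∀ X ∈ S, X.IsNonconstant ∧ X.branchPoints ⊆ B ∧ X.HasDegree d) :
    Finite (IsoClasses S) := by
  obtain ⟨𝒦, hfin, h𝒦, hcov⟩ := exists_patches hB
  obtain ⟨T, hT, hsub⟩ := Cover.finite_gluing (L := L) hfin h𝒦 d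
  have hsh : ∀ c : IsoClasses S, Nonempty (c.out.1.Sheets 𝒦 d) := fun c =>
    Cover.nonempty_sheets (hS _ c.out.2).2.1 h𝒦 (hS _ c.out.2).2.2
  let D : IsoClasses S → {t | t ⊆ T} := fun c => ⟨(hsh c).some.gluing, hsub _ _⟩
  have : Finite {t | t ⊆ T} := hT.finite_subsets
  refine Finite.of_injective D fun c c' h => ?_
  rw [← Quotient.out_eq c, ← Quotient.out_eq c']
  exact Quotient.sound (Cover.nonempty_iso_of_gluing_eq (hS _ c.out.2).1 (hS _ c'.out.2).1 hB
    (hS _ c.out.2).2.1 (hS _ c'.out.2).2.1 h𝒦 hcov _ _ (congrArg Subtype.val h))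

/-- An isomorphism is determined by its action on one fibre, which is a finite set. -/
theorem Cover.finite_iso {X Y : Cover L} (hX : X.IsNonconstant) (hY : Y.IsNonconstant)
    {B : Set (EllipticCurve L)} (hB : B.Finite) (hXB : X.branchPoints ⊆ B)
    (hYB : Y.branchPoints ⊆ B) : Finite (Iso X Y) := by
  obtain ⟨y, hy⟩ := (isPathConnected_compl hB).nonempty
  have h1 := (hX.finite_fiber y).to_subtype
  have h2 := (hY.finite_fiber y).to_subtype
  refine Finite.of_injective (β := X.f ⁻¹' {y} → Y.f ⁻¹' {y})
    (fun φ x => ⟨φ.1 x, (φ.2 x).trans x.2⟩) fun φ ψ h => ?_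
  have h3 := Cover.eq_of_eqOn_fiber hX hB hXB hYB hy φ.1.continuous ψ.1.continuous φ.2 ψ.2
    fun x hx => congrArg Subtype.val (congrFun h ⟨x, hx⟩)
  exact Subtype.ext (DFunLike.coe_injective h3)

namespace Cover

/-! ### The genus of a cover -/

/-- The pullback along `f` of the invariant `1`-form `dz` on the elliptic curve. -/
def pullbackForm (X : Cover L) (x : X.C) : TangentSpace 𝓘(ℂ) x →L[ℂ] ℂ :=
  mfderiv 𝓘(ℂ) 𝓘(ℂ) (fun q => chartAt ℂ (X.f x) (X.f q)) x

theorem formCoeff_pullbackForm_eq (X : Cover L) (p : X.C) {z : ℂ}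
    (hz : z ∈ (chartAt ℂ p).target) :
    formCoeff X.pullbackForm p z =
      deriv (localMap X.f (chartAt ℂ p) ((chartAt ℂ p).symm z)) z := by
  set e := chartAt ℂ p
  have h1 : MDifferentiableAt 𝓘(ℂ) 𝓘(ℂ) e.symm z :=
    mdifferentiableAt_atlas_symm (chart_mem_atlas ℂ p) hz
  have h2 : MDifferentiableAt 𝓘(ℂ) 𝓘(ℂ)
      (fun q => chartAt ℂ (X.f (e.symm z)) (X.f q)) (e.symm z) :=
    (mdifferentiableAt_atlas (chart_mem_atlas ℂ _) (mem_chart_source ℂ _)).comp (e.symm z)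
      (X.holomorphic.mdifferentiableAt (by simp))
  have h3 := mfderiv_comp z h2 h1
  rw [formCoeff, pullbackForm, ← fderiv_apply_one_eq_deriv, ← mfderiv_eq_fderiv]
  exact (congrArg (fun T => T (1 : ℂ)) h3).symm

/-- In a chart of `C` at `p`, the form `f^* dz` is the differential of `f`. -/
theorem formCoeff_pullbackForm_eventuallyEq (X : Cover L) (p : X.C) :
    formCoeff X.pullbackForm p =ᶠ[𝓝 (chartAt ℂ p p)] deriv (localMap X.f (chartAt ℂ p) p) := by
  set e := chartAt ℂ p with he
  have hp : p ∈ e.source := mem_chart_source ℂ p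
  have hcont : ∀ z ∈ e.target, ContinuousAt (fun w => X.f (e.symm w)) z := fun z hz =>
    X.continuous.continuousAt.comp (e.symm.continuousAt hz)
  have hsrc : ∀ᶠ z in 𝓝 (e p), X.f (e.symm z) ∈ (chartAt ℂ (X.f p)).source := by
    refine (hcont _ (e.map_source hp)).eventually ((chartAt ℂ (X.f p)).open_source.mem_nhds ?_)
    beta_reduce
    rw [e.left_inv hp]
    exact mem_chart_source ℂ _
  filter_upwards [e.open_target.mem_nhds (e.map_source hp), hsrc] with z hz hzs
  rw [formCoeff_pullbackForm_eq X p hz, ← he]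
  set q := e.symm z
  set a := chartAt ℂ (X.f p)
  set b := chartAt ℂ (X.f q)
  have hw₀ : a (X.f q) ∈ (a.symm ≫ₕ b).source := by
    rw [OpenPartialHomeomorph.trans_source]
    refine ⟨a.map_source hzs, ?_⟩
    rw [mem_preimage, a.left_inv hzs]
    exact mem_chart_source ℂ _
  have htr := transition_eventuallyEq (chart_mem_atlas ℂ (X.f p)) (chart_mem_atlas ℂ (X.f q)) hw₀
  have hc : Tendsto (fun w => a (X.f (e.symm w))) (𝓝 z) (𝓝 (a (X.f q))) :=
    (a.continuousAt hzs).tendsto.comp (hcont z hz).tendsto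
  have hzs' := (hcont z hz).eventually (a.open_source.mem_nhds hzs)
  have hev : localMap X.f e q =ᶠ[𝓝 z] fun w => localMap X.f e p w +
      ((a.symm ≫ₕ b) (a (X.f q)) - a (X.f q)) := by
    filter_upwards [hc.eventually htr, hzs'] with w hw hw'
    rw [← show a (X.f (e.symm w)) = localMap X.f e p w from rfl, ← hw]
    rw [OpenPartialHomeomorph.coe_trans, Function.comp_apply, a.left_inv hw']
    rfl
  rw [hev.deriv_eq, deriv_add_const]

/-- The order of `f^* dz` at a point is the ramification index minus one; both are `⊤` where `f` is
constant. -/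
theorem formOrder_pullbackForm (X : Cover L) (p : X.C) :
    ∃ r : ℕ∞, formOrder X.pullbackForm p = r.map (Nat.cast : ℕ → ℤ) ∧
      r + 1 = X.ramificationIndex p := by
  have han := X.analyticAt_localMap (mem_chart_source ℂ p)
  refine ⟨analyticOrderAt (deriv (localMap X.f (chartAt ℂ p) p)) (chartAt ℂ p p), ?_, ?_⟩
  · rw [formOrder, meromorphicOrderAt_congr
      ((X.formCoeff_pullbackForm_eventuallyEq p).filter_mono nhdsWithin_le_nhds),
      han.deriv.meromorphicOrderAt_eq]
  · rw [han.analyticOrderAt_deriv_add_one, ramificationIndex_eq]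

/-- The Hurwitz formula for a simple cover: the form `f^* dz` has a simple zero at each ramification
point and no other zeros or poles. -/
theorem IsSimple.hasGenus {X : Cover L} (hX : X.IsSimple 2) (hB : X.branchPoints.Finite) {g : ℕ}
    (hg : (X.branchPoints.ncard : ℤ) = 2 * g - 2) : HasGenus X.C g := by
  classical
  have hord : ∀ p, formOrder X.pullbackForm p =
      if p ∈ X.ramificationPoints then ((1 : ℤ) : WithTop ℤ) else ((0 : ℤ) : WithTop ℤ) := by
    intro p
    obtain ⟨r, hr, hr'⟩ := X.formOrder_pullbackForm p
    rw [hr]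
    split_ifs with hp
    · rw [hX.1 p hp] at hr'
      have : r = 1 := by
        cases r with
        | top => simp at hr'
        | coe r => norm_cast at hr' ⊢; omega
      subst this
      rfl
    · have h1 : X.ramificationIndex p = 1 := by simpa [ramificationPoints] using hp
      rw [h1] at hr'
      have : r = 0 := by
        cases r with
        | top => simp at hr'
        | coe r => norm_cast at hr' ⊢; omega
      subst this
      rfl
  refine ⟨X.pullbackForm, fun p => ?_, fun p => ?_, ?_⟩
  · exact (X.analyticAt_localMap (mem_chart_source ℂ p)).deriv.meromorphicAt.congr
      ((X.formCoeff_pullbackForm_eventuallyEq p).symm.filter_mono nhdsWithin_le_nhds)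
  · rw [hord]
    split_ifs <;> exact WithTop.coe_ne_top
  · have h1 : ∀ p, (formOrder X.pullbackForm p).untop₀ =
        X.ramificationPoints.indicator (fun _ => (1 : ℤ)) p := by
      intro p
      rw [hord, indicator_apply]
      split_ifs <;> rfl
    rw [finsum_congr h1, ← finsum_mem_def, ← hg, branchPoints, hX.2.ncard_image]
    rw [finsum_mem_eq_finite_toFinset_sum _ (hX.finite_ramificationPoints hB)]
    rw [Finset.sum_const, ncard_eq_toFinset_card _ (hX.finite_ramificationPoints hB)]
    simp

end Cover

/-- By the Hurwitz formula the number of branch points determines the genus, so the condition on the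
genus is automatic. -/
theorem mem_possiblyDisconnectedCovers_iff {B : Finset (EllipticCurve L)} {g d : ℕ} (hg : 1 ≤ g)
    (hB : B.card = 2 * g - 2) {X : Cover L} : X ∈ possiblyDisconnectedCovers B g d ↔
      X.IsSimple 2 ∧ X.branchPoints = B ∧ X.HasDegree d := by
  refine ⟨fun h => ⟨h.1, h.2.1, h.2.2.1⟩, fun h => ⟨h.1, h.2.1, h.2.2, ?_⟩⟩
  refine h.1.hasGenus (by rw [h.2.1]; exact B.finite_toSet) ?_
  rw [h.2.1, ncard_coe_finset, hB]
  omega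

/-! ### Moving the branch points -/

theorem mk_chartAt (y : EllipticCurve L) {y' : EllipticCurve L}
    (h : y' ∈ (chartAt ℂ y).source) :
    (QuotientAddGroup.mk (chartAt ℂ y y') : EllipticCurve L) = y' :=
  mk_atlas_apply (chart_mem_atlas ℂ y) h

/-- In the charts of the elliptic curve, a translation is a translation. -/
theorem chartAt_add_eventuallyEq (y v : EllipticCurve L) : ∃ c : ℂ, ∀ᶠ y' in 𝓝 y,
    chartAt ℂ (y + v) (y' + v) = chartAt ℂ y y' + c := by
  let D : EllipticCurve L → ℂ := fun y' => chartAt ℂ (y + v) (y' + v) - chartAt ℂ y y'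
  have hs : ∀ᶠ y' in 𝓝 y, y' ∈ (chartAt ℂ y).source :=
    (chartAt ℂ y).open_source.mem_nhds (mem_chart_source ℂ y)
  have hadd : ContinuousAt (fun y' => y' + v) y := by fun_prop
  have hs' : ∀ᶠ y' in 𝓝 y, y' + v ∈ (chartAt ℂ (y + v)).source :=
    hadd.eventually ((chartAt ℂ (y + v)).open_source.mem_nhds (mem_chart_source ℂ (y + v)))
  have hD : ContinuousAt D y := by
    refine ContinuousAt.sub (ContinuousAt.comp (f := fun y' => y' + v) ?_ hadd)
      ((chartAt ℂ y).continuousAt (mem_chart_source ℂ y))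
    exact (chartAt ℂ (y + v)).continuousAt (mem_chart_source ℂ (y + v))
  obtain ⟨U, hU, hyU, hinj⟩ := (isLocalHomeomorph_mk L).isLocallyInjective (D y)
  have hmk : ∀ y', y' ∈ (chartAt ℂ y).source → y' + v ∈ (chartAt ℂ (y + v)).source →
      (QuotientAddGroup.mk (D y') : EllipticCurve L) = v := by
    intro y' h1 h2
    have h3 : (QuotientAddGroup.mk (D y') : EllipticCurve L) =
      QuotientAddGroup.mk (chartAt ℂ (y + v) (y' + v)) - QuotientAddGroup.mk (chartAt ℂ y y') := rfl
    rw [h3, mk_chartAt _ h1, mk_chartAt _ h2, add_sub_cancel_left]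
  refine ⟨D y, ?_⟩
  filter_upwards [hs, hs', hD.eventually (hU.mem_nhds hyU)] with y' h1 h2 h3
  have h4 : D y' = D y := hinj h3 hyU
    ((hmk y' h1 h2).trans (hmk y (mem_chart_source ℂ y) (mem_chart_source ℂ (y + v))).symm)
  rw [← h4]
  simp only [D]
  ring

namespace Cover

/-- The complex structure on `C` given by charts `e x` in which `g` is holomorphic. Transition maps
are holomorphic because they are continuous and commute with `g`. -/
def ofCharts (C : Type) [TopologicalSpace C] [T2Space C] [CompactSpace C] (g : C → EllipticCurve L)
    (hg : Continuous g) (hc : ∀ p, ¬ IsConstAt g p) (e : C → OpenPartialHomeomorph C ℂ)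
    (he : ∀ x, x ∈ (e x).source)
    (han : ∀ x, ∀ p ∈ (e x).source, AnalyticAt ℂ (localMap g (e x) p) (e x p)) : Cover L :=
  letI : ChartedSpace ℂ C := ⟨range e, e, he, mem_range_self⟩
  haveI : IsManifold 𝓘(ℂ) ω C := by
    refine isManifold_of_contDiffOn _ _ _ ?_
    rintro _ _ ⟨x, rfl⟩ ⟨y, rfl⟩ z hz
    simp only [mfld_simps] at hz ⊢
    refine (AnalyticAt.contDiffAt ?_).contDiffWithinAt
    have h1 := (e x).map_target hz.1
    have h2 := analyticAt_of_over (α := id) h1 hz.2 (han x _ h1) hg.continuousAt (hc _)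
      (han y _ hz.2) hg.continuousAt (hc _) (.of_forall fun _ => continuousAt_id)
      (.of_forall fun _ => rfl)
    rw [(e x).right_inv hz.1] at h2
    exact h2
  { C := C
    f := g
    holomorphic := by
      intro x
      rw [contMDiffAt_iff]
      refine ⟨hg.continuousAt, ?_⟩
      simp only [mfld_simps, contDiffWithinAt_univ]
      exact (han x x (he x)).contDiffAt }

theorem isConstAt_comp_iff {C : Type*} [TopologicalSpace C] {g : C → EllipticCurve L}
    {φ : EllipticCurve L → EllipticCurve L} (hφ : Function.Injective φ) {p : C} :
    IsConstAt (fun x => φ (g x)) p ↔ IsConstAt g p :=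
  eventually_congr (.of_forall fun _ => hφ.eq_iff)

/-- If the homeomorphism `φ` is a translation near each branch point of `f`, then the source of
`φ ∘ f` has a complex structure for which `φ ∘ f` is holomorphic with the same ramification:
near the ramification points the given one, and elsewhere the one pulled back along `φ ∘ f`. -/
theorem exists_cover_comp {X : Cover L} (hX : X.IsSimple 2) (φ : EllipticCurve L ≃ₜ EllipticCurve L)
    (hφ : ∀ b ∈ X.branchPoints, ∃ v, ∀ᶠ y in 𝓝 b, φ y = y + v) :
    ∃ (Y : Cover L) (e : X.C ≃ₜ Y.C), (∀ x, Y.f (e x) = φ (X.f x)) ∧ Y.IsSimple 2 ∧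
      Y.branchPoints = φ '' X.branchPoints := by
  classical
  let g : X.C → EllipticCurve L := fun x => φ (X.f x)
  have hg : Continuous g := φ.continuous.comp X.continuous
  have hc : ∀ p, ¬ IsConstAt g p := fun p h =>
    hX.isNonconstant p ((isConstAt_comp_iff φ.injective).1 h)
  have hloc : IsLocalHomeomorphOn g X.ramificationPointsᶜ :=
    (φ.isLocalHomeomorph.isLocalHomeomorphOn (s := univ)).comp X.isLocalHomeomorphOn
      (mapsTo_univ _ _)
  have hV : ∀ x ∈ X.ramificationPoints, ∃ (V : Set (EllipticCurve L)) (v : EllipticCurve L),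
      IsOpen V ∧ X.f x ∈ V ∧ ∀ y ∈ V, φ y = y + v := by
    intro x hx
    obtain ⟨v, hv⟩ := hφ _ (mem_image_of_mem X.f hx)
    obtain ⟨V, hV, hVo, hxV⟩ := eventually_nhds_iff.1 hv
    exact ⟨V, v, hVo, hxV, hV⟩
  -- Near a ramification point, `g` differs from `f` by a constant in any chart.
  have hram : ∀ x ∈ X.ramificationPoints, ∃ e : OpenPartialHomeomorph X.C ℂ, x ∈ e.source ∧
      (∀ p ∈ e.source, AnalyticAt ℂ (localMap g e p) (e p)) ∧
      analyticOrderAt (fun z => localMap g e x z - localMap g e x (e x)) (e x) =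
        X.ramificationIndex x := by
    intro x hx
    obtain ⟨V, v, hVo, hxV, hV⟩ := hV x hx
    let e := (chartAt ℂ x).restrOpen (X.f ⁻¹' V) (hVo.preimage X.continuous)
    have hes : e.source = (chartAt ℂ x).source ∩ X.f ⁻¹' V :=
      OpenPartialHomeomorph.restrOpen_source _ _ _
    have key : ∀ p ∈ e.source, ∃ c, ∀ᶠ z in 𝓝 (e p),
        localMap g e p z = localMap X.f (chartAt ℂ x) p z + c := by
      intro p hp
      have hpV : X.f p ∈ V := (hes ▸ hp).2
      obtain ⟨c, hc⟩ := chartAt_add_eventuallyEq (X.f p) v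
      refine ⟨c, ?_⟩
      have ht : Tendsto e.symm (𝓝 (e p)) (𝓝 p) := by
        have := e.symm.continuousAt (e.map_source hp)
        rwa [ContinuousAt, e.left_inv hp] at this
      have ht2 : Tendsto (fun z => X.f (e.symm z)) (𝓝 (e p)) (𝓝 (X.f p)) :=
        X.continuous.continuousAt.tendsto.comp ht
      filter_upwards [ht2.eventually hc, ht2.eventually (hVo.mem_nhds hpV)] with z h1 h2
      change chartAt ℂ (φ (X.f p)) (φ (X.f (e.symm z))) = chartAt ℂ (X.f p) (X.f (e.symm z)) + c
      rw [hV _ hpV, hV _ h2, h1]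
    have hxe : x ∈ e.source := by rw [hes]; exact ⟨mem_chart_source ℂ x, hxV⟩
    refine ⟨e, hxe, fun p hp => ?_, ?_⟩
    · obtain ⟨c, hc⟩ := key p hp
      exact ((X.analyticAt_localMap (hes ▸ hp).1).add analyticAt_const).congr
        (hc.mono fun z hz => hz.symm)
    · obtain ⟨c, hc⟩ := key x hxe
      rw [ramificationIndex_eq]
      refine analyticOrderAt_congr ?_
      filter_upwards [hc] with z hz
      rw [hz, hc.self_of_nhds, add_sub_add_right_eq_sub]
      rfl
  have hunram : ∀ x ∉ X.ramificationPoints, ∃ e : OpenPartialHomeomorph X.C ℂ, x ∈ e.source ∧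
      (∀ p ∈ e.source, AnalyticAt ℂ (localMap g e p) (e p)) ∧
      analyticOrderAt (fun z => localMap g e x z - localMap g e x (e x)) (e x) =
        X.ramificationIndex x := by
    intro x hx
    obtain ⟨G, hxG, hG⟩ := hloc x hx
    let c := chartAt ℂ (g x)
    let e := G.trans c
    have hes : e.source = G.source ∩ g ⁻¹' c.source := by
      rw [OpenPartialHomeomorph.trans_source, hG]
    have key : ∀ p ∈ e.source, ∃ c, ∀ᶠ z in 𝓝 (e p), localMap g e p z = z + c := by
      intro p hp
      have hpc : g p ∈ c.source := (hes ▸ hp).2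
      have h1 : e p = c (g p) := by rw [hG]; rfl
      have h2 : c (g p) ∈ (c.symm ≫ₕ chartAt ℂ (g p)).source := by
        rw [OpenPartialHomeomorph.trans_source]
        refine ⟨c.map_source hpc, ?_⟩
        rw [mem_preimage, c.left_inv hpc]
        exact mem_chart_source ℂ _
      have h3 := transition_eventuallyEq (chart_mem_atlas ℂ (g x)) (chart_mem_atlas ℂ (g p)) h2
      refine ⟨(c.symm ≫ₕ chartAt ℂ (g p)) (c (g p)) - c (g p), ?_⟩
      have h5 := e.open_target.mem_nhds (e.map_source hp)
      rw [h1] at h5 ⊢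
      filter_upwards [h3, h5] with z hz hze
      rw [← hz]
      have h4 : g (e.symm z) = c.symm z := by
        rw [OpenPartialHomeomorph.trans_target] at hze
        rw [hG]
        exact G.right_inv hze.2
      rw [localMap, h4]
      rfl
    have hxe : x ∈ e.source := by rw [hes]; exact ⟨hxG, mem_chart_source ℂ (g x)⟩
    refine ⟨e, hxe, fun p hp => ?_, ?_⟩
    · obtain ⟨c, hc⟩ := key p hp
      exact (analyticAt_id.add analyticAt_const).congr (hc.mono fun z hz => hz.symm)
    · have h1 : X.ramificationIndex x = 1 := by simpa [ramificationPoints] using hx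
      obtain ⟨c, hc⟩ := key x hxe
      rw [h1, ← analyticOrderAt_id_sub_const_self (𝕜 := ℂ) (c := e x)]
      refine analyticOrderAt_congr ?_
      filter_upwards [hc] with z hz
      rw [hz, hc.self_of_nhds, add_sub_add_right_eq_sub]
  choose e he han hord using fun x => if hx : x ∈ X.ramificationPoints then hram x hx
    else hunram x hx
  let Y : Cover L := ofCharts X.C g hg hc e he han
  have hY : ∀ x : X.C, Y.ramificationIndex x = X.ramificationIndex x := fun x =>
    (Y.ramificationIndex_eq x).trans (hord x)
  have hR : Y.ramificationPoints = X.ramificationPoints := by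
    ext x
    exact not_congr (by rw [hY x])
  refine ⟨Y, Homeomorph.refl X.C, fun x => rfl, ⟨fun x hx => ?_, ?_⟩, ?_⟩
  · rw [hY x]
    rw [hR] at hx
    exact hX.1 x hx
  · rw [hR]
    exact φ.injective.comp_injOn hX.2
  · rw [branchPoints, hR, branchPoints, image_image]
    rfl

end Cover

/-- A homeomorphism of the elliptic curve that moves `b` a little, is a translation near `b`, and
fixes a neighbourhood of `B`: it is `y ↦ y + χ(y) v` for a Lipschitz bump function `χ` around `b`
and a small vector `v`. -/
theorem exists_homeomorph_moving {B : Set (EllipticCurve L)} (hB : B.Finite) {b : EllipticCurve L}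
    (hb : b ∉ B) : ∀ᶠ b' in 𝓝 b, ∃ φ : EllipticCurve L ≃ₜ EllipticCurve L, φ b = b' ∧
      (∃ v, ∀ᶠ y in 𝓝 b, φ y = y + v) ∧ ∀ c ∈ B, ∀ᶠ y in 𝓝 c, φ y = y := by
  let : MetricSpace (EllipticCurve L) := MetricSpace.ofT0PseudoMetricSpace _
  obtain ⟨ρ, hρ, hρB⟩ := Metric.mem_nhds_iff.1 (hB.isClosed.isOpen_compl.mem_nhds hb)
  obtain ⟨r, hr, hrρ⟩ : ∃ r, 0 < r ∧ 2 * r < ρ := ⟨ρ / 3, by linarith, by linarith⟩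
  filter_upwards [Metric.ball_mem_nhds b hr] with b' hb'
  have hb'r : ‖b' - b‖ < r := by rwa [← dist_eq_norm]
  obtain ⟨v, hv, hvr⟩ := QuotientAddGroup.norm_lt_iff.1 hb'r
  -- the cut-off function is `1` on the ball of radius `r`, `0` off the ball of radius `2 r`, and
  -- `1 / r`-Lipschitz
  let χ : EllipticCurve L → ℝ := fun y => max 0 (min 1 (2 - dist y b / r))
  have hχ : ∀ y y', |χ y - χ y'| ≤ dist y y' / r := by
    intro y y'
    have h1 : |(2 - dist y b / r) - (2 - dist y' b / r)| ≤ dist y y' / r := by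
      rw [show (2 - dist y b / r) - (2 - dist y' b / r) = (dist y' b - dist y b) / r by ring,
        abs_div, abs_of_pos hr]
      gcongr
      rw [dist_comm y y']
      exact abs_dist_sub_le _ _ _
    refine le_trans ?_ h1
    refine le_trans (abs_max_sub_max_le_max _ _ _ _) ?_
    rw [sub_self, abs_zero]
    refine max_le (abs_nonneg _) ?_
    refine le_trans (abs_min_sub_min_le_max _ _ _ _) ?_
    rw [sub_self, abs_zero]
    exact max_le (abs_nonneg _) le_rfl
  let G : EllipticCurve L → EllipticCurve L := fun y => QuotientAddGroup.mk ((χ y : ℂ) * v)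
  have hG : ∀ y y', dist (G y) (G y') ≤ ‖v‖ / r * dist y y' := by
    intro y y'
    have h1 : G y - G y' = QuotientAddGroup.mk (((χ y - χ y' : ℝ) : ℂ) * v) := by
      simp only [G]
      rw [← QuotientAddGroup.mk_sub, ← sub_mul, Complex.ofReal_sub]
    rw [dist_eq_norm, h1]
    refine (QuotientAddGroup.norm_mk_le_norm).trans ?_
    rw [norm_mul, Complex.norm_real, Real.norm_eq_abs]
    calc |χ y - χ y'| * ‖v‖ ≤ dist y y' / r * ‖v‖ := by gcongr; exact hχ y y'
      _ = ‖v‖ / r * dist y y' := by ring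
  have hK : ‖v‖ / r < 1 := (div_lt_one hr).2 hvr
  have hK0 : 0 ≤ ‖v‖ / r := by positivity
  have hGl : LipschitzWith ⟨‖v‖ / r, hK0⟩ G := LipschitzWith.of_dist_le_mul hG
  -- a perturbation of the identity by a contraction is bijective
  have hbij : Function.Bijective fun y => y + G y := by
    constructor
    · intro y y' h
      have h1 : dist y y' ≤ ‖v‖ / r * dist y y' := by
        have h2 : y - y' = G y' - G y := by
          have h : y + G y = y' + G y' := h
          rw [sub_eq_sub_iff_add_eq_add, h, add_comm]
        calc dist y y' = dist (G y') (G y) := by rw [dist_eq_norm, dist_eq_norm, h2]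
          _ ≤ _ := by rw [dist_comm]; exact hG y y'
      have h3 : dist y y' = 0 := by
        nlinarith [dist_nonneg (x := y) (y := y')]
      exact eq_of_dist_eq_zero h3
    · intro w
      have hcontr : ContractingWith ⟨‖v‖ / r, hK0⟩ fun y => w - G y := by
        refine ⟨hK, LipschitzWith.of_dist_le_mul fun y y' => ?_⟩
        rw [dist_sub_left]
        exact hG y y'
      have : Nonempty (EllipticCurve L) := ⟨0⟩
      refine ⟨hcontr.fixedPoint _, ?_⟩
      have h1 : w - G (hcontr.fixedPoint _) = hcontr.fixedPoint _ := hcontr.fixedPoint_isFixedPt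
      exact (eq_sub_iff_add_eq.1 h1.symm)
  let φ : EllipticCurve L ≃ₜ EllipticCurve L := Continuous.homeoOfEquivCompactToT2
    (f := Equiv.ofBijective _ hbij) (continuous_id.add hGl.continuous)
  have hφ : ∀ y, φ y = y + G y := fun y => rfl
  have hnear : ∀ y, dist y b < r → φ y = y + (b' - b) := by
    intro y hy
    have h1 : χ y = 1 := by
      have : dist y b / r < 1 := (div_lt_one hr).2 hy
      simp only [χ]
      rw [min_eq_left (by linarith), max_eq_right zero_le_one]
    rw [hφ]
    simp only [G]
    rw [h1, Complex.ofReal_one, one_mul, hv]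
  refine ⟨φ, ?_, ⟨b' - b, ?_⟩, fun c hcB => ?_⟩
  · rw [hnear b (by simpa using hr), add_sub_cancel]
  · filter_upwards [Metric.ball_mem_nhds b hr] with y hy using hnear y hy
  · have hcb : 2 * r < dist c b := by
      by_contra h
      exact hρB (show c ∈ Metric.ball b ρ from lt_of_le_of_lt (not_lt.1 h) hrρ) hcB
    have hcont : ContinuousAt (fun y => dist y b) c := by fun_prop
    filter_upwards [hcont.eventually (lt_mem_nhds hcb)] with y hy
    have h1 : χ y = 0 := by
      have : 2 < dist y b / r := (lt_div_iff₀ hr).2 hy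
      simp only [χ]
      exact max_eq_left ((min_le_right _ _).trans (by linarith))
    rw [hφ]
    simp only [G]
    rw [h1, Complex.ofReal_zero, zero_mul]
    exact add_zero y

/-! ### Invariance of the counts -/

/-- The simple `2`-branched covers of degree `d` with set of branch points `B`. -/
def simpleCovers (B : Set (EllipticCurve L)) (d : ℕ) : Set (Cover L) :=
  {X | X.IsSimple 2 ∧ X.branchPoints = B ∧ X.HasDegree d}

/-- The connected simple `2`-branched covers of degree `d` with set of branch points `B`. -/
def connectedSimpleCovers (B : Set (EllipticCurve L)) (d : ℕ) : Set (Cover L) :=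
  {X | X ∈ simpleCovers B d ∧ ConnectedSpace X.C}

theorem possiblyDisconnectedCovers_eq {B : Finset (EllipticCurve L)} {g : ℕ} (hg : 1 ≤ g)
    (hB : B.card = 2 * g - 2) (d : ℕ) :
    possiblyDisconnectedCovers B g d = simpleCovers (B : Set (EllipticCurve L)) d :=
  ext fun _ => mem_possiblyDisconnectedCovers_iff hg hB

theorem connectedCovers_eq {B : Finset (EllipticCurve L)} {g : ℕ} (hg : 1 ≤ g)
    (hB : B.card = 2 * g - 2) (d : ℕ) :
    connectedCovers B g d = connectedSimpleCovers (B : Set (EllipticCurve L)) d := by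
  rw [connectedCovers, possiblyDisconnectedCovers_eq hg hB]
  rfl

namespace Cover

/-- The homeomorphisms `X.C ≃ Y.C` that cover the map `φ` of the elliptic curve. -/
def HomeoOver (φ : EllipticCurve L → EllipticCurve L) (X Y : Cover L) : Type :=
  {e : X.C ≃ₜ Y.C // ∀ x, Y.f (e x) = φ (X.f x)}

/-- The homeomorphism over the elliptic curve that underlies an isomorphism. -/
def Iso.homeoOver {X Y : Cover L} (α : Iso X Y) : HomeoOver id X Y :=
  ⟨α.1.toHomeomorph, α.2⟩

/-- Conjugation with homeomorphisms over an injective map identifies isomorphisms. -/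
def isoCongr {φ : EllipticCurve L → EllipticCurve L} (hφ : Function.Injective φ)
    {X X' Y Y' : Cover L} (hX : X.IsNonconstant) (hX' : X'.IsNonconstant) (hY : Y.IsNonconstant)
    (hY' : Y'.IsNonconstant) (e : HomeoOver φ X Y) (e' : HomeoOver φ X' Y') :
    Iso X X' ≃ Iso Y Y' :=
  let T : {α : X.C ≃ₜ X'.C // ∀ x, X'.f (α x) = X.f x} ≃
      {β : Y.C ≃ₜ Y'.C // ∀ y, Y'.f (β y) = Y.f y} :=
    { toFun := fun α => ⟨(e.1.symm.trans α.1).trans e'.1, fun y => by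
        rw [Homeomorph.trans_apply, Homeomorph.trans_apply, e'.2, α.2, ← e.2,
          e.1.apply_symm_apply]⟩
      invFun := fun β => ⟨(e.1.trans β.1).trans e'.1.symm, fun x => hφ <| by
        rw [Homeomorph.trans_apply, Homeomorph.trans_apply, ← e'.2, e'.1.apply_symm_apply, β.2,
          e.2]⟩
      left_inv := fun α => by
        apply Subtype.ext
        ext x
        simp
      right_inv := fun β => by
        apply Subtype.ext
        ext x
        simp }
  (isoEquiv hX hX').trans (T.trans (isoEquiv hY hY').symm)

/-- Isomorphic covers have the same automorphisms, by conjugation. -/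
def autCongr {X Y : Cover L} (hX : X.IsNonconstant) (hY : Y.IsNonconstant) (α : Iso X Y) :
    Aut X ≃ Aut Y :=
  isoCongr Function.injective_id hX hX hY hY α.homeoOver α.homeoOver

end Cover

/-- A cover is isomorphic to the chosen representative of its class. -/
theorem IsoClasses.nonempty_iso_out {S : Set (Cover L)} (X : Cover L) (hX : X ∈ S) :
    Nonempty (Cover.Iso (Quotient.out (⟦⟨X, hX⟩⟧ : IsoClasses S)).1 X) :=
  Quotient.mk_out (s := isoSetoid S) ⟨X, hX⟩

/-- Two classes of covers that correspond to each other under homeomorphisms over an injective map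
have the same weighted count. -/
theorem weightedCount_congr {φ : EllipticCurve L → EllipticCurve L} (hφ : Function.Injective φ)
    {S S' : Set (Cover L)} (hS : ∀ X ∈ S, X.IsNonconstant) (hS' : ∀ X ∈ S', X.IsNonconstant)
    (h : ∀ X ∈ S, ∃ Y ∈ S', Nonempty (Cover.HomeoOver φ X Y))
    (h' : ∀ Y ∈ S', ∃ X ∈ S, Nonempty (Cover.HomeoOver φ X Y)) :
    weightedCount S = weightedCount S' := by
  choose F hF hFe using h
  let e : IsoClasses S → IsoClasses S' := fun c => ⟦⟨F _ c.out.2, hF _ c.out.2⟩⟧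
  refine finsum_eq_of_bijective e ⟨fun c c' hc => ?_, fun c => ?_⟩ fun c => ?_
  · obtain ⟨α⟩ : Nonempty (Cover.Iso (F _ c.out.2) (F _ c'.out.2)) := Quotient.exact hc
    rw [← Quotient.out_eq c, ← Quotient.out_eq c']
    exact Quotient.sound ⟨(Cover.isoCongr hφ (hS _ c.out.2) (hS _ c'.out.2) (hS' _ (hF _ _))
      (hS' _ (hF _ _)) (hFe _ c.out.2).some (hFe _ c'.out.2).some).symm α⟩
  · obtain ⟨X, hX, ⟨eX⟩⟩ := h' _ c.out.2
    refine ⟨⟦⟨X, hX⟩⟧, ?_⟩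
    obtain ⟨α⟩ := IsoClasses.nonempty_iso_out X hX
    rw [← Quotient.out_eq c]
    exact Quotient.sound ⟨Cover.isoCongr hφ (hS _ (Subtype.prop _)) (hS _ hX) (hS' _ (hF _ _))
      (hS' _ c.out.2) (hFe _ (Subtype.prop _)).some eX α⟩
  · obtain ⟨α⟩ := IsoClasses.nonempty_iso_out _ (hF _ c.out.2)
    rw [Nat.card_congr (Cover.isoCongr hφ (hS _ c.out.2) (hS _ c.out.2) (hS' _ (hF _ c.out.2))
      (hS' _ (hF _ c.out.2)) (hFe _ c.out.2).some (hFe _ c.out.2).some)]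
    rw [Nat.card_congr (Cover.autCongr (hS' _ (Subtype.prop _)) (hS' _ (hF _ c.out.2)) α)]

/-- Composition with a homeomorphism `φ` that is a translation near the branch points transforms
simple covers with branch points `B` into simple covers with branch points `φ '' B`. -/
theorem exists_mem_simpleCovers_of_homeomorph {B : Set (EllipticCurve L)} (hB : B.Finite)
    (φ : EllipticCurve L ≃ₜ EllipticCurve L) (hφ : ∀ b ∈ B, ∃ v, ∀ᶠ y in 𝓝 b, φ y = y + v)
    {X : Cover L} {d : ℕ} (hX : X ∈ simpleCovers B d) :
    ∃ Y ∈ simpleCovers (φ '' B) d, Nonempty (Cover.HomeoOver φ X Y) := by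
  obtain ⟨hs, rfl, hd⟩ := hX
  obtain ⟨Y, e, he, hY, hYB⟩ := Cover.exists_cover_comp hs φ hφ
  refine ⟨Y, ⟨hY, hYB, ?_⟩, ⟨e, he⟩⟩
  obtain ⟨y, hy⟩ := (isPathConnected_compl hB).nonempty
  have hy' : φ y ∉ φ '' X.branchPoints := fun h => hy ((φ.injective.mem_set_image).1 h)
  rw [Y.hasDegree_iff (hB.image φ) hYB.subset hy', ← hd y hy]
  have h1 : e.symm ⁻¹' (X.f ⁻¹' {y}) = Y.f ⁻¹' {φ y} := by
    ext x
    rw [mem_preimage, mem_preimage, mem_preimage, mem_singleton_iff, mem_singleton_iff,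
      ← φ.injective.eq_iff, ← he, e.apply_symm_apply]
  rw [← h1]
  exact encard_preimage_of_bijective e.symm.bijective _

/-- The weighted counts of covers, and whether covers exist, as functions of the degree. -/
def countInvariants (B : Set (EllipticCurve L)) : (ℕ → ℚ) × (ℕ → ℚ) × (ℕ → Prop) :=
  (fun d => weightedCount (connectedSimpleCovers B d), fun d => weightedCount (simpleCovers B d),
    fun d => (simpleCovers B d).Nonempty)

/-- The counts are invariant under homeomorphisms that are translations near the branch points. -/
theorem countInvariants_image {B : Set (EllipticCurve L)} (hB : B.Finite)
    (φ : EllipticCurve L ≃ₜ EllipticCurve L) (hφ : ∀ b ∈ B, ∃ v, ∀ᶠ y in 𝓝 b, φ y = y + v) :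
    countInvariants (φ '' B) = countInvariants B := by
  have hφ' : ∀ b ∈ φ '' B, ∃ v, ∀ᶠ y in 𝓝 b, φ.symm y = y + v := by
    rintro _ ⟨b, hb, rfl⟩
    obtain ⟨v, hv⟩ := hφ b hb
    have ht : Tendsto φ.symm (𝓝 (φ b)) (𝓝 b) := by
      have := φ.symm.continuous.tendsto (φ b)
      rwa [φ.symm_apply_apply] at this
    refine ⟨-v, (ht.eventually hv).mono fun y hy => ?_⟩
    rw [φ.apply_symm_apply] at hy
    rw [eq_add_neg_iff_add_eq, ← hy]
  have h1 : ∀ {d} (X), X ∈ simpleCovers B d →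
      ∃ Y ∈ simpleCovers (φ '' B) d, Nonempty (Cover.HomeoOver φ X Y) := fun X hX =>
    exists_mem_simpleCovers_of_homeomorph hB φ hφ hX
  have h2 : ∀ {d} (Y), Y ∈ simpleCovers (φ '' B) d →
      ∃ X ∈ simpleCovers B d, Nonempty (Cover.HomeoOver φ X Y) := by
    intro d Y hY
    obtain ⟨X, hX, ⟨e⟩⟩ := exists_mem_simpleCovers_of_homeomorph (hB.image φ) φ.symm hφ' hY
    rw [image_image] at hX
    simp only [φ.symm_apply_apply, image_id'] at hX
    refine ⟨X, hX, ⟨e.1.symm, fun x => ?_⟩⟩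
    have := e.2 (e.1.symm x)
    rw [e.1.apply_symm_apply] at this
    rw [this, φ.apply_symm_apply]
  have hnc : ∀ {B : Set (EllipticCurve L)} {d} (X), X ∈ simpleCovers B d → X.IsNonconstant :=
    fun X hX => hX.1.isNonconstant
  refine Prod.ext (funext fun d => ?_) (Prod.ext (funext fun d => ?_) (funext fun d => ?_))
  · refine (weightedCount_congr φ.injective (fun X hX => hnc X hX.1) (fun X hX => hnc X hX.1)
      (fun X hX => ?_) fun Y hY => ?_).symm
    · obtain ⟨Y, hY, ⟨e⟩⟩ := h1 X hX.1
      have := hX.2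
      exact ⟨Y, ⟨hY, e.1.surjective.connectedSpace e.1.continuous⟩, ⟨e⟩⟩
    · obtain ⟨X, hX, ⟨e⟩⟩ := h2 Y hY.1
      have := hY.2
      exact ⟨X, ⟨hX, e.1.symm.surjective.connectedSpace e.1.symm.continuous⟩, ⟨e⟩⟩
  · exact (weightedCount_congr φ.injective hnc hnc h1 h2).symm
  · refine propext ⟨fun ⟨Y, hY⟩ => ?_, fun ⟨X, hX⟩ => ?_⟩
    · obtain ⟨X, hX, -⟩ := h2 Y hY
      exact ⟨X, hX⟩
    · obtain ⟨Y, hY, -⟩ := h1 X hX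
      exact ⟨Y, hY⟩

/-- One branch point may be moved while the others are fixed: the counts are locally constant in the
moving point, which ranges over the connected complement of the other points. -/
theorem countInvariants_insert {B : Set (EllipticCurve L)} (hB : B.Finite)
    {b b' : EllipticCurve L} (hb : b ∉ B) (hb' : b' ∉ B) :
    countInvariants (insert b B) = countInvariants (insert b' B) := by
  have : ConnectedSpace (Bᶜ : Set (EllipticCurve L)) :=
    isConnected_iff_connectedSpace.1 (isPathConnected_compl hB).isConnected
  let F : (Bᶜ : Set (EllipticCurve L)) → (ℕ → ℚ) × (ℕ → ℚ) × (ℕ → Prop) :=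
    fun b => countInvariants (insert b.1 B)
  have hF : IsLocallyConstant F := by
    rw [IsLocallyConstant.iff_eventually_eq]
    rintro ⟨b, hb⟩
    rw [nhds_subtype, eventually_comap]
    filter_upwards [exists_homeomorph_moving hB hb] with b' hb'
    rintro ⟨_, hb''⟩ rfl
    obtain ⟨φ, hφb, hφv, hφB⟩ := hb'
    have h1 : φ '' (insert b B) = insert (φ b) B := by
      rw [image_insert_eq]
      congr 1
      exact (image_congr fun c hc => (hφB c hc).self_of_nhds).trans (image_id' B)
    change countInvariants (insert _ B) = countInvariants (insert b B)
    rw [← hφb, ← h1]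
    refine countInvariants_image (hB.insert b) φ ?_
    rintro c (rfl | hc)
    · exact hφv
    · exact ⟨0, (hφB c hc).mono fun y hy => by rw [hy, add_zero]⟩
  exact hF.apply_eq_of_preconnectedSpace ⟨b, hb⟩ ⟨b', hb'⟩

/-- The counts depend only on the number of branch points. -/
theorem countInvariants_eq_of_card_eq {B B' : Finset (EllipticCurve L)} (h : B.card = B'.card) :
    countInvariants (B : Set (EllipticCurve L)) = countInvariants (B' : Set (EllipticCurve L)) := by
  classical
  induction hn : (B \ B').card generalizing B with
  | zero =>
    rw [Finset.card_eq_zero, Finset.sdiff_eq_empty_iff_subset] at hn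
    rw [Finset.eq_of_subset_of_card_le hn h.ge]
  | succ n ih =>
    obtain ⟨b, hb⟩ : (B \ B').Nonempty := Finset.card_pos.1 (by omega)
    obtain ⟨b', hb'⟩ : (B' \ B).Nonempty :=
      Finset.card_pos.1 (by rw [← Finset.card_sdiff_comm h]; omega)
    rw [Finset.mem_sdiff] at hb hb'
    have hb'e : b' ∉ B.erase b := fun h => hb'.2 (Finset.mem_of_mem_erase h)
    have h1 := countInvariants_insert (B := (B.erase b : Set (EllipticCurve L)))
      (Finset.finite_toSet _) (b := b) (b' := b') (by simp) (by exact_mod_cast hb'e)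
    rw [← Finset.coe_insert, ← Finset.coe_insert, Finset.insert_erase hb.1] at h1
    rw [h1]
    refine ih ?_ ?_
    · rw [Finset.card_insert_of_notMem hb'e, Finset.card_erase_of_mem hb.1, ← h]
      have := Finset.card_pos.2 ⟨b, hb.1⟩
      omega
    · have h2 : insert b' (B.erase b) \ B' = (B \ B').erase b := by
        ext c
        simp only [Finset.mem_sdiff, Finset.mem_insert, Finset.mem_erase]
        constructor
        · rintro ⟨rfl | ⟨h3, h4⟩, h5⟩
          · exact absurd hb'.1 h5
          · exact ⟨h3, h4, h5⟩
        · rintro ⟨h3, h4, h5⟩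
          exact ⟨.inr ⟨h3, h4⟩, h5⟩
      rw [h2, Finset.card_erase_of_mem (Finset.mem_sdiff.2 hb), hn]
      rfl

/-! ### Labelled covers

A cover whose fibre over a fixed base point is labelled has no automorphisms, so that labelled
covers can be counted without weights. -/

/-- A cover in `S` with a labelling of its fibre over `y` by `ι`. -/
abbrev LabelledCover (S : Set (Cover L)) (y : EllipticCurve L) (ι : Type) : Type 1 :=
  Σ X : S, ι ≃ X.1.f ⁻¹' {y}

/-- `X` and `Y` are isomorphic as labelled covers. -/
def LabelledCover.IsIso {S S' : Set (Cover L)} {y : EllipticCurve L} {ι : Type}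
    (X : LabelledCover S y ι) (Y : LabelledCover S' y ι) : Prop :=
  ∃ e : Cover.HomeoOver id X.1.1 Y.1.1, ∀ i, e.1 (X.2 i) = (Y.2 i).1

theorem LabelledCover.IsIso.symm {S S' : Set (Cover L)} {y : EllipticCurve L} {ι : Type}
    {X : LabelledCover S y ι} {Y : LabelledCover S' y ι} (h : X.IsIso Y) : Y.IsIso X := by
  obtain ⟨e, he⟩ := h
  refine ⟨⟨e.1.symm, fun x => ?_⟩, fun i => ?_⟩
  · have := e.2 (e.1.symm x)
    rw [e.1.apply_symm_apply] at this
    exact this.symm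
  · rw [← he, e.1.symm_apply_apply]

theorem LabelledCover.IsIso.trans {S S' S'' : Set (Cover L)} {y : EllipticCurve L} {ι : Type}
    {X : LabelledCover S y ι} {Y : LabelledCover S' y ι} {Z : LabelledCover S'' y ι}
    (h : X.IsIso Y) (h' : Y.IsIso Z) : X.IsIso Z := by
  obtain ⟨e, he⟩ := h
  obtain ⟨e', he'⟩ := h'
  exact ⟨⟨e.1.trans e'.1, fun x => (e'.2 _).trans (e.2 _)⟩, fun i => by
    rw [Homeomorph.trans_apply, he, he']⟩

/-- Isomorphism as an equivalence relation on labelled covers. -/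
def labelledSetoid (S : Set (Cover L)) (y : EllipticCurve L) (ι : Type) :
    Setoid (LabelledCover S y ι) where
  r X Y := X.IsIso Y
  iseqv := ⟨fun _ => ⟨⟨Homeomorph.refl _, fun _ => rfl⟩, fun _ => rfl⟩, fun h => h.symm,
    fun h h' => h.trans h'⟩

/-- The isomorphism classes of covers in `S` with fibre over `y` labelled by `ι`. -/
def LabelledClasses (S : Set (Cover L)) (y : EllipticCurve L) (ι : Type) : Type 1 :=
  Quotient (labelledSetoid S y ι)

/-- A representative of an isomorphism class. -/
def IsoClasses.rep {S : Set (Cover L)} (c : IsoClasses S) : S := Quotient.out c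

theorem IsoClasses.eq_of_iso {S : Set (Cover L)} {c c' : IsoClasses S}
    (α : Cover.Iso c.rep.1 c'.rep.1) : c = c' :=
  (Quotient.out_eq c).symm.trans
    ((Quotient.sound (s := isoSetoid S) (a := c.rep) (b := c'.rep) ⟨α⟩).trans (Quotient.out_eq c'))

/-- The definition of `weightedCount`, in terms of `IsoClasses.rep`. -/
theorem weightedCount_eq (S : Set (Cover L)) :
    weightedCount S = ∑ᶠ c : IsoClasses S, 1 / (Nat.card (Cover.Aut c.rep.1) : ℚ) := rfl

/-- The label classes over the class of `X` are the orbits of the free action of `Aut X` on the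
labellings of the fibre; so a class contributes `|ι|! / |Aut X|` to the number of labelled
classes. -/
theorem card_labelledClasses {S : Set (Cover L)} {B : Set (EllipticCurve L)} (hB : B.Finite)
    {y : EllipticCurve L} (hy : y ∉ B) {ι : Type} [Fintype ι] (hfin : Finite (IsoClasses S))
    (hS : ∀ X ∈ S, X.IsNonconstant ∧ X.branchPoints ⊆ B ∧ X.HasDegree (Fintype.card ι)) :
    Finite (LabelledClasses S y ι) ∧
      (Nat.card (LabelledClasses S y ι) : ℚ) = (Fintype.card ι).factorial * weightedCount S := by
  classical
  have hnc : ∀ X : S, X.1.IsNonconstant := fun X => (hS _ X.2).1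
  have : Fintype (IsoClasses S) := Fintype.ofFinite _
  have hlab : ∀ X : S, Nonempty (ι ≃ X.1.f ⁻¹' {y}) := fun X => by
    obtain ⟨ℓ⟩ := (hS _ X.2).2.2.nonempty_equiv (fun h => hy ((hS _ X.2).2.1 h))
    exact ⟨(Fintype.equivFin ι).trans ℓ⟩
  have hff : ∀ X : S, Fintype (X.1.f ⁻¹' {y}) := fun X => ((hnc X).finite_fiber y).fintype
  have hfa : ∀ X : S, Finite X.1.Aut := fun X =>
    Cover.finite_iso (hnc X) (hnc X) hB (hS _ X.2).2.1 (hS _ X.2).2.1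
  have hfa' : ∀ X : S, Fintype X.1.Aut := fun X => Fintype.ofFinite _
  let Q : (Σ c : IsoClasses S, ι ≃ c.rep.1.f ⁻¹' {y}) → LabelledClasses S y ι :=
    fun d => ⟦⟨d.1.rep, d.2⟩⟧
  have hQ : Function.Surjective Q := by
    intro t
    induction t using Quotient.inductionOn with
    | h X =>
      obtain ⟨X, ℓ⟩ := X
      obtain ⟨α⟩ := IsoClasses.nonempty_iso_out X.1 X.2
      let c : IsoClasses S := ⟦X⟧
      let ρ : X.1.f ⁻¹' {y} ≃ c.rep.1.f ⁻¹' {y} :=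
        Equiv.subtypeEquiv α.homeoOver.1.symm.toEquiv fun x => by
          have := α.homeoOver.2 (α.homeoOver.1.symm x)
          rw [α.homeoOver.1.apply_symm_apply] at this
          simp only [mem_preimage, mem_singleton_iff]
          rw [this]
          rfl
      refine ⟨⟨c, ℓ.trans ρ⟩, Quotient.sound ⟨α.homeoOver, fun i => ?_⟩⟩
      exact α.homeoOver.1.apply_symm_apply _
  have hfinL : Finite (LabelledClasses S y ι) := Finite.of_surjective Q hQ
  have : Fintype (LabelledClasses S y ι) := Fintype.ofFinite _
  refine ⟨hfinL, ?_⟩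
  let w : (Σ c : IsoClasses S, ι ≃ c.rep.1.f ⁻¹' {y}) → ℚ := fun d =>
    1 / (Nat.card (Cover.Aut d.1.rep.1) : ℚ)
  have h1 : ∑ d, w d = (Fintype.card ι).factorial * weightedCount S := by
    rw [Fintype.sum_sigma, weightedCount_eq, finsum_eq_sum_of_fintype, Finset.mul_sum]
    refine Finset.sum_congr rfl fun c _ => ?_
    simp only [w]
    rw [Finset.sum_const, Finset.card_univ, nsmul_eq_mul,
      Fintype.card_equiv (hlab c.rep).some]
  -- the fibre of `Q` over a labelled class is an orbit of `Aut`, which acts freely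
  have h2 : ∀ t, ∑ d with Q d = t, w d = 1 := by
    intro t
    obtain ⟨⟨c, ℓ⟩, rfl⟩ := hQ t
    let act : Cover.Aut c.rep.1 → (ι ≃ c.rep.1.f ⁻¹' {y}) := fun α =>
      ℓ.trans (Equiv.subtypeEquiv α.1.toEquiv fun x => by
        simp only [mem_preimage, mem_singleton_iff]
        rw [← α.2 x]
        rfl)
    have hact : ∀ α i, (act α i).1 = α.1 (ℓ i) := fun α i => rfl
    have hinj : Function.Injective fun α => (⟨c, act α⟩ : Σ c : IsoClasses S,
        ι ≃ c.rep.1.f ⁻¹' {y}) := by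
      intro α β h
      have h3 : act α = act β := eq_of_heq (Sigma.mk.inj h).2
      have h4 := Cover.eq_of_eqOn_fiber (hnc c.rep) hB (hS _ c.rep.2).2.1 (hS _ c.rep.2).2.1 hy
        α.1.continuous β.1.continuous α.2 β.2 fun x hx => by
          have h5 := congrArg (fun e : ι ≃ c.rep.1.f ⁻¹' {y} => (e (ℓ.symm ⟨x, hx⟩)).1) h3
          simpa [hact] using h5
      exact Subtype.ext (DFunLike.coe_injective h4)
    have h3 : (Finset.univ.filter fun d => Q d = Q ⟨c, ℓ⟩) =
        Finset.univ.map ⟨fun α => (⟨c, act α⟩ : Σ c : IsoClasses S,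
          ι ≃ c.rep.1.f ⁻¹' {y}), hinj⟩ := by
      ext ⟨c', ℓ'⟩
      simp only [Finset.mem_filter, Finset.mem_univ, true_and, Finset.mem_map,
        Function.Embedding.coeFn_mk]
      constructor
      · intro h
        obtain ⟨e, he⟩ : LabelledCover.IsIso (⟨c.rep, ℓ⟩ : LabelledCover S y ι) ⟨c'.rep, ℓ'⟩ :=
          Quotient.exact h.symm
        obtain rfl : c = c' := by
          exact IsoClasses.eq_of_iso ((Cover.isoEquiv (hnc _) (hnc _)).symm e)
        refine ⟨(Cover.isoEquiv (hnc _) (hnc _)).symm e, ?_⟩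
        congr 1
        ext i
        exact he i
      · rintro ⟨α, hα⟩
        obtain ⟨rfl, h4⟩ := Sigma.mk.inj hα
        obtain rfl := eq_of_heq h4
        exact (Quotient.sound ⟨α.homeoOver, fun i => rfl⟩ : Q ⟨c, ℓ⟩ = Q ⟨c, act α⟩).symm
    rw [h3, Finset.sum_map]
    simp only [w, Function.Embedding.coeFn_mk, Finset.sum_const, Finset.card_univ, nsmul_eq_mul]
    have : Nonempty (Cover.Aut c.rep.1) := ⟨⟨Diffeomorph.refl _ _ _, fun _ => rfl⟩⟩
    rw [Nat.card_eq_fintype_card, mul_one_div_cancel]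
    exact_mod_cast Fintype.card_ne_zero
  rw [← h1, ← Finset.sum_fiberwise _ Q, Finset.sum_congr rfl fun t _ => h2 t]
  simp

/-! ### Disjoint unions and components of covers -/

namespace Cover

theorem HomeoOver.ramificationIndex_eq {X Y : Cover L} (e : HomeoOver id X Y) (x : X.C) :
    Y.ramificationIndex (e.1 x) = X.ramificationIndex x :=
  ramificationIndex_congr e.1.toOpenPartialHomeomorph (fun q _ => e.2 q) (mem_univ x)

theorem HomeoOver.ramificationPoints_eq {X Y : Cover L} (e : HomeoOver id X Y) :
    X.ramificationPoints = e.1 ⁻¹' Y.ramificationPoints := by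
  ext x
  simp only [ramificationPoints, mem_preimage, mem_ofPred_eq, e.ramificationIndex_eq]

theorem HomeoOver.branchPoints_eq {X Y : Cover L} (e : HomeoOver id X Y) :
    X.branchPoints = Y.branchPoints := by
  have h : X.f = Y.f ∘ e.1 := funext fun x => (e.2 x).symm
  rw [branchPoints, branchPoints, h, image_comp, e.ramificationPoints_eq,
    image_preimage_eq _ e.1.surjective]

theorem HomeoOver.isSimple {X Y : Cover L} (e : HomeoOver id X Y) (hY : Y.IsSimple 2) :
    X.IsSimple 2 := by
  have h : X.f = Y.f ∘ e.1 := funext fun x => (e.2 x).symm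
  refine ⟨fun x hx => ?_, ?_⟩
  · rw [← e.ramificationIndex_eq]
    rw [e.ramificationPoints_eq] at hx
    exact hY.1 _ hx
  · rw [h, e.ramificationPoints_eq]
    exact hY.2.comp e.1.injective.injOn fun x hx => hx

/-- The disjoint union of two covers. -/
def sum (X Y : Cover L) : Cover L where
  C := X.C ⊕ Y.C
  f := Sum.elim X.f Y.f
  holomorphic := X.holomorphic.sumElim Y.holomorphic

theorem sum_ramificationIndex_inl (X Y : Cover L) (x : X.C) :
    (sum X Y).ramificationIndex (.inl x) = X.ramificationIndex x := by
  have : Nonempty X.C := ⟨x⟩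
  exact ramificationIndex_congr (X := X) (Y := sum X Y)
    (Topology.IsOpenEmbedding.inl.toOpenPartialHomeomorph Sum.inl) (fun q _ => rfl) (mem_univ x)

theorem sum_ramificationIndex_inr (X Y : Cover L) (y : Y.C) :
    (sum X Y).ramificationIndex (.inr y) = Y.ramificationIndex y := by
  have : Nonempty Y.C := ⟨y⟩
  exact ramificationIndex_congr (X := Y) (Y := sum X Y)
    (Topology.IsOpenEmbedding.inr.toOpenPartialHomeomorph Sum.inr) (fun q _ => rfl) (mem_univ y)

theorem sum_ramificationPoints (X Y : Cover L) : (sum X Y).ramificationPoints =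
    Sum.inl '' X.ramificationPoints ∪ Sum.inr '' Y.ramificationPoints := by
  ext z
  rcases z with (x | y)
  · change (sum X Y).ramificationIndex (.inl x) ≠ 1 ↔ _
    rw [sum_ramificationIndex_inl]
    constructor
    · exact fun h => .inl ⟨x, h, rfl⟩
    · rintro (⟨x', h, he⟩ | ⟨y, _, he⟩)
      · exact Sum.inl_injective he ▸ h
      · exact absurd he Sum.inr_ne_inl
  · change (sum X Y).ramificationIndex (.inr y) ≠ 1 ↔ _
    rw [sum_ramificationIndex_inr]
    constructor
    · exact fun h => .inr ⟨y, h, rfl⟩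
    · rintro (⟨x, _, he⟩ | ⟨y', h, he⟩)
      · exact absurd he Sum.inl_ne_inr
      · exact Sum.inr_injective he ▸ h

theorem sum_branchPoints (X Y : Cover L) :
    (sum X Y).branchPoints = X.branchPoints ∪ Y.branchPoints := by
  rw [branchPoints, sum_ramificationPoints]
  refine (image_union (α := X.C ⊕ Y.C) (Sum.elim X.f Y.f) _ _).trans ?_
  rw [image_image, image_image]
  rfl

/-- A disjoint union is simple if and only if its parts are simple and have disjoint sets of branch
points. -/
theorem sum_isSimple_iff (X Y : Cover L) : (sum X Y).IsSimple 2 ↔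
    X.IsSimple 2 ∧ Y.IsSimple 2 ∧ Disjoint X.branchPoints Y.branchPoints := by
  have hl : ∀ x ∈ X.ramificationPoints, (Sum.inl x : X.C ⊕ Y.C) ∈ (sum X Y).ramificationPoints :=
    fun x hx => by rw [sum_ramificationPoints]; exact .inl (mem_image_of_mem _ hx)
  have hr : ∀ y ∈ Y.ramificationPoints, (Sum.inr y : X.C ⊕ Y.C) ∈ (sum X Y).ramificationPoints :=
    fun y hy => by rw [sum_ramificationPoints]; exact .inr (mem_image_of_mem _ hy)
  constructor
  · rintro ⟨h1, h2⟩
    refine ⟨⟨fun x hx => ?_, fun x hx x' hx' h => ?_⟩,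
      ⟨fun y hy => ?_, fun y hy y' hy' h => ?_⟩, ?_⟩
    · rw [← sum_ramificationIndex_inl X Y]; exact h1 _ (hl x hx)
    · exact Sum.inl_injective (h2 (hl x hx) (hl x' hx') h)
    · rw [← sum_ramificationIndex_inr X Y]; exact h1 _ (hr y hy)
    · exact Sum.inr_injective (h2 (hr y hy) (hr y' hy') h)
    · rw [Set.disjoint_left]
      rintro _ ⟨x, hx, rfl⟩ ⟨y, hy, h⟩
      exact Sum.inl_ne_inr (h2 (hl x hx) (hr y hy) h.symm)
  · rintro ⟨hX, hY, hd⟩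
    rw [Set.disjoint_left] at hd
    constructor
    · rw [sum_ramificationPoints]
      rintro _ (⟨x, hx, rfl⟩ | ⟨y, hy, rfl⟩)
      · rw [sum_ramificationIndex_inl]; exact hX.1 x hx
      · rw [sum_ramificationIndex_inr]; exact hY.1 y hy
    · rw [sum_ramificationPoints]
      rintro _ (⟨x, hx, rfl⟩ | ⟨y, hy, rfl⟩) _ (⟨x', hx', rfl⟩ | ⟨y', hy', rfl⟩) h
      · rw [hX.2 hx hx' h]
      · exact absurd (h ▸ mem_image_of_mem Y.f hy') (hd (mem_image_of_mem X.f hx))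
      · exact absurd (mem_image_of_mem Y.f hy) (hd (h ▸ mem_image_of_mem X.f hx'))
      · rw [hY.2 hy hy' h]

/-- The restriction of a cover to a closed and open subset. -/
def restrict (X : Cover L) (U : TopologicalSpace.Opens X.C) (hU : IsClosed (U : Set X.C)) :
    Cover L :=
  haveI : CompactSpace U := isCompact_iff_compactSpace.1 hU.isCompact
  { C := U
    f := fun x => X.f x
    holomorphic := X.holomorphic.comp contMDiff_subtype_val }

/-- A cover is the disjoint union of its restrictions to a closed and open subset and to its
complement. -/
def sumRestrict (X : Cover L) (U V : TopologicalSpace.Opens X.C) (hU : IsClosed (U : Set X.C))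
    (hV : IsClosed (V : Set X.C)) (hUV : IsCompl (U : Set X.C) V) :
    HomeoOver id (sum (X.restrict U hU) (X.restrict V hV)) X :=
  let j : (sum (X.restrict U hU) (X.restrict V hV)).C → X.C := Sum.elim Subtype.val Subtype.val
  have hj : Function.Bijective j := by
    constructor
    · refine Function.Injective.sumElim Subtype.val_injective Subtype.val_injective ?_
      rintro ⟨a, ha⟩ ⟨b, hb⟩ rfl
      exact Set.disjoint_left.1 hUV.disjoint ha hb
    · intro x
      rcases hUV.sup_eq_top.ge (mem_univ x) with h | h
      · exact ⟨.inl ⟨x, h⟩, rfl⟩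
      · exact ⟨.inr ⟨x, h⟩, rfl⟩
  have hjc : Continuous j := continuous_subtype_val.sumElim continuous_subtype_val
  ⟨Continuous.homeoOfEquivCompactToT2 (f := Equiv.ofBijective j hj) hjc, by
    rintro (x | x) <;> rfl⟩

/-- A labelling of one fibre off the branch points determines the degree. -/
theorem hasDegree_of_equiv {X : Cover L} {B : Set (EllipticCurve L)} (hB : B.Finite)
    (hXB : X.branchPoints ⊆ B) {y : EllipticCurve L} (hy : y ∉ B) {ι : Type} [Fintype ι]
    (ℓ : ι ≃ X.f ⁻¹' {y}) : X.HasDegree (Fintype.card ι) := by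
  rw [X.hasDegree_iff hB hXB hy, ← ENat.card_coe_set_eq, ← ENat.card_congr ℓ,
    ENat.card_eq_coe_fintype_card]

end Cover

/-- A homeomorphism that maps the image of one embedding onto the image of another restricts to a
homeomorphism of the embedded spaces. -/
theorem exists_homeomorph_of_image_range {A A' M M' : Type*} [TopologicalSpace A]
    [TopologicalSpace A'] [TopologicalSpace M] [TopologicalSpace M'] {i : A → M} {j : A' → M'}
    (hi : Topology.IsEmbedding i) (hj : Topology.IsEmbedding j) (φ : M ≃ₜ M')
    (h : φ '' range i = range j) :
    ∃ e : A ≃ₜ A', ∀ a, j (e a) = φ (i a) := by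
  refine ⟨hi.toHomeomorph.trans ((φ.image (range i)).trans ((Homeomorph.setCongr h).trans
    hj.toHomeomorph.symm)), fun a => ?_⟩
  have h1 : ∀ b : range j, j (hj.toHomeomorph.symm b) = b := fun b =>
    congrArg Subtype.val (hj.toHomeomorph.apply_symm_apply b)
  simp only [Homeomorph.trans_apply]
  rw [h1]
  rfl

/-- An isomorphism between disjoint unions `X ⊔ Y` and `X' ⊔ Y'` with `X` and `X'` connected that
maps some point of `X` to `X'` is a disjoint union of isomorphisms. -/
theorem Cover.HomeoOver.exists_sum {X Y X' Y' : Cover L} (φ : HomeoOver id (sum X Y) (sum X' Y'))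
    [PreconnectedSpace X.C] [PreconnectedSpace X'.C] {x : X.C} {x' : X'.C}
    (hx : φ.1 (Sum.inl x) = Sum.inl x') :
    (∃ e : HomeoOver id X X', ∀ a, φ.1 (Sum.inl a) = Sum.inl (e.1 a)) ∧
      ∃ e : HomeoOver id Y Y', ∀ a, φ.1 (Sum.inr a) = Sum.inr (e.1 a) := by
  have key : ∀ {X Y X' Y' : Cover L} (φ : HomeoOver id (sum X Y) (sum X' Y'))
      [PreconnectedSpace X.C] {x : X.C} {x' : X'.C} (_ : φ.1 (Sum.inl x) = Sum.inl x') (a : X.C),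
      φ.1 (Sum.inl a) ∈ range (Sum.inl : X'.C → X'.C ⊕ Y'.C) := by
    intro X Y X' Y' φ _ x x' hx a
    have hclopen : IsClopen ((fun a : X.C => φ.1 (Sum.inl a)) ⁻¹'
        range (Sum.inl : X'.C → X'.C ⊕ Y'.C)) :=
      IsClopen.preimage ⟨isClosed_range_inl, isOpen_range_inl⟩
        (φ.1.continuous.comp continuous_inl)
    have := hclopen.eq_univ ⟨x, by rw [mem_preimage, hx]; exact mem_range_self x'⟩
    exact this.ge (mem_univ a)
  have h1 : φ.1 '' range (Sum.inl : X.C → X.C ⊕ Y.C) = range (Sum.inl : X'.C → X'.C ⊕ Y'.C) := by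
    refine subset_antisymm ?_ ?_
    · rintro _ ⟨_, ⟨a, rfl⟩, rfl⟩
      exact key φ hx a
    · rintro _ ⟨a, rfl⟩
      let ψ : HomeoOver id (sum X' Y') (sum X Y) := ⟨φ.1.symm, fun z => by
        have := φ.2 (φ.1.symm z)
        rw [φ.1.apply_symm_apply] at this
        exact this.symm⟩
      have h2 : ψ.1 (Sum.inl x') = Sum.inl x := by
        rw [← hx]
        exact φ.1.symm_apply_apply _
      exact ⟨_, key ψ h2 a, φ.1.apply_symm_apply _⟩
  have h2 : φ.1 '' range (Sum.inr : Y.C → X.C ⊕ Y.C) = range (Sum.inr : Y'.C → X'.C ⊕ Y'.C) := by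
    have h3 : φ.1 '' (range (Sum.inl : X.C → X.C ⊕ Y.C))ᶜ =
        (range (Sum.inl : X'.C → X'.C ⊕ Y'.C))ᶜ :=
      (image_compl_eq φ.1.bijective).trans (congrArg compl h1)
    exact (congrArg (fun s : Set (X.C ⊕ Y.C) => φ.1 '' s) compl_range_inl.symm).trans
      (h3.trans compl_range_inl)
  obtain ⟨e, he⟩ := exists_homeomorph_of_image_range .inl .inl φ.1 h1
  obtain ⟨e', he'⟩ := exists_homeomorph_of_image_range .inr .inr φ.1 h2
  exact ⟨⟨⟨e, fun a => (congrArg (sum X' Y').f (he a)).trans (φ.2 (Sum.inl a))⟩,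
      fun a => (he a).symm⟩,
    ⟨e', fun a => (congrArg (sum X' Y').f (he' a)).trans (φ.2 (Sum.inr a))⟩,
    fun a => (he' a).symm⟩

/-! ### Splitting off the component of a labelled point -/

/-- A representative of an isomorphism class of labelled covers. -/
def LabelledClasses.rep {S : Set (Cover L)} {y : EllipticCurve L} {ι : Type}
    (c : LabelledClasses S y ι) : LabelledCover S y ι := Quotient.out c

/-- The class of a labelled cover. -/
def LabelledCover.toClass {S : Set (Cover L)} {y : EllipticCurve L} {ι : Type}
    (X : LabelledCover S y ι) : LabelledClasses S y ι := Quotient.mk _ X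

theorem LabelledCover.rep_isIso {S : Set (Cover L)} {y : EllipticCurve L} {ι : Type}
    (X : LabelledCover S y ι) : X.toClass.rep.IsIso X :=
  Quotient.exact (Quotient.out_eq (s := labelledSetoid S y ι) X.toClass)

/-- Isomorphic representatives represent the same class. -/
theorem LabelledClasses.rep_inj {S : Set (Cover L)} {y : EllipticCurve L} {ι : Type}
    {c c' : LabelledClasses S y ι} (h : c.rep.IsIso c'.rep) : c = c' :=
  (Quotient.out_eq c).symm.trans ((Quotient.sound (s := labelledSetoid S y ι) h).trans
    (Quotient.out_eq c'))

/-- Labellings of the fibres of `X` and `Y` by complementary subsets of `ι` give a labelling of the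
fibre of the disjoint union by `ι`. -/
def sumLabelling {ι : Type} (p : ι → Prop) [DecidablePred p] {X Y : Cover L} {y : EllipticCurve L}
    (ℓ : {i // p i} ≃ X.f ⁻¹' {y}) (ℓ' : {i // ¬ p i} ≃ Y.f ⁻¹' {y}) :
    ι ≃ (Cover.sum X Y).f ⁻¹' {y} :=
  (Equiv.sumCompl p).symm.trans ((Equiv.sumCongr ℓ ℓ').trans
    (Equiv.subtypeSum (p := fun z => Sum.elim X.f Y.f z ∈ ({y} : Set (EllipticCurve L)))).symm)

theorem sumLabelling_of_pos {ι : Type} {p : ι → Prop} [DecidablePred p] {X Y : Cover L}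
    {y : EllipticCurve L} (ℓ : {i // p i} ≃ X.f ⁻¹' {y}) (ℓ' : {i // ¬ p i} ≃ Y.f ⁻¹' {y}) {i : ι}
    (hi : p i) : (sumLabelling p ℓ ℓ' i).1 = Sum.inl (ℓ ⟨i, hi⟩).1 := by
  simp only [sumLabelling, Equiv.trans_apply]
  rw [Equiv.sumCompl_symm_apply_of_pos hi]
  rfl

theorem sumLabelling_of_neg {ι : Type} {p : ι → Prop} [DecidablePred p] {X Y : Cover L}
    {y : EllipticCurve L} (ℓ : {i // p i} ≃ X.f ⁻¹' {y}) (ℓ' : {i // ¬ p i} ≃ Y.f ⁻¹' {y}) {i : ι}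
    (hi : ¬ p i) : (sumLabelling p ℓ ℓ' i).1 = Sum.inr (ℓ' ⟨i, hi⟩).1 := by
  simp only [sumLabelling, Equiv.trans_apply]
  rw [Equiv.sumCompl_symm_apply_of_neg hi]
  rfl

/-- A disjoint union of simple covers with complementary sets of branch points `S` and `S' \ S` is
simple. Its degree is read off from a labelling of the fibre over `y`. -/
theorem sum_mem_simpleCovers {S S' : Finset (EllipticCurve L)} (h : S ⊆ S') {y : EllipticCurve L}
    (hy : y ∉ S') {ι : Type} [Fintype ι] {d d' : ℕ} {X Y : Cover L}
    (hX : X ∈ simpleCovers (S : Set (EllipticCurve L)) d)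
    (hY : Y ∈ simpleCovers ((S' : Set (EllipticCurve L)) \ S) d')
    (ℓ : ι ≃ (Cover.sum X Y).f ⁻¹' {y}) :
    Cover.sum X Y ∈ simpleCovers (S' : Set (EllipticCurve L)) (Fintype.card ι) := by
  have hb : (Cover.sum X Y).branchPoints = S' := by
    rw [Cover.sum_branchPoints, hX.2.1, hY.2.1, union_sdiff_cancel (Finset.coe_subset.2 h)]
  refine ⟨(Cover.sum_isSimple_iff X Y).2 ⟨hX.1, hY.1, ?_⟩, hb,
    Cover.hasDegree_of_equiv S'.finite_toSet hb.subset (by simpa using hy) ℓ⟩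
  rw [hX.2.1, hY.2.1]
  exact disjoint_sdiff_right

/-- A labelled cover `X` is the disjoint union of the component `X₁` that carries the label `i₀` and
of the rest `X₂`. The labels `T` of the component and its branch points `S` may be arbitrary. -/
theorem exists_splitting {B : Finset (EllipticCurve L)} {y : EllipticCurve L} (hy : y ∉ B)
    {ι : Type} [Fintype ι] [DecidableEq ι] {d : ℕ} {X : Cover L}
    (hX : X ∈ simpleCovers (B : Set (EllipticCurve L)) d) (ℓ : ι ≃ X.f ⁻¹' {y}) (i₀ : ι) :
    ∃ (T : Finset ι) (S : Finset (EllipticCurve L)) (_ : i₀ ∈ T) (_ : S ⊆ B) (X₁ X₂ : Cover L)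
      (_ : X₁ ∈ connectedSimpleCovers (S : Set (EllipticCurve L)) (Fintype.card {i // i ∈ T}))
      (_ : X₂ ∈ simpleCovers ((B : Set (EllipticCurve L)) \ S) (Fintype.card {i // i ∉ T}))
      (ℓ₁ : {i // i ∈ T} ≃ X₁.f ⁻¹' {y}) (ℓ₂ : {i // i ∉ T} ≃ X₂.f ⁻¹' {y})
      (e : Cover.HomeoOver id (Cover.sum X₁ X₂) X),
      (∀ i, e.1 (Sum.inl (ℓ₁ i).1) = (ℓ i).1) ∧ ∀ i, e.1 (Sum.inr (ℓ₂ i).1) = (ℓ i).1 := by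
  classical
  have : LocallyConnectedSpace X.C := ChartedSpace.locallyConnectedSpace ℂ X.C
  let U : TopologicalSpace.Opens X.C := ⟨connectedComponent (ℓ i₀).1, isOpen_connectedComponent⟩
  have hU : IsClosed (U : Set X.C) := isClosed_connectedComponent
  let V : TopologicalSpace.Opens X.C := ⟨(U : Set X.C)ᶜ, hU.isOpen_compl⟩
  have hV : IsClosed (V : Set X.C) := U.isOpen.isClosed_compl
  let X₁ := X.restrict U hU
  let X₂ := X.restrict V hV
  let e : Cover.HomeoOver id (Cover.sum X₁ X₂) X := X.sumRestrict U V hU hV isCompl_compl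
  let T : Finset ι := Finset.univ.filter fun i => (ℓ i).1 ∈ U
  have hT : ∀ i, i ∈ T ↔ (ℓ i).1 ∈ U := fun i => by simp [T]
  let ℓ₁ : {i // i ∈ T} ≃ X₁.f ⁻¹' {y} :=
    { toFun := fun i => ⟨⟨(ℓ i).1, (hT i).1 i.2⟩, (ℓ i).2⟩
      invFun := fun x => ⟨ℓ.symm ⟨x.1.1, x.2⟩, by rw [hT, ℓ.apply_symm_apply]; exact x.1.2⟩
      left_inv := fun i => Subtype.ext (ℓ.symm_apply_apply _)
      right_inv := fun x => by
        have h : (ℓ (ℓ.symm ⟨x.1.1, x.2⟩)).1 = x.1.1 :=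
          congrArg Subtype.val (ℓ.apply_symm_apply _)
        exact Subtype.ext (Subtype.val_injective (p := fun z => z ∈ (U : Set X.C)) h) }
  let ℓ₂ : {i // i ∉ T} ≃ X₂.f ⁻¹' {y} :=
    { toFun := fun i => ⟨⟨(ℓ i).1, fun h => i.2 ((hT i).2 h)⟩, (ℓ i).2⟩
      invFun := fun x => ⟨ℓ.symm ⟨x.1.1, x.2⟩, by rw [hT, ℓ.apply_symm_apply]; exact x.1.2⟩
      left_inv := fun i => Subtype.ext (ℓ.symm_apply_apply _)
      right_inv := fun x => by
        have h : (ℓ (ℓ.symm ⟨x.1.1, x.2⟩)).1 = x.1.1 :=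
          congrArg Subtype.val (ℓ.apply_symm_apply _)
        exact Subtype.ext (Subtype.val_injective (p := fun z => z ∈ (V : Set X.C)) h) }
  have hb : X₁.branchPoints ∪ X₂.branchPoints = B := by
    rw [← Cover.sum_branchPoints, e.branchPoints_eq, hX.2.1]
  obtain ⟨h1, h2, h3⟩ := (Cover.sum_isSimple_iff X₁ X₂).1 (e.isSimple hX.1)
  have hsub : X₁.branchPoints ⊆ B := hb ▸ subset_union_left
  let S := (B.finite_toSet.subset hsub).toFinset
  have hS : (S : Set (EllipticCurve L)) = X₁.branchPoints := Finite.coe_toFinset _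
  have hS2 : X₂.branchPoints = (B : Set (EllipticCurve L)) \ S := by
    rw [hS, ← hb, union_sdiff_left, h3.symm.sdiff_eq_left]
  have hsub2 : X₂.branchPoints ⊆ B := hb ▸ subset_union_right
  have hy' : y ∉ (B : Set (EllipticCurve L)) := by simpa using hy
  refine ⟨T, S, (hT i₀).2 mem_connectedComponent, ?_, X₁, X₂, ⟨⟨h1, hS.symm,
    Cover.hasDegree_of_equiv B.finite_toSet hsub hy' ℓ₁⟩, ?_⟩, ⟨h2, hS2,
    Cover.hasDegree_of_equiv B.finite_toSet hsub2 hy' ℓ₂⟩, ℓ₁, ℓ₂, e, fun i => rfl, fun i => rfl⟩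
  · rw [← Finset.coe_subset, hS]
    exact hsub
  · exact Subtype.connectedSpace isConnected_connectedComponent

/-- Labelled covers correspond to the following data: the set `T` of labels on the component that
carries the label `i₀`, the set `S` of branch points of this component, the component, and the
union of all other components. -/
theorem exists_bijective_splitting {B : Finset (EllipticCurve L)} {y : EllipticCurve L}
    (hy : y ∉ B) {ι : Type} [Fintype ι] [DecidableEq ι] (i₀ : ι) :
    ∃ Φ : (Σ p : {T : Finset ι // i₀ ∈ T} × B.powerset,
        LabelledClasses (connectedSimpleCovers (p.2.1 : Set (EllipticCurve L))
          (Fintype.card {i // i ∈ p.1.1})) y {i // i ∈ p.1.1} ×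
        LabelledClasses (simpleCovers ((B : Set (EllipticCurve L)) \ p.2.1)
          (Fintype.card {i // i ∉ p.1.1})) y {i // i ∉ p.1.1}) →
        LabelledClasses (simpleCovers (B : Set (EllipticCurve L)) (Fintype.card ι)) y ι,
      Function.Bijective Φ := by
  classical
  refine ⟨fun d => LabelledCover.toClass ⟨⟨Cover.sum d.2.1.rep.1.1 d.2.2.rep.1.1,
    sum_mem_simpleCovers (Finset.mem_powerset.1 d.1.2.2) hy d.2.1.rep.1.2.1 d.2.2.rep.1.2
      (sumLabelling (· ∈ d.1.1.1) d.2.1.rep.2 d.2.2.rep.2)⟩,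
    sumLabelling (· ∈ d.1.1.1) d.2.1.rep.2 d.2.2.rep.2⟩, ?_, ?_⟩
  · rintro ⟨⟨⟨T, hT⟩, ⟨S, hS⟩⟩, a, b⟩ ⟨⟨⟨T', hT'⟩, ⟨S', hS'⟩⟩, a', b'⟩ h
    obtain ⟨φ, hφ⟩ := Quotient.exact h
    have : ConnectedSpace a.rep.1.1.C := a.rep.1.2.2
    have : ConnectedSpace a'.rep.1.1.C := a'.rep.1.2.2
    have hpos : ∀ i (hi : i ∈ T) (hi' : i ∈ T'), φ.1 (Sum.inl (a.rep.2 ⟨i, hi⟩).1) =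
        Sum.inl (a'.rep.2 ⟨i, hi'⟩).1 := fun i hi hi' =>
      (congrArg φ.1 (sumLabelling_of_pos _ _ hi).symm).trans
        ((hφ i).trans (sumLabelling_of_pos _ _ hi'))
    obtain ⟨⟨e, he⟩, e', he'⟩ := φ.exists_sum (hpos i₀ hT hT')
    obtain rfl : T = T' := by
      ext i
      constructor
      · intro hi
        by_contra hi'
        have := (congrArg φ.1 (sumLabelling_of_pos _ _ hi).symm).trans
          ((hφ i).trans (sumLabelling_of_neg _ _ hi'))
        exact Sum.inl_ne_inr ((he _).symm.trans this)
      · intro hi'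
        by_contra hi
        have := (congrArg φ.1 (sumLabelling_of_neg _ _ hi).symm).trans
          ((hφ i).trans (sumLabelling_of_pos _ _ hi'))
        exact Sum.inr_ne_inl ((he' _).symm.trans this)
    obtain rfl : S = S' := by
      have := e.branchPoints_eq
      rw [a.rep.1.2.1.2.1, a'.rep.1.2.1.2.1] at this
      exact Finset.coe_injective this
    obtain rfl : a = a' := LabelledClasses.rep_inj ⟨e, fun i =>
      Sum.inl_injective ((he _).symm.trans (hpos i.1 i.2 i.2))⟩
    obtain rfl : b = b' := LabelledClasses.rep_inj ⟨e', fun i =>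
      Sum.inr_injective ((he' _).symm.trans
        ((congrArg φ.1 (sumLabelling_of_neg _ _ i.2).symm).trans
          ((hφ i).trans (sumLabelling_of_neg _ _ i.2))))⟩
    rfl
  · intro t
    induction t using Quotient.inductionOn with
    | h Xℓ =>
      obtain ⟨⟨X, hX⟩, ℓ⟩ := Xℓ
      obtain ⟨T, S, hT, hS, X₁, X₂, hX₁, hX₂, ℓ₁, ℓ₂, e, he₁, he₂⟩ := exists_splitting hy hX ℓ i₀
      let a : LabelledCover (connectedSimpleCovers (S : Set (EllipticCurve L))
        (Fintype.card {i // i ∈ T})) y {i // i ∈ T} := ⟨⟨X₁, hX₁⟩, ℓ₁⟩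
      let b : LabelledCover (simpleCovers ((B : Set (EllipticCurve L)) \ S)
        (Fintype.card {i // i ∉ T})) y {i // i ∉ T} := ⟨⟨X₂, hX₂⟩, ℓ₂⟩
      refine ⟨⟨⟨⟨T, hT⟩, ⟨S, Finset.mem_powerset.2 hS⟩⟩, a.toClass, b.toClass⟩, ?_⟩
      obtain ⟨e₁, h₁⟩ := a.rep_isIso
      obtain ⟨e₂, h₂⟩ := b.rep_isIso
      refine Quotient.sound ⟨⟨(Homeomorph.sumCongr e₁.1 e₂.1).trans e.1, ?_⟩, fun i => ?_⟩
      · rintro (x | x)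
        · exact Eq.trans (b := X₁.f (e₁.1 x)) (e.2 (Sum.inl (e₁.1 x))) (e₁.2 x)
        · exact Eq.trans (b := X₂.f (e₂.1 x)) (e.2 (Sum.inr (e₂.1 x))) (e₂.2 x)
      · by_cases hi : i ∈ T
        · refine (congrArg ((Homeomorph.sumCongr e₁.1 e₂.1).trans e.1)
            (sumLabelling_of_pos _ _ hi)).trans ?_
          exact (congrArg (fun z => e.1 (Sum.inl z)) (h₁ ⟨i, hi⟩)).trans (he₁ ⟨i, hi⟩)
        · refine (congrArg ((Homeomorph.sumCongr e₁.1 e₂.1).trans e.1)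
            (sumLabelling_of_neg _ _ hi)).trans ?_
          exact (congrArg (fun z => e.1 (Sum.inr z)) (h₂ ⟨i, hi⟩)).trans (he₂ ⟨i, hi⟩)

theorem simpleCovers_spec {B : Set (EllipticCurve L)} {d : ℕ} :
    ∀ X ∈ simpleCovers B d, X.IsNonconstant ∧ X.branchPoints ⊆ B ∧ X.HasDegree d :=
  fun _ hX => ⟨hX.1.isNonconstant, hX.2.1.subset, hX.2.2⟩

theorem finite_isoClasses_simpleCovers {B : Set (EllipticCurve L)} (hB : B.Finite) (d : ℕ) :
    Finite (IsoClasses (simpleCovers B d)) :=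
  finite_isoClasses hB simpleCovers_spec

theorem finite_isoClasses_connectedSimpleCovers {B : Set (EllipticCurve L)} (hB : B.Finite)
    (d : ℕ) : Finite (IsoClasses (connectedSimpleCovers B d)) :=
  finite_isoClasses hB fun X hX => simpleCovers_spec X hX.1

theorem finite_aut_of_mem_simpleCovers {B : Set (EllipticCurve L)} (hB : B.Finite) {d : ℕ} :
    ∀ X ∈ simpleCovers B d, Finite X.Aut := fun X hX =>
  have h := simpleCovers_spec X hX
  Cover.finite_iso h.1 h.1 hB h.2.1 h.2.1

/-- The count of labelled covers according to the component that carries the label `i₀`. -/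
theorem factorial_mul_weightedCount {B : Finset (EllipticCurve L)} {y : EllipticCurve L}
    (hy : y ∉ B) {ι : Type} [Fintype ι] [DecidableEq ι] (i₀ : ι) :
    ((Fintype.card ι).factorial : ℚ) *
        weightedCount (simpleCovers (B : Set (EllipticCurve L)) (Fintype.card ι)) =
      ∑ T : Finset ι with i₀ ∈ T, ∑ S ∈ B.powerset,
        (T.card.factorial *
            weightedCount (connectedSimpleCovers (S : Set (EllipticCurve L)) T.card)) *
          ((Fintype.card ι - T.card).factorial *
            weightedCount (simpleCovers ((B : Set (EllipticCurve L)) \ S)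
              (Fintype.card ι - T.card))) := by
  obtain ⟨Φ, hΦ⟩ := exists_bijective_splitting hy i₀
  have hy' : y ∉ (B : Set (EllipticCurve L)) := by simpa using hy
  have h1 := fun p : {T : Finset ι // i₀ ∈ T} × B.powerset =>
    card_labelledClasses (ι := {i // i ∈ p.1.1}) p.2.1.finite_toSet
      (fun h => hy' (Finset.mem_powerset.1 p.2.2 h))
      (finite_isoClasses_connectedSimpleCovers p.2.1.finite_toSet _)
      (fun X hX => simpleCovers_spec X hX.1)
  have h2 := fun p : {T : Finset ι // i₀ ∈ T} × B.powerset =>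
    card_labelledClasses (ι := {i // i ∉ p.1.1}) (B.finite_toSet.subset sdiff_subset)
      (fun h => hy' h.1)
      (finite_isoClasses_simpleCovers (B := (B : Set (EllipticCurve L)) \ p.2.1)
        (B.finite_toSet.subset sdiff_subset) _)
      simpleCovers_spec
  have := fun p => (h1 p).1
  have := fun p => (h2 p).1
  rw [← (card_labelledClasses B.finite_toSet hy' (finite_isoClasses_simpleCovers B.finite_toSet _)
    simpleCovers_spec).2, ← Nat.card_eq_of_bijective Φ hΦ, Nat.card_sigma, Nat.cast_sum]
  simp only [Nat.card_prod, Nat.cast_mul, (h1 _).2, (h2 _).2]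
  rw [Fintype.sum_prod_type, Finset.sum_subtype
    (Finset.univ.filter fun T : Finset ι => i₀ ∈ T) (p := fun T => i₀ ∈ T) (fun T => by simp)]
  refine Finset.sum_congr rfl fun T _ => ?_
  rw [← Finset.sum_coe_sort B.powerset]
  refine Finset.sum_congr rfl fun S _ => ?_
  simp only [Fintype.card_coe, Fintype.card_subtype_compl]

/-- The recursion that comes from splitting off one component. The factor `e` is the number of
choices of `i₀` in a set `T` of `e` labels: the count for a fixed `i₀` is averaged over `i₀`. -/
theorem mul_weightedCount (B : Finset (EllipticCurve L)) (n : ℕ) :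
    (n : ℚ) * weightedCount (simpleCovers (B : Set (EllipticCurve L)) n) =
      ∑ e ∈ Finset.range (n + 1), ∑ S ∈ B.powerset,
        (e * weightedCount (connectedSimpleCovers (S : Set (EllipticCurve L)) e)) *
          weightedCount (simpleCovers ((B : Set (EllipticCurve L)) \ S) (n - e)) := by
  obtain ⟨y, hy⟩ := (isPathConnected_compl B.finite_toSet).nonempty
  have hy' : y ∉ B := by simpa using hy
  set F : ℕ → ℚ := fun e => ∑ S ∈ B.powerset,
        (e.factorial * weightedCount (connectedSimpleCovers (S : Set (EllipticCurve L)) e)) *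
          ((n - e).factorial *
            weightedCount (simpleCovers ((B : Set (EllipticCurve L)) \ S) (n - e))) with hF
  have h1 : ∀ i₀ : Fin n, (n.factorial : ℚ) *
      weightedCount (simpleCovers (B : Set (EllipticCurve L)) n) =
        ∑ T : Finset (Fin n), if i₀ ∈ T then F T.card else 0 := fun i₀ => by
    have := factorial_mul_weightedCount hy' i₀
    rw [Fintype.card_fin] at this
    rw [this, Finset.sum_filter]
  -- summation over `i₀` replaces the condition `i₀ ∈ T` by the factor `|T|`
  have h2 : (n : ℚ) * ((n.factorial : ℚ) *
      weightedCount (simpleCovers (B : Set (EllipticCurve L)) n)) =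
        ∑ T : Finset (Fin n), T.card * F T.card := by
    calc _ = ∑ i₀ : Fin n, (n.factorial : ℚ) *
          weightedCount (simpleCovers (B : Set (EllipticCurve L)) n) := by simp
      _ = ∑ i₀ : Fin n, ∑ T : Finset (Fin n), if i₀ ∈ T then F T.card else 0 :=
        Finset.sum_congr rfl fun i₀ _ => h1 i₀
      _ = _ := by
        rw [Finset.sum_comm]
        refine Finset.sum_congr rfl fun T _ => ?_
        simp
  rw [← Finset.powerset_univ, Finset.sum_powerset_apply_card (fun m => (m : ℚ) * F m),
    Finset.card_univ, Fintype.card_fin] at h2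
  have h3 : (n.factorial : ℚ) ≠ 0 := by positivity
  apply mul_left_cancel₀ h3
  rw [mul_left_comm, h2, Finset.mul_sum]
  refine Finset.sum_congr rfl fun e he => ?_
  have h4 : e ≤ n := Nat.lt_succ_iff.1 (Finset.mem_range.1 he)
  rw [hF]
  simp only [Finset.mul_sum, Finset.smul_sum, nsmul_eq_mul]
  refine Finset.sum_congr rfl fun S _ => ?_
  rw [← Nat.choose_mul_factorial_mul_factorial h4]
  push_cast
  ring

/-! ### Covers of degree zero -/

/-- The only cover of degree zero is the empty one. -/
theorem isEmpty_of_mem_simpleCovers_zero {B : Set (EllipticCurve L)} (hB : B.Finite) {X : Cover L}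
    (hX : X ∈ simpleCovers B 0) : IsEmpty X.C := by
  by_contra h
  rw [not_isEmpty_iff] at h
  obtain ⟨x, hx⟩ := (hX.1.isNonconstant.dense_preimage_compl hB).nonempty
  have h1 := hX.2.2 (X.f x) (by rw [hX.2.1]; exact hx)
  rw [Nat.cast_zero, encard_eq_zero] at h1
  exact h1.subset (rfl : x ∈ X.f ⁻¹' {X.f x})

theorem weightedCount_empty : weightedCount (∅ : Set (Cover L)) = 0 := by
  have : IsEmpty (IsoClasses (∅ : Set (Cover L))) := inferInstanceAs (IsEmpty (Quotient _))
  rw [weightedCount, finsum_of_isEmpty]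

theorem simpleCovers_zero_of_nonempty {B : Set (EllipticCurve L)} (hB : B.Finite)
    (hne : B.Nonempty) : simpleCovers B 0 = ∅ := by
  refine eq_empty_of_forall_notMem fun X hX => ?_
  have := isEmpty_of_mem_simpleCovers_zero hB hX
  obtain ⟨y, hy⟩ := hne
  rw [← hX.2.1] at hy
  obtain ⟨x, -⟩ := hy
  exact this.elim x

/-- The empty cover is the only cover of degree zero, and it has one automorphism. It accounts for
the term `1` in `1 + Ẑ = exp Z`. -/
theorem weightedCount_simpleCovers_empty_zero :
    weightedCount (simpleCovers (∅ : Set (EllipticCurve L)) 0) = 1 := by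
  have hE : ∀ X ∈ simpleCovers (∅ : Set (EllipticCurve L)) 0, IsEmpty X.C := fun X hX =>
    isEmpty_of_mem_simpleCovers_zero finite_empty hX
  let _ : ChartedSpace ℂ Empty := ChartedSpace.empty ℂ Empty
  let X₀ : Cover L := { C := Empty, f := Empty.elim, holomorphic := fun x => x.elim }
  have hX₀ : X₀ ∈ simpleCovers (∅ : Set (EllipticCurve L)) 0 := by
    have h : X₀.ramificationPoints = ∅ := Set.eq_empty_of_isEmpty (α := Empty) _
    refine ⟨⟨fun x => x.elim, fun x => x.elim⟩, by rw [Cover.branchPoints, h, image_empty],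
      fun y _ => ?_⟩
    rw [Nat.cast_zero, encard_eq_zero]
    exact Set.eq_empty_of_isEmpty (α := Empty) _
  have hiso : ∀ X ∈ simpleCovers (∅ : Set (EllipticCurve L)) 0,
      ∀ Y ∈ simpleCovers (∅ : Set (EllipticCurve L)) 0, Nonempty (Unique (Cover.Iso X Y)) := by
    intro X hX Y hY
    have := hE X hX
    have := hE Y hY
    let e : X.C ≃ₜ Y.C :=
      { toEquiv := Equiv.equivOfIsEmpty _ _
        continuous_toFun := continuous_iff_continuousAt.2 fun x => isEmptyElim x
        continuous_invFun := continuous_iff_continuousAt.2 fun x => isEmptyElim x }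
    refine ⟨⟨⟨(Cover.isoEquiv hX.1.isNonconstant hY.1.isNonconstant).symm
      ⟨e, fun x => isEmptyElim x⟩⟩, fun a => ?_⟩⟩
    apply Subtype.ext
    ext x
    exact isEmptyElim x
  have : Nonempty (IsoClasses (simpleCovers (∅ : Set (EllipticCurve L)) 0)) := ⟨⟦⟨X₀, hX₀⟩⟧⟩
  have : Subsingleton (IsoClasses (simpleCovers (∅ : Set (EllipticCurve L)) 0)) := by
    constructor
    intro a b
    exact IsoClasses.eq_of_iso (hiso _ a.rep.2 _ b.rep.2).some.default
  have : Unique (IsoClasses (simpleCovers (∅ : Set (EllipticCurve L)) 0)) :=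
    Classical.choice ((unique_iff_subsingleton_and_nonempty _).2 ⟨inferInstance, inferInstance⟩)
  rw [weightedCount_eq, finsum_unique]
  have := (hiso _ (default : IsoClasses (simpleCovers (∅ : Set (EllipticCurve L)) 0)).rep.2 _
    (default : IsoClasses (simpleCovers (∅ : Set (EllipticCurve L)) 0)).rep.2).some
  rw [Nat.card_unique, Nat.cast_one, div_one]

/-! ### The differential equation of the exponential -/

section PowerSeries

variable {σ : Type*}

/-- Each coefficient of `exp Z` is a finite sum, whose length may be chosen as large as needed. -/
theorem eventually_coeff_exp_subst {Z : MvPowerSeries σ ℚ} (hZ : PowerSeries.HasSubst Z)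
    (e : σ →₀ ℕ) : ∀ᶠ M in atTop, MvPowerSeries.coeff e ((PowerSeries.exp ℚ).subst Z) =
      ∑ k ∈ Finset.range M, (1 / k.factorial : ℚ) * MvPowerSeries.coeff e (Z ^ k) := by
  obtain ⟨M₀, hM₀⟩ := (PowerSeries.coeff_subst_finite hZ (PowerSeries.exp ℚ) e).bddAbove
  filter_upwards [eventually_gt_atTop M₀] with M hM
  rw [PowerSeries.coeff_subst hZ, finsum_eq_sum_of_support_subset (s := Finset.range M)]
  · simp [PowerSeries.coeff_exp]
  · intro k hk
    rw [Finset.coe_range]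
    exact (hM₀ hk).trans_lt hM

/-- The chain rule `∂ (exp Z) = ∂ Z * exp Z`. -/
theorem pderiv_exp_subst {Z : MvPowerSeries σ ℚ} (hZ : PowerSeries.HasSubst Z) (s : σ) :
    MvPowerSeries.pderiv ℚ s ((PowerSeries.exp ℚ).subst Z) =
      MvPowerSeries.pderiv ℚ s Z * (PowerSeries.exp ℚ).subst Z := by
  classical
  ext n
  have h1 := (tendsto_add_atTop_nat 1).eventually
    (eventually_coeff_exp_subst hZ (n + Finsupp.single s 1))
  have h2 := (Finset.eventually_all (Finset.HasAntidiagonal.antidiagonal n)).2 fun p _ =>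
    eventually_coeff_exp_subst hZ p.2
  obtain ⟨M, hM1, hM2⟩ := (h1.and h2).exists
  rw [MvPowerSeries.coeff_pderiv, hM1, MvPowerSeries.coeff_mul, Finset.sum_mul]
  refine Eq.trans ?_ (Finset.sum_congr rfl fun p hp => congrArg _ (hM2 p hp)).symm
  have h3 : ∀ k : ℕ, (1 / k.factorial : ℚ) *
      MvPowerSeries.coeff (n + Finsupp.single s 1) (Z ^ k) * (n s + 1) =
        (1 / k.factorial : ℚ) * MvPowerSeries.coeff n (MvPowerSeries.pderiv ℚ s (Z ^ k)) :=
    fun k => by rw [MvPowerSeries.coeff_pderiv, mul_assoc]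
  simp only [h3, Finset.sum_range_succ']
  rw [pow_zero, MvPowerSeries.pderiv_one, map_zero, mul_zero, add_zero]
  simp only [Finset.mul_sum]
  rw [Finset.sum_comm]
  refine Finset.sum_congr rfl fun k _ => ?_
  rw [MvPowerSeries.pderiv_pow, add_tsub_cancel_right, mul_assoc, ← map_natCast (MvPowerSeries.C),
    MvPowerSeries.coeff_C_mul, mul_comm (Z ^ k), MvPowerSeries.coeff_mul, Nat.factorial_succ,
    Finset.mul_sum, Finset.mul_sum]
  refine Finset.sum_congr rfl fun p _ => ?_
  have : (k.factorial : ℚ) ≠ 0 := by positivity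
  have : ((k + 1 : ℕ) : ℚ) ≠ 0 := by positivity
  push_cast
  field_simp

/-- A solution `G` of the linear differential equation `∂G = F G` is determined by the terms of `G`
that do not contain the variable of differentiation. -/
theorem eq_zero_of_pderiv_eq {F G : MvPowerSeries σ ℚ} {s : σ}
    (hG : MvPowerSeries.pderiv ℚ s G = F * G)
    (h0 : ∀ n : σ →₀ ℕ, n s = 0 → MvPowerSeries.coeff n G = 0) : G = 0 := by
  classical
  ext n
  rw [map_zero]
  induction hk : n s using Nat.strong_induction_on generalizing n with
  | h k ih =>
    rcases Nat.eq_zero_or_pos k with rfl | hpos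
    · exact h0 n hk
    · obtain ⟨m, rfl⟩ : ∃ m, n = m + Finsupp.single s 1 := by
        refine ⟨n - Finsupp.single s 1, (tsub_add_cancel_of_le ?_).symm⟩
        rw [Finsupp.single_le_iff]
        omega
      have h1 := congrArg (MvPowerSeries.coeff m) hG
      have h2 : (m s : ℚ) + 1 ≠ 0 := by positivity
      rw [MvPowerSeries.coeff_pderiv, MvPowerSeries.coeff_mul, Finset.sum_eq_zero] at h1
      · exact (mul_eq_zero.1 h1).resolve_right h2
      · intro p hp
        have h3 : p.1 s + p.2 s = m s := by
          rw [← Finset.HasAntidiagonal.mem_antidiagonal.1 hp, Finsupp.add_apply]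
        have h4 : m s + 1 = k := by simpa using hk
        rw [ih (p.2 s) (by omega) p.2 rfl, mul_zero]

theorem coeff_mul_fin_two {R : Type*} [CommSemiring R] (F G : MvPowerSeries (Fin 2) R)
    (m : Fin 2 →₀ ℕ) :
    MvPowerSeries.coeff m (F * G) =
      ∑ p ∈ Finset.HasAntidiagonal.antidiagonal (m 0),
        ∑ q ∈ Finset.HasAntidiagonal.antidiagonal (m 1),
        MvPowerSeries.coeff (Finsupp.single 0 p.1 + Finsupp.single 1 q.1) F *
          MvPowerSeries.coeff (Finsupp.single 0 p.2 + Finsupp.single 1 q.2) G := by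
  classical
  have h : ∀ i : Fin 2 →₀ ℕ, Finsupp.single 0 (i 0) + Finsupp.single 1 (i 1) = i := fun i => by
    ext j
    fin_cases j <;> simp
  rw [MvPowerSeries.coeff_mul, ← Finset.sum_product']
  refine Finset.sum_nbij' (fun p => ((p.1 0, p.2 0), (p.1 1, p.2 1)))
    (fun r => (Finsupp.single 0 r.1.1 + Finsupp.single 1 r.2.1,
      Finsupp.single 0 r.1.2 + Finsupp.single 1 r.2.2)) ?_ ?_ ?_ ?_ ?_
  · intro p hp
    rw [← Finset.HasAntidiagonal.mem_antidiagonal.1 hp]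
    simp
  · rintro ⟨⟨a, b⟩, ⟨c, d⟩⟩ hr
    simp only [Finset.mem_product, Finset.HasAntidiagonal.mem_antidiagonal] at hr ⊢
    ext j
    fin_cases j
    · simpa using hr.1
    · simpa using hr.2
  · intro p _
    simp [h]
  · rintro ⟨⟨a, b⟩, ⟨c, d⟩⟩ _
    simp
  · intro p _
    simp [h]

end PowerSeries

/-! ### The number of branch points is even -/

/-- A square root with nonnegative real part. -/
theorem exists_sqrt_slitPlane : ∃ q : ℂ → ℂ, (∀ w, w ≠ 0 → q w ^ 2 = w) ∧
    (∀ w ∈ Complex.slitPlane, ContinuousAt q w) ∧ (∀ w ∈ Complex.slitPlane, 0 < (q w).re) := by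
  refine ⟨fun w => Complex.exp (Complex.log w / 2), fun w hw => ?_, fun w hw => ?_, fun w hw => ?_⟩
  · rw [← Complex.exp_nat_mul, Nat.cast_ofNat, mul_div_cancel₀ _ two_ne_zero, Complex.exp_log hw]
  · exact ((continuousAt_clog hw).div_const 2).cexp
  · rw [Complex.exp_re]
    refine mul_pos (Real.exp_pos _) (Real.cos_pos_of_mem_Ioo ?_)
    have h1 : (Complex.log w / 2).im = Complex.arg w / 2 := by
      rw [← Complex.log_im]
      exact Complex.div_ofNat_im _ 2
    have h2 := Complex.neg_pi_lt_arg w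
    have h3 := (Complex.arg_le_pi w).lt_of_ne (Complex.mem_slitPlane_iff_arg.1 hw).1
    rw [h1]
    constructor <;> linarith

/-- There are two branches of the square root, one off the ray `i ℝ≥0` and one off the ray
`-i ℝ≥0`, that agree in the right half-plane and differ in the left one. -/
theorem exists_two_sqrt_branches : ∃ q₁ q₂ : ℂ → ℂ,
    (∀ w, w ≠ 0 → q₁ w ^ 2 = w) ∧ (∀ w, w ≠ 0 → q₂ w ^ 2 = w) ∧
    (∀ w, w.re ≠ 0 ∨ w.im < 0 → ContinuousAt q₁ w) ∧
    (∀ w, w.re ≠ 0 ∨ 0 < w.im → ContinuousAt q₂ w) ∧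
    (∀ w, 0 < w.re → q₁ w = q₂ w) ∧ ∀ w, w.re < 0 → q₁ w ≠ q₂ w := by
  obtain ⟨q, hq1, hq2, hq3⟩ := exists_sqrt_slitPlane
  obtain ⟨t, ht0, ht⟩ : ∃ t : ℝ, 0 < t ∧ 2 * t ^ 2 = 1 := by
    refine ⟨√(1 / 2), by positivity, ?_⟩
    rw [Real.sq_sqrt (by norm_num)]
    norm_num
  have htc : 2 * (t : ℂ) ^ 2 = 1 := by exact_mod_cast ht
  have hI : Complex.I ^ 2 = -1 := Complex.I_sq
  have him : ∀ w, w ≠ 0 → 2 * (q w).re * (q w).im = w.im := fun w hw => by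
    have := congrArg Complex.im (hq1 w hw)
    rw [pow_two, Complex.mul_im] at this
    linarith
  have hsl : ∀ w : ℂ, w.re ≠ 0 ∨ w.im < 0 → Complex.I * w ∈ Complex.slitPlane := fun w hw => by
    rw [Complex.mem_slitPlane_iff]
    simp only [Complex.mul_re, Complex.I_re, Complex.I_im, Complex.mul_im]
    rcases hw with h | h
    · right; simpa using h
    · left; simpa using h
  have hsl' : ∀ w : ℂ, w.re ≠ 0 ∨ 0 < w.im → -(Complex.I * w) ∈ Complex.slitPlane := fun w hw => by
    rw [Complex.mem_slitPlane_iff]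
    simp only [Complex.neg_re, Complex.neg_im, Complex.mul_re, Complex.I_re, Complex.I_im,
      Complex.mul_im]
    rcases hw with h | h
    · right; simpa using h
    · left; simpa using h
  have hs1 : ∀ w, w ≠ 0 → (t * (1 - Complex.I) * q (Complex.I * w)) ^ 2 = w := fun w hw => by
    rw [mul_pow, hq1 _ (mul_ne_zero Complex.I_ne_zero hw)]
    linear_combination (-(2 * t ^ 2 * w) + t ^ 2 * Complex.I * w) * hI + w * htc
  have hs2 : ∀ w, w ≠ 0 → (t * (1 + Complex.I) * q (-(Complex.I * w))) ^ 2 = w := fun w hw => by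
    rw [mul_pow, hq1 _ (neg_ne_zero.2 (mul_ne_zero Complex.I_ne_zero hw))]
    linear_combination (-(2 * t ^ 2 * w) - t ^ 2 * Complex.I * w) * hI + w * htc
  -- the signs of the coordinates of the two roots, in the two half-planes
  have hsign : ∀ w : ℂ, w.re ≠ 0 → 0 < (q (Complex.I * w)).re ∧ 0 < (q (-(Complex.I * w))).re ∧
      2 * (q (Complex.I * w)).re * (q (Complex.I * w)).im = w.re ∧
      2 * (q (-(Complex.I * w))).re * (q (-(Complex.I * w))).im = -w.re := fun w hw => by
    have hw0 : w ≠ 0 := by rintro rfl; exact hw rfl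
    have h0 : Complex.I * w ≠ 0 := mul_ne_zero Complex.I_ne_zero hw0
    refine ⟨hq3 _ (hsl w (.inl hw)), hq3 _ (hsl' w (.inl hw)), ?_, ?_⟩
    · rw [him _ h0]; simp
    · rw [him _ (neg_ne_zero.2 h0)]; simp
  refine ⟨fun w => t * (1 - Complex.I) * q (Complex.I * w),
    fun w => t * (1 + Complex.I) * q (-(Complex.I * w)), hs1, hs2, fun w hw => ?_, fun w hw => ?_,
    fun w hw => ?_, fun w hw h => ?_⟩
  · exact continuousAt_const.mul
      (ContinuousAt.comp (f := fun w => Complex.I * w) (hq2 _ (hsl w hw)) (by fun_prop))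
  · exact continuousAt_const.mul
      (ContinuousAt.comp (f := fun w => -(Complex.I * w)) (hq2 _ (hsl' w hw)) (by fun_prop))
  · have hw0 : w ≠ 0 := by rintro rfl; exact hw.ne' rfl
    obtain ⟨h1, h2, h3, h4⟩ := hsign w hw.ne'
    have h5 : 0 < (q (Complex.I * w)).im := by nlinarith
    have h6 : (q (-(Complex.I * w))).im < 0 := by nlinarith
    refine (sq_eq_sq_iff_eq_or_eq_neg.1 ((hs1 w hw0).trans (hs2 w hw0).symm)).resolve_right ?_
    intro h
    have h7 := congrArg Complex.re h
    simp [mul_assoc] at h7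
    nlinarith
  · obtain ⟨h1, h2, h3, h4⟩ := hsign w hw.ne
    have h5 : (q (Complex.I * w)).im < 0 := by nlinarith
    have h6 : 0 < (q (-(Complex.I * w))).im := by nlinarith
    have h7 := congrArg Complex.im h
    simp [mul_assoc] at h7
    rcases h7 with h7 | h7 <;> linarith

/-- A nontrivial permutation that moves at most two points is a transposition. -/
theorem sign_eq_neg_one_of_forall_eq {ι : Type*} [Fintype ι] [DecidableEq ι] {π : Equiv.Perm ι}
    (h : π ≠ 1) {k l : ι} (hkl : ∀ i, i ≠ k → i ≠ l → π i = i) : Equiv.Perm.sign π = -1 := by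
  have h1 : π.support ⊆ {k, l} := fun i hi => by
    by_contra hi'
    simp only [Finset.mem_insert, Finset.mem_singleton, not_or] at hi'
    exact Equiv.Perm.mem_support.1 hi (hkl i hi'.1 hi'.2)
  have h2 := (Finset.card_le_card h1).trans Finset.card_le_two
  have h3 := Equiv.Perm.two_le_card_support_of_ne_one h
  exact (Equiv.Perm.card_support_eq_two.1 (le_antisymm h2 h3)).sign_eq

namespace Cover

/-- On `K`, the map `g` is a continuous lift to the cover of the projection to the elliptic
curve. -/
structure IsLift (X : Cover L) (K : Set ℂ) (g : ℂ → X.C) : Prop where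
  continuousOn : ContinuousOn g K
  map_eq : ∀ u ∈ K, X.f (g u) = QuotientAddGroup.mk u

theorem IsLift.mono {X : Cover L} {K K' : Set ℂ} {g : ℂ → X.C} (hg : X.IsLift K g)
    (h : K' ⊆ K) : X.IsLift K' g :=
  ⟨hg.continuousOn.mono h, fun u hu => hg.map_eq u (h hu)⟩

theorem IsLift.comp_add {X : Cover L} {K K' : Set ℂ} {g : ℂ → X.C} (hg : X.IsLift K g) {v : ℂ}
    (hv : v ∈ L.lattice) (h : ∀ u ∈ K', u + v ∈ K) : X.IsLift K' fun u => g (u + v) := by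
  refine ⟨hg.continuousOn.comp (by fun_prop) h, fun u hu => ?_⟩
  rw [hg.map_eq _ (h u hu)]
  exact (QuotientAddGroup.eq.2 (by simpa using hv)).symm

/-- Lifts on a connected set are unique. -/
theorem IsLift.eqOn {X : Cover L} {K : Set ℂ} {g h : ℂ → X.C} (hg : X.IsLift K g)
    (hh : X.IsLift K h) (hK : IsPreconnected K)
    (hKB : ∀ u ∈ K, (QuotientAddGroup.mk u : EllipticCurve L) ∉ X.branchPoints) {u : ℂ}
    (hu : u ∈ K) (heq : g u = h u) : EqOn g h K := by
  have : PreconnectedSpace K := isPreconnected_iff_preconnectedSpace.1 hK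
  have h1 := X.lift_unique subset_rfl (g₁ := fun v : K => g v) (g₂ := fun v : K => h v)
    (continuousOn_iff_continuous_domRestrict.1 hg.continuousOn)
    (continuousOn_iff_continuous_domRestrict.1 hh.continuousOn)
    (fun v => by rw [hg.map_eq v v.2, hh.map_eq v v.2])
    (fun v => by rw [hg.map_eq v v.2]; exact hKB v v.2) ⟨u, hu⟩ heq
  exact fun v hv => congrFun h1 ⟨v, hv⟩

theorem exists_isLift (X : Cover L) {K : Set ℂ} (hK : Convex ℝ K) (hKo : IsOpen K)
    (hKB : ∀ u ∈ K, (QuotientAddGroup.mk u : EllipticCurve L) ∉ X.branchPoints) {u : ℂ}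
    (hu : u ∈ K) {x : X.C} (hx : X.f x = QuotientAddGroup.mk u) :
    ∃ g, X.IsLift K g ∧ g u = x := by
  classical
  obtain ⟨s, hs, hs', hsu⟩ := X.exists_lift subset_rfl hK hKo hKB ⟨u, hu⟩ hx
  refine ⟨fun v => if h : v ∈ K then s ⟨v, h⟩ else x, ⟨?_, fun v hv => ?_⟩, ?_⟩
  · rw [continuousOn_iff_continuous_domRestrict]
    convert hs using 1
    ext v
    simp
  · rw [dif_pos hv]
    exact hs' _
  · exact (dif_pos hu).trans hsu

/-- The `s k`, for `k` in `ι`, are the lifts on `K`. -/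
structure IsSheets (X : Cover L) {ι : Type} (K : Set ℂ) (s : ι → ℂ → X.C) : Prop where
  isLift : ∀ k, X.IsLift K (s k)
  injective : ∀ u ∈ K, Function.Injective fun k => s k u
  exists_eq : ∀ u ∈ K, ∀ x, X.f x = QuotientAddGroup.mk u → ∃ k, s k u = x

/-- Over a convex open set that avoids the branch points, the points of one fibre extend to the
lifts. -/
theorem exists_isSheets (X : Cover L) {ι : Type} {K : Set ℂ} (hK : Convex ℝ K) (hKo : IsOpen K)
    (hKB : ∀ u ∈ K, (QuotientAddGroup.mk u : EllipticCurve L) ∉ X.branchPoints) {u : ℂ}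
    (hu : u ∈ K) (ℓ : ι ≃ X.f ⁻¹' {(QuotientAddGroup.mk u : EllipticCurve L)}) :
    ∃ s : ι → ℂ → X.C, X.IsSheets K s := by
  choose s hs hsu using fun k => X.exists_isLift hK hKo hKB hu (ℓ k).2
  refine ⟨s, hs, fun v hv k k' h => ?_, fun v hv x hx => ?_⟩
  · have := (hs k).eqOn (hs k') hK.isPreconnected hKB hv h hu
    rw [hsu, hsu] at this
    exact ℓ.injective (Subtype.ext this)
  · obtain ⟨g, hg, hgv⟩ := X.exists_isLift hK hKo hKB hv hx
    obtain ⟨k, hk⟩ := ℓ.surjective ⟨g u, hg.map_eq u hu⟩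
    have h : g u = s k u := by rw [hsu, hk]
    exact ⟨k, (hg.eqOn (hs k) hK.isPreconnected hKB hu h hv).symm.trans hgv⟩

theorem IsSheets.comp_add {X : Cover L} {ι : Type} {K K' : Set ℂ} {s : ι → ℂ → X.C}
    (hs : X.IsSheets K s) {v : ℂ} (hv : v ∈ L.lattice) (h : ∀ u ∈ K', u + v ∈ K) :
    X.IsSheets K' fun k u => s k (u + v) := by
  refine ⟨fun k => (hs.isLift k).comp_add hv h, fun u hu => hs.injective _ (h u hu),
    fun u hu x hx => hs.exists_eq _ (h u hu) x ?_⟩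
  rw [hx]
  exact QuotientAddGroup.eq.2 (by simpa using hv)

/-- `τ` is the permutation of the sheets that is obtained by following the lifts through `V`, from
`K` to `K'`. -/
def IsTransport (X : Cover L) {ι : Type} (K K' V : Set ℂ) (s s' : ι → ℂ → X.C)
    (τ : Equiv.Perm ι) : Prop :=
  ∀ k, ∃ g, X.IsLift V g ∧ EqOn g (s k) (V ∩ K) ∧ EqOn g (s' (τ k)) (V ∩ K')

/-- Transport through a convex open set `V` that avoids the branch points and meets `K` and `K'`. -/
theorem exists_isTransport (X : Cover L) {ι : Type} [Finite ι] {K K' V : Set ℂ}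
    {s s' : ι → ℂ → X.C} (hs : X.IsSheets K s) (hs' : X.IsSheets K' s') (hV : Convex ℝ V)
    (hVo : IsOpen V) (hVB : ∀ u ∈ V, (QuotientAddGroup.mk u : EllipticCurve L) ∉ X.branchPoints)
    (hK : Convex ℝ K) (hK' : Convex ℝ K') (h : (V ∩ K).Nonempty) (h' : (V ∩ K').Nonempty) :
    ∃ τ, X.IsTransport K K' V s s' τ := by
  obtain ⟨u, hu⟩ := h
  obtain ⟨u', hu'⟩ := h'
  choose g hg hgu using fun k =>
    X.exists_isLift hV hVo hVB hu.1 ((hs.isLift k).map_eq u hu.2)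
  choose τ hτ using fun k => hs'.exists_eq u' hu'.2 (g k u') ((hg k).map_eq u' hu'.1)
  have hinj : Function.Injective τ := by
    intro k k' hk
    have h1 : g k u' = g k' u' := by rw [← hτ, ← hτ, hk]
    have h2 := (hg k).eqOn (hg k') hV.isPreconnected hVB hu'.1 h1 hu.1
    rw [hgu, hgu] at h2
    exact hs.injective u hu.2 h2
  refine ⟨Equiv.ofBijective τ (Finite.injective_iff_bijective.1 hinj), fun k => ⟨g k, hg k, ?_, ?_⟩⟩
  · exact ((hg k).mono inter_subset_left).eqOn ((hs.isLift k).mono inter_subset_right)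
      (hV.inter hK).isPreconnected (fun u hu => hVB u hu.1) hu (hgu k)
  · exact ((hg k).mono inter_subset_left).eqOn ((hs'.isLift _).mono inter_subset_right)
      (hV.inter hK').isPreconnected (fun u hu => hVB u hu.1) hu' (hτ k).symm

/-- A lift on a part `V ∩ D` of `V` computes the transport. -/
theorem IsTransport.apply_eq {X : Cover L} {ι : Type} {K K' V : Set ℂ} {s s' : ι → ℂ → X.C}
    {τ : Equiv.Perm ι} (hτ : X.IsTransport K K' V s s' τ) (hs' : X.IsSheets K' s') {D : Set ℂ}
    (hV : Convex ℝ V) (hD : Convex ℝ D)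
    (hVB : ∀ u ∈ V, (QuotientAddGroup.mk u : EllipticCurve L) ∉ X.branchPoints) {g : ℂ → X.C}
    (hg : X.IsLift (V ∩ D) g) {k j : ι} {u u' : ℂ} (hu : u ∈ V ∩ D) (huK : u ∈ K)
    (hu' : u' ∈ V ∩ D) (huK' : u' ∈ K') (hk : g u = s k u) (hj : g u' = s' j u') : τ k = j := by
  obtain ⟨G, hG, hG1, hG2⟩ := hτ k
  refine hs'.injective u' huK' ?_
  beta_reduce
  rw [← hG2 ⟨hu'.1, huK'⟩, ← hj]
  exact (hG.mono inter_subset_left).eqOn hg (hV.inter hD).isPreconnected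
    (fun v hv => hVB v hv.1) hu (by rw [hk]; exact hG1 ⟨hu.1, huK⟩) hu'

/-- Near an unramified point a cover has a local section. -/
theorem exists_isLift_ball (X : Cover L) {p : X.C} (hp : p ∉ X.ramificationPoints) {b : ℂ}
    (hb : X.f p = QuotientAddGroup.mk b) : ∃ N ∈ 𝓝 p, ∀ᶠ ε in 𝓝[>] (0 : ℝ), ∃ g,
      X.IsLift (Metric.ball b ε) g ∧ ∀ x ∈ N, ∀ u ∈ Metric.ball b ε,
        X.f x = QuotientAddGroup.mk u → g u = x := by
  obtain ⟨φ, hpφ, hφ⟩ := X.isLocalHomeomorphOn p hp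
  have h1 : ∀ᶠ u in 𝓝 b, (QuotientAddGroup.mk u : EllipticCurve L) ∈ φ.target := by
    refine QuotientAddGroup.continuous_mk.continuousAt.eventually (φ.open_target.mem_nhds ?_)
    rw [← hb, hφ]
    exact φ.map_source hpφ
  obtain ⟨ε₀, hε₀, hball⟩ := Metric.eventually_nhds_iff_ball.1 h1
  refine ⟨φ.source, φ.open_source.mem_nhds hpφ, ?_⟩
  filter_upwards [Ioo_mem_nhdsGT hε₀] with ε hε
  have hsub : ∀ u ∈ Metric.ball b ε, (QuotientAddGroup.mk u : EllipticCurve L) ∈ φ.target :=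
    fun u hu => hball u (Metric.ball_subset_ball hε.2.le hu)
  refine ⟨fun u => φ.symm (QuotientAddGroup.mk u), ⟨?_, fun u hu => ?_⟩, fun x hx u _ hxu => ?_⟩
  · exact φ.continuousOn_symm.comp QuotientAddGroup.continuous_mk.continuousOn hsub
  · rw [hφ]
    exact φ.right_inv (hsub u hu)
  · beta_reduce
    rw [← hxu, hφ]
    exact φ.left_inv hx

/-- Near a ramification point of index two a cover is of the form `z ↦ b + c z ^ 2`. -/
theorem exists_parametrization (X : Cover L) {p : X.C} (hp : X.ramificationIndex p = 2) {b : ℂ}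
    (hb : X.f p = QuotientAddGroup.mk b) {c : ℂ} (hc : c ≠ 0) : ∃ ρ > 0, ∃ r : ℂ → X.C,
      ContinuousOn r (Metric.ball 0 ρ) ∧ InjOn r (Metric.ball 0 ρ) ∧
      (∀ z ∈ Metric.ball (0 : ℂ) ρ, X.f (r z) = QuotientAddGroup.mk (b + c * z ^ 2)) ∧
      ∃ N ∈ 𝓝 p, ∃ U ∈ 𝓝 b, ∀ x ∈ N, ∀ u ∈ U, X.f x = QuotientAddGroup.mk u →
        ∃ z ∈ Metric.ball (0 : ℂ) ρ, r z = x ∧ u = b + c * z ^ 2 := by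
  obtain ⟨s, hs, hs0, hsd, hsv⟩ := exists_sqrt_of_order_eq_two
    (X.analyticAt_localMap (mem_chart_source ℂ p)) ((X.ramificationIndex_eq p).symm.trans hp)
  obtain ⟨κ, hκ⟩ : ∃ κ : ℂ, κ ^ 2 = c := IsAlgClosed.exists_pow_nat_eq _ (by norm_num)
  have hκ0 : κ ≠ 0 := by rintro rfl; exact hc (by rw [← hκ]; simp)
  set e := chartAt ℂ p
  have hpe : p ∈ e.source := mem_chart_source ℂ p
  have hmk : ∀ᶠ x in 𝓝 p, X.f x = (QuotientAddGroup.mk (b + (s (e x)) ^ 2) : EllipticCurve L) := by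
    have h0 : (QuotientAddGroup.mk (localMap X.f e p (e p)) : EllipticCurve L) =
        QuotientAddGroup.mk b := by
      rw [localMap_apply _ _ hpe, mk_atlas_apply (chart_mem_atlas _ _) (mem_chart_source _ _), hb]
    filter_upwards [(e.continuousAt hpe).eventually hsv, e.open_source.mem_nhds hpe,
      X.continuous.continuousAt.eventually ((chartAt ℂ (X.f p)).open_source.mem_nhds
        (mem_chart_source ℂ (X.f p)))] with x h1 h2 h3
    rw [QuotientAddGroup.mk_add, ← h0, ← QuotientAddGroup.mk_add, ← h1, localMap, e.left_inv h2,
      mk_atlas_apply (chart_mem_atlas _ _) h3]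
  let σ : OpenPartialHomeomorph ℂ ℂ :=
    (hs.hasStrictDerivAt.hasStrictFDerivAt_equiv hsd).toOpenPartialHomeomorph _
  let Ψ : OpenPartialHomeomorph X.C ℂ := e.trans σ
  have hΨ : ∀ x, Ψ x = s (e x) := fun x => rfl
  have hpΨ : p ∈ Ψ.source := by
    rw [OpenPartialHomeomorph.trans_source]
    exact ⟨hpe,
      (hs.hasStrictDerivAt.hasStrictFDerivAt_equiv hsd).mem_toOpenPartialHomeomorph_source⟩
  have hΨp : Ψ p = 0 := hs0
  have h0t : (0 : ℂ) ∈ Ψ.target := hΨp ▸ Ψ.map_source hpΨ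
  have hsymm : Tendsto Ψ.symm (𝓝 0) (𝓝 p) := by
    have := Ψ.continuousAt_symm h0t
    rwa [ContinuousAt, ← hΨp, Ψ.left_inv hpΨ, hΨp] at this
  have hmul : Tendsto (fun z : ℂ => κ * z) (𝓝 0) (𝓝 0) := by
    have : ContinuousAt (fun z : ℂ => κ * z) 0 := by fun_prop
    simpa [ContinuousAt] using this
  obtain ⟨ρ, hρ, hball⟩ := Metric.eventually_nhds_iff_ball.1
    (hmul.eventually ((hsymm.eventually hmk).and (Ψ.open_target.mem_nhds h0t)))
  obtain ⟨φ, hbφ, hφ⟩ := isLocalHomeomorph_mk L b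
  refine ⟨ρ, hρ, fun z => Ψ.symm (κ * z), ?_, ?_, ?_, ?_⟩
  · exact Ψ.continuousOn_symm.comp (by fun_prop) fun z hz => (hball z hz).2
  · intro z hz z' hz' h
    exact mul_left_cancel₀ hκ0 (Ψ.symm.injOn (hball z hz).2 (hball z' hz').2 h)
  · intro z hz
    rw [(hball z hz).1, ← hΨ, Ψ.right_inv (hball z hz).2, mul_pow, hκ]
  · have hΨc : ContinuousAt Ψ p := Ψ.continuousAt hpΨ
    have h1 : ∀ᶠ x in 𝓝 p, Ψ x / κ ∈ Metric.ball (0 : ℂ) ρ := by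
      refine (hΨc.div_const κ).eventually (Metric.isOpen_ball.mem_nhds ?_)
      change Ψ p / κ ∈ _
      rw [hΨp, zero_div]
      exact Metric.mem_ball_self hρ
    have h2 : ∀ᶠ x in 𝓝 p, b + Ψ x ^ 2 ∈ φ.source := by
      refine (continuousAt_const.add (hΨc.pow 2)).eventually (φ.open_source.mem_nhds ?_)
      change b + Ψ p ^ 2 ∈ _
      rw [hΨp]
      simpa using hbφ
    refine ⟨_, (h1.and (h2.and (hmk.and (Ψ.open_source.mem_nhds hpΨ)))), φ.source,
      φ.open_source.mem_nhds hbφ, ?_⟩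
    rintro x ⟨hx1, hx2, hx3, hx4⟩ u hu hxu
    refine ⟨Ψ x / κ, hx1, ?_, ?_⟩
    · beta_reduce
      rw [mul_div_cancel₀ _ hκ0]
      exact Ψ.left_inv hx4
    · have h3 : φ (b + Ψ x ^ 2) = φ u := by
        rw [← hφ]
        exact hx3.symm.trans hxu
      rw [← φ.injOn hx2 hu h3, div_pow, hκ, mul_div_cancel₀ _ hc]

/-- Near a branch point of a simple cover all sheets are either unramified or lie on the image of a
parametrization of the form `z ↦ b + c z ^ 2`. -/
theorem IsSimple.exists_local_form {X : Cover L} (hX : X.IsSimple 2) {b c : ℂ}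
    (hb : (QuotientAddGroup.mk b : EllipticCurve L) ∈ X.branchPoints) (hc : c ≠ 0) :
    ∃ ρ > 0, ∃ r : ℂ → X.C, ContinuousOn r (Metric.ball 0 ρ) ∧ InjOn r (Metric.ball 0 ρ) ∧
      (∀ z ∈ Metric.ball (0 : ℂ) ρ, X.f (r z) = QuotientAddGroup.mk (b + c * z ^ 2)) ∧
      ∀ᶠ ε in 𝓝[>] (0 : ℝ), ∀ u ∈ Metric.ball b ε, ∀ x, X.f x = QuotientAddGroup.mk u →
        (∃ z ∈ Metric.ball (0 : ℂ) ρ, r z = x ∧ u = b + c * z ^ 2) ∨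
          ∃ g, X.IsLift (Metric.ball b ε) g ∧ g u = x := by
  obtain ⟨p, hp, hpb⟩ := hb
  obtain ⟨ρ, hρ, r, hr1, hr2, hr3, N, hN, U, hU, hNU⟩ :=
    X.exists_parametrization (hX.1 p hp) hpb hc
  refine ⟨ρ, hρ, r, hr1, hr2, hr3, ?_⟩
  let F : Set X.C := X.f ⁻¹' {(QuotientAddGroup.mk b : EllipticCurve L)} \ {p}
  have hF : F.Finite := (hX.isNonconstant.finite_fiber _).subset sdiff_subset
  have hFu : ∀ q ∈ F, q ∉ X.ramificationPoints := fun q hq hq' =>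
    hq.2 (hX.2 hq' hp (Eq.trans hq.1 hpb.symm))
  choose! M hM hMε using fun q (hq : q ∈ F) => X.exists_isLift_ball (hFu q hq) hq.1
  have h1 : ∀ᶠ u in 𝓝 b, ∀ x ∈ X.f ⁻¹' {(QuotientAddGroup.mk u : EllipticCurve L)},
      x ∈ N ∨ ∃ q ∈ F, x ∈ M q := by
    refine QuotientAddGroup.continuous_mk.continuousAt.eventually
      (X.continuous.isClosedMap.eventually_nhds_fiber _ fun x hx => ?_)
    by_cases hxp : x = p
    · subst hxp
      filter_upwards [hN] with x hx using .inl hx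
    · filter_upwards [hM x ⟨hx, hxp⟩] with x' hx' using .inr ⟨x, ⟨hx, hxp⟩, hx'⟩
  obtain ⟨ε₀, hε₀, hball⟩ := Metric.eventually_nhds_iff_ball.1 (h1.and hU)
  filter_upwards [Ioo_mem_nhdsGT hε₀, (eventually_all_finite hF).2 hMε] with ε hε hg u hu x hx
  have hu' := hball u (Metric.ball_subset_ball hε.2.le hu)
  rcases hu'.1 x hx with h | ⟨q, hq, h⟩
  · exact .inl (hNU x h u hu'.2 hx)
  · obtain ⟨g, hg1, hg2⟩ := hg q hq
    exact .inr ⟨g, hg1, hg2 x h u hu hx⟩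

/-- Transport to the left and to the right of a branch point `b` differ by a transposition, namely
of the two sheets that come together at the ramification point over `b`. In the coordinate `ζ = (u -
b) / c`, the sets `V` and `V'` lie in the left and in the right half-plane, while `K` and `K'` avoid
the rays `i ℝ≥0` and `-i ℝ≥0`, so that a branch of `√ζ` exists on each of them. -/
theorem IsTransport.sign_eq_neg {X : Cover L} (hX : X.IsSimple 2) {ι : Type} [Fintype ι]
    [DecidableEq ι] {K K' V V' : Set ℂ} {s s' : ι → ℂ → X.C} {τ τ' : Equiv.Perm ι}
    (hτ : X.IsTransport K K' V s s' τ) (hτ' : X.IsTransport K K' V' s s' τ')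
    (hs : X.IsSheets K s) (hs' : X.IsSheets K' s') (hK : Convex ℝ K) (hK' : Convex ℝ K')
    (hV : Convex ℝ V) (hV' : Convex ℝ V')
    (hKB : ∀ u ∈ K, (QuotientAddGroup.mk u : EllipticCurve L) ∉ X.branchPoints)
    (hKB' : ∀ u ∈ K', (QuotientAddGroup.mk u : EllipticCurve L) ∉ X.branchPoints)
    (hVB : ∀ u ∈ V, (QuotientAddGroup.mk u : EllipticCurve L) ∉ X.branchPoints)
    (hVB' : ∀ u ∈ V', (QuotientAddGroup.mk u : EllipticCurve L) ∉ X.branchPoints) {b c : ℂ}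
    (hb : (QuotientAddGroup.mk b : EllipticCurve L) ∈ X.branchPoints) (hc : c ≠ 0)
    (hKc : ∀ t : ℝ, 0 ≤ t → b + c * (t * Complex.I) ∉ K)
    (hKc' : ∀ t : ℝ, 0 ≤ t → b - c * (t * Complex.I) ∉ K')
    (hVc : ∀ u ∈ V, ((u - b) / c).re < 0) (hVc' : ∀ u ∈ V', 0 < ((u - b) / c).re)
    (h₁ : b ∈ closure (V ∩ K)) (h₂ : b ∈ closure (V ∩ K')) (h₃ : b ∈ closure (V' ∩ K))
    (h₄ : b ∈ closure (V' ∩ K')) : Equiv.Perm.sign τ' = - Equiv.Perm.sign τ := by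
  obtain ⟨ρ, hρ, r, hr1, hr2, hr3, hloc⟩ := hX.exists_local_form hb hc
  obtain ⟨q₁, q₂, hq₁, hq₂, hq₁c, hq₂c, hright, hleft⟩ := exists_two_sqrt_branches
  have hcρ : 0 < ‖c‖ * ρ ^ 2 := mul_pos (norm_pos_iff.2 hc) (by positivity)
  obtain ⟨ε, hεloc, hε⟩ := (hloc.and (Ioo_mem_nhdsGT hcρ)).exists
  set D := Metric.ball b ε with hD
  have hDc : Convex ℝ D := convex_ball b ε
  have hDn : D ∈ 𝓝 b := Metric.ball_mem_nhds b hε.1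
  set ζ : ℂ → ℂ := fun u => (u - b) / c with hζ
  have hζu : ∀ u, b + c * ζ u = u := fun u => by
    rw [hζ]
    beta_reduce
    rw [mul_div_cancel₀ _ hc, add_sub_cancel]
  have hVζ : ∀ u ∈ V ∩ D, (ζ u).re < 0 := fun u hu => hVc u hu.1
  have hVζ' : ∀ u ∈ V' ∩ D, 0 < (ζ u).re := fun u hu => hVc' u hu.1
  have hKζ : ∀ u ∈ K ∩ D, (ζ u).re ≠ 0 ∨ (ζ u).im < 0 := fun u hu => by
    by_contra! h
    refine hKc (ζ u).im h.2 ?_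
    have h1 : ((ζ u).im : ℂ) * Complex.I = ζ u := by
      apply Complex.ext <;> simp [h.1]
    rw [h1, hζu]
    exact hu.1
  have hKζ' : ∀ u ∈ K' ∩ D, (ζ u).re ≠ 0 ∨ 0 < (ζ u).im := fun u hu => by
    by_contra! h
    refine hKc' (-(ζ u).im) (by linarith [h.2]) ?_
    have h1 : ((-(ζ u).im : ℝ) : ℂ) * Complex.I = -ζ u := by
      apply Complex.ext <;> simp [h.1]
    rw [h1, mul_neg, sub_neg_eq_add, hζu]
    exact hu.1
  -- a root of `ζ u` gives a point over `u`
  have hroot : ∀ u ∈ D, ∀ z : ℂ, z ^ 2 = ζ u → z ∈ Metric.ball (0 : ℂ) ρ := fun u hu z hz => by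
    rw [mem_ball_zero_iff]
    refine lt_of_pow_lt_pow_left₀ 2 hρ.le ?_
    rw [← norm_pow, hz, hζ]
    beta_reduce
    rw [norm_div, div_lt_iff₀ (norm_pos_iff.2 hc), mul_comm]
    exact (mem_ball_iff_norm.1 hu).trans hε.2
  have hlift : ∀ (W : Set ℂ) (q : ℂ → ℂ), (∀ u ∈ W ∩ D, q (ζ u) ^ 2 = ζ u) →
      (∀ u ∈ W ∩ D, ContinuousAt q (ζ u)) → X.IsLift (W ∩ D) fun u => r (q (ζ u)) := by
    intro W q hq hqc
    refine ⟨hr1.comp (fun u hu => ContinuousAt.continuousWithinAt ?_)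
      fun u hu => hroot u hu.2 _ (hq u hu), fun u hu => ?_⟩
    · refine ContinuousAt.comp (hqc u hu) (ContinuousAt.div_const ?_ c)
      fun_prop
    · rw [hr3 _ (hroot u hu.2 _ (hq u hu)), hq u hu, hζu]
  have hre : ∀ w : ℂ, w.re ≠ 0 ∨ w.im < 0 → w ≠ 0 := by
    rintro w hw rfl
    simp at hw
  have hre' : ∀ w : ℂ, w.re ≠ 0 ∨ 0 < w.im → w ≠ 0 := by
    rintro w hw rfl
    simp at hw
  have hW : ∀ W : Set ℂ, (∀ u ∈ W ∩ D, (ζ u).re ≠ 0 ∨ (ζ u).im < 0) →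
      X.IsLift (W ∩ D) (fun u => r (q₁ (ζ u))) ∧ X.IsLift (W ∩ D) fun u => r (-q₁ (ζ u)) := by
    intro W h
    refine ⟨hlift W q₁ (fun u hu => hq₁ _ (hre _ (h u hu))) fun u hu => hq₁c _ (h u hu),
      hlift W (fun w => -q₁ w) (fun u hu => ?_) fun u hu => (hq₁c _ (h u hu)).neg⟩
    rw [neg_sq]
    exact hq₁ _ (hre _ (h u hu))
  have hW' : X.IsLift (K' ∩ D) fun u => r (q₂ (ζ u)) :=
    hlift K' q₂ (fun u hu => hq₂ _ (hre' _ (hKζ' u hu))) fun u hu => hq₂c _ (hKζ' u hu)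
  have hVl := (hW V fun u hu => .inl (hVζ u hu).ne).1
  have hVl' := (hW V' fun u hu => .inl (hVζ' u hu).ne').1
  obtain ⟨hKl, hKl'⟩ := hW K hKζ
  obtain ⟨u₁, hu₁D, hu₁V, hu₁K⟩ := mem_closure_iff_nhds.1 h₁ D hDn
  obtain ⟨u₂, hu₂D, hu₂V, hu₂K⟩ := mem_closure_iff_nhds.1 h₂ D hDn
  obtain ⟨u₃, hu₃D, hu₃V, hu₃K⟩ := mem_closure_iff_nhds.1 h₃ D hDn
  obtain ⟨u₄, hu₄D, hu₄V, hu₄K⟩ := mem_closure_iff_nhds.1 h₄ D hDn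
  -- a lift on `K ∩ D` is one of the sheets
  have hsheet : ∀ g, X.IsLift (K ∩ D) g → ∃ k, g u₁ = s k u₁ ∧ g u₃ = s k u₃ := by
    intro g hg
    obtain ⟨k, hk⟩ := hs.exists_eq u₁ hu₁K (g u₁) (hg.map_eq u₁ ⟨hu₁K, hu₁D⟩)
    exact ⟨k, hk.symm, hg.eqOn ((hs.isLift k).mono inter_subset_left)
      (hK.inter hDc).isPreconnected (fun v hv => hKB v hv.1) ⟨hu₁K, hu₁D⟩ hk.symm ⟨hu₃K, hu₃D⟩⟩
  have hsheet' : ∀ g, X.IsLift (K' ∩ D) g → ∃ j, g u₂ = s' j u₂ ∧ g u₄ = s' j u₄ := by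
    intro g hg
    obtain ⟨j, hj⟩ := hs'.exists_eq u₂ hu₂K (g u₂) (hg.map_eq u₂ ⟨hu₂K, hu₂D⟩)
    exact ⟨j, hj.symm, hg.eqOn ((hs'.isLift j).mono inter_subset_left)
      (hK'.inter hDc).isPreconnected (fun v hv => hKB' v hv.1) ⟨hu₂K, hu₂D⟩ hj.symm ⟨hu₄K, hu₄D⟩⟩
  -- the sheets `k` and `l` over `K` are given by the roots `±√ζ`; all others extend over `b`
  obtain ⟨k, hk₁, hk₃⟩ := hsheet _ hKl
  obtain ⟨l, hl₁, -⟩ := hsheet _ hKl'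
  obtain ⟨j, hj₂, hj₄⟩ := hsheet' _ hW'
  -- continuation of `√ζ` on the right ends in the branch `q₂` over `K'`, on the left in `-q₂`
  have hne : τ k ≠ τ' k := by
    have h5 : τ' k = j := hτ'.apply_eq hs' hV' hDc hVB' hVl' ⟨hu₃V, hu₃D⟩ hu₃K ⟨hu₄V, hu₄D⟩ hu₄K
      hk₃ (by rw [← hj₄]; exact congrArg r (hright _ (hVζ' _ ⟨hu₄V, hu₄D⟩)))
    obtain ⟨j', hj'⟩ := hs'.exists_eq u₂ hu₂K _ (hVl.map_eq u₂ ⟨hu₂V, hu₂D⟩)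
    have h6 : τ k = j' := hτ.apply_eq hs' hV hDc hVB hVl ⟨hu₁V, hu₁D⟩ hu₁K ⟨hu₂V, hu₂D⟩ hu₂K
      hk₁ hj'.symm
    rw [h5, h6]
    rintro rfl
    have hζ0 := hre' _ (hKζ' u₂ ⟨hu₂K, hu₂D⟩)
    exact hleft _ (hVζ _ ⟨hu₂V, hu₂D⟩) (hr2 (hroot u₂ hu₂D _ (hq₁ _ hζ0))
      (hroot u₂ hu₂D _ (hq₂ _ hζ0)) (hj'.symm.trans hj₂.symm))
  have hfix : ∀ i, i ≠ k → i ≠ l → τ i = τ' i := by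
    intro i hik hil
    rcases hεloc u₁ hu₁D (s i u₁) ((hs.isLift i).map_eq u₁ hu₁K) with
      ⟨z, hz, hzx, hzu⟩ | ⟨g, hg, hgu⟩
    · exfalso
      have h5 : z ^ 2 = q₁ (ζ u₁) ^ 2 := by
        rw [hq₁ _ (hre _ (hKζ u₁ ⟨hu₁K, hu₁D⟩))]
        exact mul_left_cancel₀ hc (add_left_cancel (hzu.symm.trans (hζu u₁).symm))
      rcases sq_eq_sq_iff_eq_or_eq_neg.1 h5 with rfl | rfl
      · exact hik (hs.injective u₁ hu₁K (hzx.symm.trans hk₁))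
      · exact hil (hs.injective u₁ hu₁K (hzx.symm.trans hl₁))
    · obtain ⟨i', hi₁, hi₃⟩ := hsheet g (hg.mono inter_subset_right)
      obtain rfl : i' = i := hs.injective u₁ hu₁K (hi₁.symm.trans hgu)
      obtain ⟨j', hj₂', hj₄'⟩ := hsheet' g (hg.mono inter_subset_right)
      rw [hτ.apply_eq hs' hV hDc hVB (hg.mono inter_subset_right) ⟨hu₁V, hu₁D⟩ hu₁K ⟨hu₂V, hu₂D⟩
        hu₂K hi₁ hj₂', hτ'.apply_eq hs' hV' hDc hVB' (hg.mono inter_subset_right) ⟨hu₃V, hu₃D⟩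
        hu₃K ⟨hu₄V, hu₄D⟩ hu₄K hi₃ hj₄']
  have h5 : Equiv.Perm.sign (τ⁻¹ * τ') = -1 := by
    refine sign_eq_neg_one_of_forall_eq (k := k) (l := l) (fun h => hne ?_) fun i hik hil => ?_
    · rw [inv_mul_eq_one.1 h]
    · rw [Equiv.Perm.mul_apply, ← hfix i hik hil]
      exact τ.symm_apply_apply i
  rw [← mul_inv_cancel_left τ τ', map_mul, h5, mul_neg, mul_one]

end Cover

variable (L) in
/-- The coordinates with respect to the periods. -/
theorem exists_coordinates : ∃ x y : ℂ →L[ℝ] ℝ, x L.ω₁ = 1 ∧ x L.ω₂ = 0 ∧ y L.ω₁ = 0 ∧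
    y L.ω₂ = 1 ∧ (∀ u, (x u : ℂ) * L.ω₁ + (y u : ℂ) * L.ω₂ = u) ∧
    ∀ v ∈ L.lattice, ∃ m n : ℤ, x v = m ∧ y v = n := by
  let x : ℂ →L[ℝ] ℝ := LinearMap.toContinuousLinearMap (L.basis.coord 0)
  let y : ℂ →L[ℝ] ℝ := LinearMap.toContinuousLinearMap (L.basis.coord 1)
  have hx : ∀ u, x u = L.basis.repr u 0 := fun u => rfl
  have hy : ∀ u, y u = L.basis.repr u 1 := fun u => rfl
  have h1 : L.basis.repr L.ω₁ = Finsupp.single 0 1 := by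
    rw [← L.basis_zero, Module.Basis.repr_self]
  have h2 : L.basis.repr L.ω₂ = Finsupp.single 1 1 := by
    rw [← L.basis_one, Module.Basis.repr_self]
  have hx1 : x L.ω₁ = 1 := by rw [hx, h1]; simp
  have hx2 : x L.ω₂ = 0 := by rw [hx, h2]; simp
  have hy1 : y L.ω₁ = 0 := by rw [hy, h1]; simp
  have hy2 : y L.ω₂ = 1 := by rw [hy, h2]; simp
  refine ⟨x, y, hx1, hx2, hy1, hy2, fun u => ?_, fun v hv => ?_⟩
  · rw [hx, hy]
    conv_rhs => rw [← L.basis.sum_repr u]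
    simp [Fin.sum_univ_two]
  · obtain ⟨m, n, rfl⟩ := PeriodPair.mem_lattice.1 hv
    refine ⟨m, n, ?_, ?_⟩
    · rw [← zsmul_eq_mul, ← zsmul_eq_mul, map_add, map_zsmul, map_zsmul, hx1, hx2]
      simp
    · rw [← zsmul_eq_mul, ← zsmul_eq_mul, map_add, map_zsmul, map_zsmul, hy1, hy2]
      simp

/-- The parity of the number `m` of branch points, when these are the points `(i + 1 / 2) / m` on
the line through the half period `ω₂ / 2` in the direction of `ω₁`. Transport of the sheets in the
direction of `ω₂`, through the strips `V i` between consecutive branch points, gives permutations `τ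
0, …, τ m`. Consecutive ones differ by a transposition, and translation by `ω₁` conjugates `τ m` to
`τ 0`. Comparison of the signs yields `(-1) ^ m = 1`. -/
theorem Cover.even_of_branchPoints_eq {X : Cover L} (hX : X.IsSimple 2) {d : ℕ}
    (hd : X.HasDegree d) {m : ℕ} (hm : m ≠ 0) (hbr : X.branchPoints = (fun i : ℕ =>
      (QuotientAddGroup.mk ((((i + 1 / 2) / m : ℝ) : ℂ) * L.ω₁ + ((1 / 2 : ℝ) : ℂ) * L.ω₂) :
        EllipticCurve L)) '' Iio m) : Even m := by
  obtain ⟨x, y, hx1, hx2, hy1, hy2, hxy, hlat⟩ := exists_coordinates L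
  have hmpos : (0 : ℝ) < m := by positivity
  have hxc : ∀ a b : ℝ, x ((a : ℂ) * L.ω₁ + (b : ℂ) * L.ω₂) = a := fun a b => by
    rw [← Complex.real_smul, ← Complex.real_smul, map_add, map_smul, map_smul, hx1, hx2]
    simp
  have hyc : ∀ a b : ℝ, y ((a : ℂ) * L.ω₁ + (b : ℂ) * L.ω₂) = b := fun a b => by
    rw [← Complex.real_smul, ← Complex.real_smul, map_add, map_smul, map_smul, hy1, hy2]
    simp
  set β : ℕ → ℂ := fun i =>
    (((i + 1 / 2) / m : ℝ) : ℂ) * L.ω₁ + ((1 / 2 : ℝ) : ℂ) * L.ω₂ with hβ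
  have hβx : ∀ i, m * x (β i) = i + 1 / 2 := fun i => by rw [hβ, hxc]; field_simp
  have hβy : ∀ i, y (β i) = 1 / 2 := fun i => hyc _ _
  -- the coordinates of the points over the branch points
  have hB : ∀ u : ℂ, (QuotientAddGroup.mk u : EllipticCurve L) ∈ X.branchPoints →
      ∃ N n : ℤ, m * x u = N + 1 / 2 ∧ y u = n + 1 / 2 := by
    intro u hu
    rw [hbr] at hu
    obtain ⟨i, -, hi⟩ := hu
    have hv : -β i + u ∈ L.lattice := QuotientAddGroup.eq.1 hi
    obtain ⟨p, n, hp, hn⟩ := hlat _ hv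
    rw [map_add, map_neg] at hp hn
    refine ⟨i + m * p, n, ?_, ?_⟩
    · push_cast
      have := hβx i
      linear_combination this + m * hp
    · linear_combination hβy i + hn
  let A : Set ℂ := y ⁻¹' Ioo (-(1 / 2)) (1 / 2)
  let A' : Set ℂ := y ⁻¹' Ioo (1 / 2) (3 / 2)
  let V : ℕ → Set ℂ := fun i => (m • x) ⁻¹' Ioo (i - 1 / 2) (i + 1 / 2)
  have hAy : ∀ u, u ∈ A ↔ -(1 / 2) < y u ∧ y u < 1 / 2 := fun _ => Iff.rfl
  have hAy' : ∀ u, u ∈ A' ↔ 1 / 2 < y u ∧ y u < 3 / 2 := fun _ => Iff.rfl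
  have hVx : ∀ i u, u ∈ V i ↔ i - 1 / 2 < m * x u ∧ m * x u < i + 1 / 2 := fun i u => by
    simp [V]
  have hA : Convex ℝ A := (convex_Ioo _ _).linear_preimage y.toLinearMap
  have hA' : Convex ℝ A' := (convex_Ioo _ _).linear_preimage y.toLinearMap
  have hV : ∀ i, Convex ℝ (V i) := fun i => (convex_Ioo _ _).linear_preimage (m • x).toLinearMap
  have hAo : IsOpen A := isOpen_Ioo.preimage y.continuous
  have hVo : ∀ i, IsOpen (V i) := fun i => isOpen_Ioo.preimage (m • x).continuous
  have hAB : ∀ u ∈ A, (QuotientAddGroup.mk u : EllipticCurve L) ∉ X.branchPoints := by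
    rintro u ⟨h1, h2⟩ hu
    obtain ⟨-, n, -, hn⟩ := hB u hu
    rw [hn] at h1 h2
    have h3 : (-1 : ℝ) < n := by linarith
    have h4 : (n : ℝ) < 0 := by linarith
    norm_cast at h3 h4
    omega
  have hAB' : ∀ u ∈ A', (QuotientAddGroup.mk u : EllipticCurve L) ∉ X.branchPoints := by
    rintro u ⟨h1, h2⟩ hu
    obtain ⟨-, n, -, hn⟩ := hB u hu
    rw [hn] at h1 h2
    have h3 : (0 : ℝ) < n := by linarith
    have h4 : (n : ℝ) < 1 := by linarith
    norm_cast at h3 h4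
    omega
  have hVB : ∀ i, ∀ u ∈ V i, (QuotientAddGroup.mk u : EllipticCurve L) ∉ X.branchPoints := by
    intro i u hu hu'
    obtain ⟨N, -, hN, -⟩ := hB u hu'
    obtain ⟨h1, h2⟩ := (hVx i u).1 hu
    rw [hN] at h1 h2
    have h3 : ((i : ℤ) : ℝ) < N + 1 := by push_cast; linarith
    have h4 : (N : ℝ) < (i : ℤ) := by push_cast; linarith
    norm_cast at h3 h4
    omega
  have h0A : (0 : ℂ) ∈ A := by
    rw [hAy, map_zero]
    norm_num
  have hA1 : ∀ u ∈ A, u + L.ω₁ ∈ A := fun u hu => by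
    rw [hAy, map_add, hy1, add_zero]
    exact hu
  have hA2 : ∀ u ∈ A', u + -L.ω₂ ∈ A := fun u hu => by
    rw [hAy, map_add, map_neg, hy2]
    constructor <;> linarith [hu.1, hu.2]
  obtain ⟨ℓ⟩ := hd.nonempty_equiv (hAB 0 h0A)
  obtain ⟨s, hs⟩ := X.exists_isSheets hA hAo hAB h0A ℓ
  have hs' : X.IsSheets A' fun k u => s k (u + -L.ω₂) :=
    hs.comp_add (L.lattice.neg_mem L.ω₂_mem_lattice) hA2
  have hs'' : X.IsSheets A fun k u => s k (u + L.ω₁) := hs.comp_add L.ω₁_mem_lattice hA1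
  -- the points of the grid at which lifts are compared
  have hgrid : ∀ i : ℕ, ∀ t : ℝ, (((i / m : ℝ) : ℂ) * L.ω₁ + (t : ℂ) * L.ω₂) ∈ V i := by
    intro i t
    rw [hVx, hxc, mul_div_cancel₀ _ hmpos.ne']
    constructor <;> linarith
  have hgridA : ∀ i : ℕ, ((((i / m : ℝ) : ℂ) * L.ω₁ + ((0 : ℝ) : ℂ) * L.ω₂)) ∈ A := by
    intro i
    rw [hAy, hyc]
    norm_num
  have hgridA' : ∀ i : ℕ, ((((i / m : ℝ) : ℂ) * L.ω₁ + ((1 : ℝ) : ℂ) * L.ω₂)) ∈ A' := by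
    intro i
    rw [hAy', hyc]
    norm_num
  choose τ hτ using fun i => X.exists_isTransport hs hs' (hV i) (hVo i) (hVB i) hA hA'
    ⟨_, hgrid i 0, hgridA i⟩ ⟨_, hgrid i 1, hgridA' i⟩
  obtain ⟨σ, hσ⟩ := X.exists_isTransport hs'' hs hA hAo hAB hA hA ⟨0, h0A, h0A⟩ ⟨0, h0A, h0A⟩
  have hσ' : ∀ k, ∀ u ∈ A, s k (u + L.ω₁) = s (σ k) u := fun k u hu => by
    obtain ⟨g, -, h1, h2⟩ := hσ k
    rw [← h2 ⟨hu, hu⟩, h1 ⟨hu, hu⟩]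
  -- translation by the first period conjugates the transport through `V m` to that through `V 0`
  have hconj : Equiv.Perm.sign (τ m) = Equiv.Perm.sign (τ 0) := by
    have h1 : τ 0 * σ = σ * τ m := by
      ext1 k
      obtain ⟨g, hg, hg1, hg2⟩ := hτ m k
      have h0 : ∀ u ∈ V 0, u + L.ω₁ ∈ V m := fun u hu => by
        rw [hVx] at hu ⊢
        rw [map_add, hx1, mul_add, mul_one]
        push_cast at hu
        constructor <;> linarith [hu.1, hu.2]
      have h2V : L.ω₂ ∈ V 0 := by
        rw [hVx, hx2]
        norm_num
      have h2A : L.ω₂ ∈ A' := by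
        rw [hAy', hy2]
        norm_num
      have h2A' : L.ω₂ + L.ω₁ ∈ A' := by
        rw [hAy', map_add, hy1, hy2]
        norm_num
      have h0V : (0 : ℂ) ∈ V 0 := by
        rw [hVx, map_zero]
        norm_num
      refine (hτ 0).apply_eq hs' (hV 0) convex_univ (hVB 0)
        (((hg.comp_add L.ω₁_mem_lattice h0)).mono inter_subset_left) ⟨h0V, mem_univ _⟩ h0A
        ⟨h2V, mem_univ _⟩ h2A ?_ ?_
      · rw [hg1 ⟨h0 _ h0V, hA1 _ h0A⟩, hσ' _ _ h0A]
      · rw [hg2 ⟨h0 _ h2V, h2A'⟩]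
        beta_reduce
        rw [add_right_comm, hσ' _ _ (hA2 _ h2A)]
        rfl
    have h2 := congrArg Equiv.Perm.sign h1
    rw [map_mul, map_mul, mul_comm] at h2
    exact (mul_left_cancel h2).symm
  have hstep : ∀ i < m, Equiv.Perm.sign (τ (i + 1)) = - Equiv.Perm.sign (τ i) := by
    intro i hi
    have hω₂ : L.ω₂ ≠ 0 := fun h => by
      rw [h, map_zero] at hy2
      exact zero_ne_one hy2
    -- with this choice `c * i = ω₂`: the rays in question point in the direction of `± ω₂`
    set c : ℂ := -Complex.I * L.ω₂ with hc
    have hc0 : c ≠ 0 := mul_ne_zero (neg_ne_zero.2 Complex.I_ne_zero) hω₂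
    have hcI : c * Complex.I = L.ω₂ := by
      rw [hc]
      linear_combination -L.ω₂ * Complex.I_sq
    have hbB : (QuotientAddGroup.mk (β i) : EllipticCurve L) ∈ X.branchPoints := by
      rw [hbr]
      exact mem_image_of_mem _ hi
    have hray : ∀ t : ℝ, y (c * (t * Complex.I)) = t := fun t => by
      have : c * (t * Complex.I) = t • L.ω₂ := by
        rw [Complex.real_smul]
        linear_combination (t : ℂ) * hcI
      rw [this, map_smul, hy2, smul_eq_mul, mul_one]
    have hKc : ∀ t : ℝ, 0 ≤ t → β i + c * (t * Complex.I) ∉ A := by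
      intro t ht h
      have := h.2
      rw [map_add, hβy, hray] at this
      linarith
    have hKc' : ∀ t : ℝ, 0 ≤ t → β i - c * (t * Complex.I) ∉ A' := by
      intro t ht h
      have := h.1
      rw [map_sub, hβy, hray] at this
      linarith
    -- left and right of the line through `β i` in the direction of the second period
    have hre : ∀ u, ((u - β i) / c).re = x (u - β i) * (L.ω₁ / c).re := fun u => by
      have h1 : (u - β i) / c = (x (u - β i) : ℂ) * (L.ω₁ / c) +
          (y (u - β i) : ℂ) * Complex.I := by
        conv_lhs => rw [← hxy (u - β i), ← hcI]
        field_simp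
      rw [h1]
      simp
    have hθ : (L.ω₁ / c).re ≠ 0 := by
      intro h
      have h1 : L.ω₁ = (L.ω₁ / c).im • L.ω₂ := by
        have h2 : ((L.ω₁ / c).im : ℂ) * Complex.I = L.ω₁ / c := by
          apply Complex.ext <;> simp [h]
        rw [Complex.real_smul, ← hcI, mul_left_comm, h2, mul_div_cancel₀ _ hc0]
      have h2 := congrArg x h1
      rw [map_smul, hx1, hx2] at h2
      simp at h2
    have hleft : ∀ u ∈ V i, x (u - β i) < 0 := fun u hu => by
      have h1 := ((hVx i u).1 hu).2
      have h2 := hβx i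
      rw [map_sub]
      have : m * x u < m * x (β i) := by linarith
      linarith [lt_of_mul_lt_mul_left this hmpos.le]
    have hright : ∀ u ∈ V (i + 1), 0 < x (u - β i) := fun u hu => by
      have h1 := ((hVx (i + 1) u).1 hu).1
      have h2 := hβx i
      push_cast at h1
      rw [map_sub]
      have : m * x (β i) < m * x u := by linarith
      linarith [lt_of_mul_lt_mul_left this hmpos.le]
    have hcl : ∀ (W : Set ℂ) (v : ℂ), (∀ t ∈ Ioo (0 : ℝ) (1 / m), β i + t • v ∈ W) →
        β i ∈ closure W := by
      intro W v hW
      refine mem_closure_of_tendsto (f := fun t : ℝ => β i + t • v) (b := 𝓝[>] 0) ?_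
        (mem_of_superset (Ioo_mem_nhdsGT (by positivity)) hW)
      have : ContinuousAt (fun t : ℝ => β i + t • v) 0 := by fun_prop
      have h1 := this.tendsto.mono_left (nhdsWithin_le_nhds (s := Ioi 0))
      simpa using h1
    have hm1 : (1 : ℝ) ≤ m := by exact_mod_cast Nat.one_le_iff_ne_zero.2 hm
    have hpt : ∀ t ∈ Ioo (0 : ℝ) (1 / m), ∀ v, m * x (β i + t • v) = i + 1 / 2 + (m * t) * x v ∧
        y (β i + t • v) = 1 / 2 + t * y v ∧ 0 < m * t ∧ m * t < 1 ∧ 0 < t ∧ t < 1 := by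
      intro t ht v
      have h1 : m * t < 1 := by
        have := mul_lt_mul_of_pos_left ht.2 hmpos
        rwa [mul_one_div_cancel hmpos.ne'] at this
      have h2 : 0 < m * t := mul_pos hmpos ht.1
      refine ⟨?_, ?_, h2, h1, ht.1, ?_⟩
      · rw [map_add, map_smul, mul_add, hβx, smul_eq_mul, mul_assoc]
      · rw [map_add, map_smul, hβy, smul_eq_mul]
      · nlinarith [ht.1]
    have h₁ : β i ∈ closure (V i ∩ A) := hcl _ (-L.ω₁ - L.ω₂) fun t ht => by
      obtain ⟨h1, h2, h3, h4, h5, h6⟩ := hpt t ht (-L.ω₁ - L.ω₂)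
      rw [map_sub, map_neg, hx1, hx2] at h1
      rw [map_sub, map_neg, hy1, hy2] at h2
      exact ⟨(hVx _ _).2 ⟨by linarith, by linarith⟩, by linarith, by linarith⟩
    have h₂ : β i ∈ closure (V i ∩ A') := hcl _ (-L.ω₁ + L.ω₂) fun t ht => by
      obtain ⟨h1, h2, h3, h4, h5, h6⟩ := hpt t ht (-L.ω₁ + L.ω₂)
      rw [map_add x (-L.ω₁), map_neg, hx1, hx2] at h1
      rw [map_add y (-L.ω₁), map_neg, hy1, hy2] at h2
      exact ⟨(hVx _ _).2 ⟨by linarith, by linarith⟩, by linarith, by linarith⟩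
    have h₃ : β i ∈ closure (V (i + 1) ∩ A) := hcl _ (L.ω₁ - L.ω₂) fun t ht => by
      obtain ⟨h1, h2, h3, h4, h5, h6⟩ := hpt t ht (L.ω₁ - L.ω₂)
      rw [map_sub, hx1, hx2] at h1
      rw [map_sub, hy1, hy2] at h2
      exact ⟨(hVx _ _).2 ⟨by push_cast; linarith, by push_cast; linarith⟩, by linarith, by linarith⟩
    have h₄ : β i ∈ closure (V (i + 1) ∩ A') := hcl _ (L.ω₁ + L.ω₂) fun t ht => by
      obtain ⟨h1, h2, h3, h4, h5, h6⟩ := hpt t ht (L.ω₁ + L.ω₂)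
      rw [map_add x L.ω₁, hx1, hx2] at h1
      rw [map_add y L.ω₁, hy1, hy2] at h2
      exact ⟨(hVx _ _).2 ⟨by push_cast; linarith, by push_cast; linarith⟩, by linarith, by linarith⟩
    -- the orientation of the periods decides on which side of the line the strip `V i` lies
    rcases hθ.lt_or_gt with hθ | hθ
    · rw [(hτ (i + 1)).sign_eq_neg hX (hτ i) hs hs' hA hA' (hV _) (hV _) hAB hAB' (hVB _) (hVB _)
        hbB hc0 hKc hKc' (fun u hu => by rw [hre]; exact mul_neg_of_pos_of_neg (hright u hu) hθ)
        (fun u hu => by rw [hre]; exact mul_pos_of_neg_of_neg (hleft u hu) hθ) h₃ h₄ h₁ h₂, neg_neg]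
    · exact (hτ i).sign_eq_neg hX (hτ (i + 1)) hs hs' hA hA' (hV _) (hV _) hAB hAB' (hVB _) (hVB _)
        hbB hc0 hKc hKc' (fun u hu => by rw [hre]; exact mul_neg_of_neg_of_pos (hleft u hu) hθ)
        (fun u hu => by rw [hre]; exact mul_pos (hright u hu) hθ) h₁ h₂ h₃ h₄
  have hind : ∀ i ≤ m, Equiv.Perm.sign (τ i) = (-1) ^ i * Equiv.Perm.sign (τ 0) := by
    intro i
    induction i with
    | zero => simp
    | succ i ih =>
      intro hi
      rw [hstep i hi, ih (by omega), pow_succ]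
      simp
  have h1 := hind m le_rfl
  rw [hconj, eq_comm, mul_eq_right] at h1
  exact (neg_one_pow_eq_one_iff_even (by decide)).1 h1

/-- The number of branch points of a simple cover is even. Since existence of covers depends only on
the number of branch points, these may be assumed to lie on a line. -/
theorem even_card_of_nonempty {B : Finset (EllipticCurve L)} {d : ℕ}
    (h : (simpleCovers (B : Set (EllipticCurve L)) d).Nonempty) : Even B.card := by
  classical
  rcases eq_or_ne B.card 0 with hm | hm
  · rw [hm]
    exact Even.zero
  obtain ⟨x, y, hx1, hx2, -, -, -, hlat⟩ := exists_coordinates L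
  set m := B.card with hmB
  let F : ℕ → EllipticCurve L := fun i =>
    QuotientAddGroup.mk ((((i + 1 / 2) / m : ℝ) : ℂ) * L.ω₁ + ((1 / 2 : ℝ) : ℂ) * L.ω₂)
  -- the `ω₁`-coordinates of the points differ by less than `1`
  have hinj : InjOn F (Finset.range m) := by
    intro i hi j hj hij
    rw [Finset.coe_range, mem_Iio] at hi hj
    obtain ⟨n, -, hn, -⟩ := hlat _ (QuotientAddGroup.eq.1 hij)
    rw [← Complex.real_smul, ← Complex.real_smul, ← Complex.real_smul] at hn
    simp only [map_add, map_neg, map_smul, hx1, hx2, smul_eq_mul] at hn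
    have hmpos : (m : ℝ) ≠ 0 := by exact_mod_cast hm
    field_simp at hn
    have h1 : (j : ℝ) - i = m * n := by linarith
    have h2 : (j : ℤ) - i = m * n := by exact_mod_cast h1
    have h3 : n < 1 := by
      by_contra! h
      nlinarith
    have h4 : -1 < n := by
      by_contra! h
      nlinarith
    obtain rfl : n = 0 := by omega
    omega
  let B₀ := (Finset.range m).image F
  have hcard : B.card = B₀.card := by
    rw [Finset.card_image_of_injOn hinj, Finset.card_range]
  have h2 := congrFun (congrArg (fun z => z.2.2) (countInvariants_eq_of_card_eq hcard)) d
  obtain ⟨X, hX⟩ : (simpleCovers (B₀ : Set (EllipticCurve L)) d).Nonempty := h2.mp h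
  refine Cover.even_of_branchPoints_eq hX.1 hX.2.2 hm ?_
  rw [hX.2.1, Finset.coe_image, Finset.coe_range]

/-! ### Comparison of the generating series -/

instance : Infinite (EllipticCurve L) :=
  ⟨fun _ => (isPathConnected_compl (L := L) finite_univ).nonempty.ne_empty compl_univ⟩

theorem simpleCovers_of_not_even {B : Finset (EllipticCurve L)} (hB : ¬ Even B.card) (d : ℕ) :
    simpleCovers (B : Set (EllipticCurve L)) d = ∅ :=
  not_nonempty_iff_eq_empty.1 fun h => hB (even_card_of_nonempty h)

variable (L) in
/-- The numbers of covers depend only on the number `k` of branch points and on the degree `d`. They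
are related by splitting off one component. -/
theorem exists_hurwitz_numbers : ∃ a b : ℕ → ℕ → ℚ,
    (∀ (B : Finset (EllipticCurve L)) d,
      weightedCount (connectedSimpleCovers (B : Set (EllipticCurve L)) d) = a B.card d) ∧
    (∀ (B : Finset (EllipticCurve L)) d,
      weightedCount (simpleCovers (B : Set (EllipticCurve L)) d) = b B.card d) ∧
    b 0 0 = 1 ∧ (∀ k, k ≠ 0 → b k 0 = 0) ∧ (∀ k d, ¬ Even k → a k d = 0 ∧ b k d = 0) ∧
    ∀ k n : ℕ, (n + 1 : ℚ) * b k (n + 1) = ∑ p ∈ Finset.HasAntidiagonal.antidiagonal n,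
      ∑ q ∈ Finset.HasAntidiagonal.antidiagonal k,
        k.choose q.1 * ((p.1 + 1 : ℚ) * a q.1 (p.1 + 1) * b q.2 p.2) := by
  classical
  choose P hP using fun k => Infinite.exists_subset_card_eq (EllipticCurve L) k
  have ha : ∀ (B : Finset (EllipticCurve L)) d,
      weightedCount (connectedSimpleCovers (B : Set (EllipticCurve L)) d) =
        weightedCount (connectedSimpleCovers (P B.card : Set (EllipticCurve L)) d) := fun B d =>
    congrFun (congrArg Prod.fst (countInvariants_eq_of_card_eq (hP B.card).symm)) d
  have hb : ∀ (B : Finset (EllipticCurve L)) d,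
      weightedCount (simpleCovers (B : Set (EllipticCurve L)) d) =
        weightedCount (simpleCovers (P B.card : Set (EllipticCurve L)) d) := fun B d =>
    congrFun (congrArg (fun z => z.2.1) (countInvariants_eq_of_card_eq (hP B.card).symm)) d
  refine ⟨fun k d => weightedCount (connectedSimpleCovers (P k : Set (EllipticCurve L)) d),
    fun k d => weightedCount (simpleCovers (P k : Set (EllipticCurve L)) d), ha, hb, ?_, ?_, ?_, ?_⟩
  · have h : P 0 = ∅ := Finset.card_eq_zero.1 (hP 0)
    beta_reduce
    rw [h, Finset.coe_empty, weightedCount_simpleCovers_empty_zero]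
  · intro k hk
    have hne : (P k : Set (EllipticCurve L)).Nonempty := by
      rw [Finset.coe_nonempty, ← Finset.card_ne_zero, hP]
      exact hk
    beta_reduce
    rw [simpleCovers_zero_of_nonempty (P k).finite_toSet hne, weightedCount_empty]
  · intro k d hk
    have h1 := simpleCovers_of_not_even (B := P k) (by rwa [hP]) d
    have h2 : connectedSimpleCovers (P k : Set (EllipticCurve L)) d = ∅ :=
      subset_empty_iff.1 fun X hX => h1.subset hX.1
    beta_reduce
    rw [h1, h2]
    exact ⟨weightedCount_empty, weightedCount_empty⟩
  · intro k n
    have h := mul_weightedCount (P k) (n + 1)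
    push_cast at h
    beta_reduce
    rw [h, Finset.sum_range_succ', Finset.Nat.sum_antidiagonal_eq_sum_range_succ_mk]
    simp only [Nat.cast_zero, zero_mul, Finset.sum_const_zero, add_zero, Nat.cast_add,
      Nat.cast_one, Nat.add_sub_add_right]
    refine Finset.sum_congr rfl fun e _ => ?_
    have h2 : ∀ S ∈ (P k).powerset,
        ((e : ℚ) + 1) * weightedCount (connectedSimpleCovers (S : Set (EllipticCurve L)) (e + 1)) *
          weightedCount (simpleCovers ((P k : Set (EllipticCurve L)) \ S) (n - e)) =
        ((e : ℚ) + 1) * weightedCount (connectedSimpleCovers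
          (P S.card : Set (EllipticCurve L)) (e + 1)) *
          weightedCount (simpleCovers (P (k - S.card) : Set (EllipticCurve L)) (n - e)) := by
      intro S hS
      rw [ha S, ← Finset.coe_sdiff, hb (P k \ S),
        Finset.card_sdiff_of_subset (Finset.mem_powerset.1 hS), hP]
    rw [Finset.sum_congr rfl h2, Finset.sum_powerset_apply_card (fun m => ((e : ℚ) + 1) *
      weightedCount (connectedSimpleCovers (P m : Set (EllipticCurve L)) (e + 1)) *
      weightedCount (simpleCovers (P (k - m) : Set (EllipticCurve L)) (n - e))), hP,
      Finset.Nat.sum_antidiagonal_eq_sum_range_succ_mk]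
    simp only [nsmul_eq_mul]

/-- The coefficients at odd powers of `λ`, which the definition of `partitionFunction` sets to zero,
follow the same formula as the others because there are no covers with an odd number of branch
points. -/
theorem coeff_partitionFunction_of_pos {N : ℕ → ℕ → ℚ} {a : ℕ → ℕ → ℚ}
    (h : ∀ g d, 1 ≤ g → 1 ≤ d → N g d = a (2 * g - 2) d) (h' : ∀ k d, ¬ Even k → a k d = 0)
    {n : Fin 2 →₀ ℕ} (hn : 1 ≤ n 0) :
    MvPowerSeries.coeff n (partitionFunction N) = a (n 1) (n 0) / (n 1).factorial := by
  rw [MvPowerSeries.coeff_apply, partitionFunction]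
  by_cases hev : Even (n 1)
  · rw [if_pos ⟨hn, hev⟩, h _ _ (by omega) hn]
    obtain ⟨r, hr⟩ := hev
    rw [show 2 * (n 1 / 2 + 1) - 2 = n 1 by omega]
  · rw [if_neg (fun h => hev h.2), h' _ _ hev, zero_div]

/-- With respect to `q`, both sides solve the differential equation `∂ G = ∂ Z * G`, and they have
the same terms at `q ^ 0`. -/
theorem one_add_ZHat_eq {B B' : ℕ → Finset (EllipticCurve L)}
    (hB : ∀ g, 1 ≤ g → (B g).card = 2 * g - 2) (hB' : ∀ g, 1 ≤ g → (B' g).card = 2 * g - 2) :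
    1 + ZHat B' = (PowerSeries.exp ℚ).subst (Z B) := by
  classical
  obtain ⟨a, b, ha, hb, hb0, hb0', hev, hrec⟩ := exists_hurwitz_numbers L
  have hZ : PowerSeries.HasSubst (Z B) := hasSubst_partitionFunction _
  have hZc : ∀ n : Fin 2 →₀ ℕ, 1 ≤ n 0 →
      MvPowerSeries.coeff n (Z B) = a (n 1) (n 0) / (n 1).factorial := fun n hn =>
    coeff_partitionFunction_of_pos (fun g d hg _ => by
      rw [connectedCovers_eq hg (hB g hg), ha, hB g hg]) (fun k d hk => (hev k d hk).1) hn
  have hZ0 : ∀ n : Fin 2 →₀ ℕ, n 0 = 0 → MvPowerSeries.coeff n (Z B) = 0 := fun n hn => by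
    rw [Z, MvPowerSeries.coeff_apply, partitionFunction, if_neg (fun h' => by have := h'.1; omega)]
  have h1 : ∀ n : Fin 2 →₀ ℕ, n = 0 ↔ n 0 = 0 ∧ n 1 = 0 := fun n => by
    constructor
    · rintro rfl
      exact ⟨rfl, rfl⟩
    · rintro ⟨h, h'⟩
      ext j
      fin_cases j
      exacts [h, h']
  have hWc : ∀ n : Fin 2 →₀ ℕ,
      MvPowerSeries.coeff n (1 + ZHat B') = b (n 1) (n 0) / (n 1).factorial := by
    intro n
    have h2 : n 0 = 0 → MvPowerSeries.coeff n (ZHat B') = 0 := fun hn => by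
      rw [ZHat, MvPowerSeries.coeff_apply, partitionFunction,
        if_neg (fun h' => by have := h'.1; omega)]
    rw [map_add, MvPowerSeries.coeff_one]
    rcases Nat.eq_zero_or_pos (n 0) with hn | hn
    · rw [h2 hn, hn, add_zero]
      by_cases h : n 1 = 0
      · rw [if_pos ((h1 n).2 ⟨hn, h⟩), h, hb0]
        simp
      · rw [if_neg fun h' => h ((h1 n).1 h').2, hb0' _ h, zero_div]
    · rw [if_neg fun h' => hn.ne' ((h1 n).1 h').1, zero_add]
      exact coeff_partitionFunction_of_pos (fun g d hg _ => by
        rw [possiblyDisconnectedCovers_eq hg (hB' g hg), hb, hB' g hg])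
        (fun k d hk => (hev k d hk).2) hn
  -- the factorials turn the binomial convolution in the recursion into a product of series
  have hW : MvPowerSeries.pderiv ℚ 0 (1 + ZHat B') =
      MvPowerSeries.pderiv ℚ 0 (Z B) * (1 + ZHat B') := by
    ext m
    rw [MvPowerSeries.coeff_pderiv, hWc, coeff_mul_fin_two]
    simp only [MvPowerSeries.coeff_pderiv, hWc]
    have h2 : (m + Finsupp.single 0 1 : Fin 2 →₀ ℕ) 0 = m 0 + 1 := by simp
    have h3 : (m + Finsupp.single 0 1 : Fin 2 →₀ ℕ) 1 = m 1 := by simp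
    rw [h2, h3, div_mul_eq_mul_div, mul_comm (b _ _), hrec, Finset.sum_div]
    refine Finset.sum_congr rfl fun p _ => ?_
    rw [Finset.sum_div]
    refine Finset.sum_congr rfl fun q hq => ?_
    rw [hZc _ (by simp)]
    have hq' := Finset.HasAntidiagonal.mem_antidiagonal.1 hq
    have h4 := Nat.choose_mul_factorial_mul_factorial (n := m 1) (k := q.1) (by omega)
    rw [show m 1 - q.1 = q.2 by omega] at h4
    have h5 : (q.1.factorial : ℚ) ≠ 0 := by positivity
    have h6 : (q.2.factorial : ℚ) ≠ 0 := by positivity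
    have h7 : ((m 1).choose q.1 : ℚ) ≠ 0 := by
      exact_mod_cast (Nat.choose_pos (by omega)).ne'
    rw [← h4]
    simp
    field_simp
  rw [← sub_eq_zero]
  refine eq_zero_of_pderiv_eq (F := MvPowerSeries.pderiv ℚ 0 (Z B)) (s := 0) ?_ ?_
  · rw [map_sub, hW, pderiv_exp_subst hZ, mul_sub]
  · intro n hn
    rw [map_sub, hWc, PowerSeries.coeff_subst hZ, finsum_eq_single _ 0]
    · by_cases h : n 1 = 0
      · rw [(h1 n).2 ⟨hn, h⟩]
        simp [hb0]
      · rw [hn, hb0' _ h, pow_zero, MvPowerSeries.coeff_one, if_neg fun h' => h ((h1 n).1 h').2]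
        simp
    · intro k hk
      obtain ⟨k, rfl⟩ := Nat.exists_eq_succ_of_ne_zero hk
      rw [pow_succ, MvPowerSeries.coeff_mul, Finset.sum_eq_zero, smul_zero]
      intro p hp
      have h2 : p.1 0 + p.2 0 = n 0 := by
        rw [← Finset.HasAntidiagonal.mem_antidiagonal.1 hp, Finsupp.add_apply]
      rw [hZ0 p.2 (by omega), mul_zero]

end BranchedCover

end

theorem mainTheorem8 (L : PeriodPair)
    (B B' : ℕ → Finset (BranchedCover.EllipticCurve L))
    (hB : ∀ g, 1 ≤ g → (B g).card = 2 * g - 2)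
    (hB' : ∀ g, 1 ≤ g → (B' g).card = 2 * g - 2) :
    (∀ g d, 1 ≤ g → 1 ≤ d →
      Finite (BranchedCover.IsoClasses (BranchedCover.connectedCovers (B g) g d)) ∧
      Finite (BranchedCover.IsoClasses (BranchedCover.possiblyDisconnectedCovers (B' g) g d)) ∧
      (∀ X ∈ BranchedCover.connectedCovers (B g) g d, Finite X.Aut) ∧
      (∀ X ∈ BranchedCover.possiblyDisconnectedCovers (B' g) g d, Finite X.Aut)) ∧
    BranchedCover.ZHat B' =
      (PowerSeries.exp ℚ).subst (BranchedCover.Z B) - 1 := by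
  refine ⟨fun g d hg _ => ?_, ?_⟩
  · rw [BranchedCover.connectedCovers_eq hg (hB g hg),
      BranchedCover.possiblyDisconnectedCovers_eq hg (hB' g hg)]
    exact ⟨BranchedCover.finite_isoClasses_connectedSimpleCovers (B g).finite_toSet d,
      BranchedCover.finite_isoClasses_simpleCovers (B' g).finite_toSet d,
      fun X hX => BranchedCover.finite_aut_of_mem_simpleCovers (B g).finite_toSet X hX.1,
      BranchedCover.finite_aut_of_mem_simpleCovers (B' g).finite_toSet⟩
  · rw [← BranchedCover.one_add_ZHat_eq hB hB', add_sub_cancel_left]
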